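/- Let $\Omega\subset\mathbb R^2$ be a bounded domain whose boundary $\Gamma$ is a simple closed polygon, divided into finitely many straight edges. Each edge is of exactly one of three types: clamped, simply supported, or free. Let $\Gamma_c,\Gamma_s,\Gamma_f$ be the unions of the edges of the respective types, and assume that there is at least one clamped edge. Let $n=(n_1,n_2)$ be the outer unit normal and $t=(-n_2,n_1)$ the counterclockwise unit tangent on $\Gamma$. Boundary values are understood in the sense of traces. Put $$Q=\{q\in H^1(\Omega): q=0\text{ on }\Gamma_c\cup\Gamma_s\},\qquad W=\{v\in H^2(\Omega): v=\tfrac{\partial v}{\partial n}=0\text{ on }\Gamma_c,\ v=0\text{ on }\Gamma_s\}.$$ For $\psi\in (H^1(\Omega))^2$ let $\operatorname{Curl}\psi$ be the matrix with rows $(\partial_2\psi_a,-\partial_1\psi_a)$, $a=1,2$, and let $\frac{\partial\psi}{\partial t}=(\operatorname{Curl}\psi)\,n\in (H^{-1/2}(\Gamma))^2$, that is, $\langle\frac{\partial\psi}{\partial t},\xi\rangle_\Gamma=\int_\Omega\operatorname{Curl}\psi:\nabla\xi\,dx$ for $\xi\in(H^1(\Omega))^2$. For $q\in Q$ let $\Psi_q$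 be the set of all $\psi\in(H^1(\Omega))^2$ that satisfy the coupling condition $$\Big\langle\frac{\partial\psi}{\partial t},\nabla v\Big\rangle_\Gamma=-\int_\Gamma q\,\frac{\partial v}{\partial n}\,ds\qquad\text{for all }v\in W,$$ and let $V=\{(q,\psi)\in Q\times(H^1(\Omega))^2:\psi\in\Psi_q\}$. Fix a clamped edge $E$ with end points $x_A,x_B$, ordered counterclockwise, and let $\gamma$ be the counterclockwise arc length parametrization of $\Gamma$ with $\gamma(0)=x_B$. For $q\in Q$ define $\psi_\Gamma[q]:\Gamma\to\mathbb R^2$ on $\Gamma\setminus E$ by $$\psi_\Gamma[q](\gamma(\sigma))=-\int_0^\sigma q\,n\,ds,$$ and on $E$ by linear interpolation of its values at $x_A$ and $x_B$. Let $\psi[q]\in(H^1(\Omega))^2$ be the harmonic extension of $\psi_\Gamma[q]$, that is, the function with trace $\psi_\Gamma[q]$ on $\Gamma$ whose components are weakly harmonic in $\Omega$. Then for each $q\in Q$ the function $\psi[q]$ is well defined (it exists and is unique), and $\psi[q]\in\Psi_q$. Moreover, $V$ is the direct sum of two linear subspaces, $$V=V_0\oplus V_1,\qquad V_0=\{0\}\times\Psi_0,\qquad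 V_1=\{(q,\psi[q]):q\in Q\},$$ and there is a constant $c>0$ such that $\|\psi[q]\|_1\le c\,\|q\|_1$ for all $q\in Q$, where $\|\cdot\|_1$ is the $H^1(\Omega)$-norm. -/

import Mathlib

open MeasureTheory Set Filter Topology
open scoped ContDiff

noncomputable section

namespace Plate

/-- The Euclidean plane. -/
abbrev Plane := EuclideanSpace ℝ (Fin 2)

/-- Classical partial derivative `∂_i φ`. -/
def pderiv (i : Fin 2) (φ : Plane → ℝ) (x : Plane) : ℝ :=
  fderiv ℝ φ x (EuclideanSpace.single i 1)

/-! ### Smooth functions and Sobolev spaces -/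

/-- `C_c^∞(ℝ²)`; the restrictions of these functions to a bounded `Ω` are exactly the
restrictions of functions in `C^∞(ℝ²)`. -/
def Smooth : Submodule ℝ (Plane → ℝ) where
  carrier := {φ | ContDiff ℝ ∞ φ ∧ HasCompactSupport φ}
  add_mem' := fun ha hb => ⟨ha.1.add hb.1, ha.2.add hb.2⟩
  zero_mem' := ⟨contDiff_const, HasCompactSupport.zero⟩
  smul_mem' := fun c _ ha => ⟨contDiff_const.smul ha.1, ha.2.smul_left (f := fun _ => c)⟩

theorem Smooth.continuous_pderiv {φ : Plane → ℝ} (h : φ ∈ Smooth) (i : Fin 2) :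
    Continuous (pderiv i φ) :=
  (h.1.continuous_fderiv (by simp)).clm_apply continuous_const

theorem Smooth.hasCompactSupport_pderiv {φ : Plane → ℝ} (h : φ ∈ Smooth) (i : Fin 2) :
    HasCompactSupport (pderiv i φ) := by
  refine (h.2.fderiv (𝕜 := ℝ)).mono' ?_
  intro x hx
  refine subset_closure ?_
  intro h0
  apply hx
  simp [pderiv, h0]

theorem Smooth.memLp {φ : Plane → ℝ} (h : φ ∈ Smooth) (Ω : Set Plane) :
    MemLp φ 2 (volume.restrict Ω) :=
  (h.1.continuous.memLp_of_hasCompactSupport h.2).restrict Ω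

theorem Smooth.memLp_pderiv {φ : Plane → ℝ} (h : φ ∈ Smooth) (Ω : Set Plane) (i : Fin 2) :
    MemLp (pderiv i φ) 2 (volume.restrict Ω) :=
  ((Smooth.continuous_pderiv h i).memLp_of_hasCompactSupport
    (Smooth.hasCompactSupport_pderiv h i)).restrict Ω

theorem pderiv_add {φ χ : Plane → ℝ} (h : φ ∈ Smooth) (h' : χ ∈ Smooth) (i : Fin 2) :
    pderiv i (φ + χ) = pderiv i φ + pderiv i χ := by
  funext x
  have h1 : DifferentiableAt ℝ φ x := (h.1.differentiable (by simp)).differentiableAt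
  have h2 : DifferentiableAt ℝ χ x := (h'.1.differentiable (by simp)).differentiableAt
  simp [pderiv, fderiv_add h1 h2]

theorem pderiv_smul {φ : Plane → ℝ} (h : φ ∈ Smooth) (c : ℝ) (i : Fin 2) :
    pderiv i (c • φ) = c • pderiv i φ := by
  funext x
  have h1 : DifferentiableAt ℝ φ x := (h.1.differentiable (by simp)).differentiableAt
  simp [pderiv, fderiv_const_smul h1 c]

/-- `L²(Ω)`. -/
abbrev L2 (Ω : Set Plane) := Lp ℝ 2 (volume.restrict Ω)

/-- Test functions on `Ω`, i.e. `C_c^∞(Ω)`. -/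
def IsTest (Ω : Set Plane) (φ : Plane → ℝ) : Prop := φ ∈ Smooth ∧ tsupport φ ⊆ Ω

/-- `g` is the weak partial derivative `∂_i u` on `Ω`. -/
def IsWeakPartial (Ω : Set Plane) (i : Fin 2) (u g : L2 Ω) : Prop :=
  ∀ φ : Plane → ℝ, IsTest Ω φ →
    ∫ x in Ω, u x * pderiv i φ x = - ∫ x in Ω, g x * φ x

/-- The Sobolev space `H¹(Ω)`: an element is a function `u ∈ L²(Ω)` together with its weak gradient
`∇u ∈ L²(Ω)²` (for open `Ω` the gradient is determined by `u`, see `H1.ext_fn`). The norm inherited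
from the Hilbert sum `L²(Ω) ⊕ L²(Ω)²` is the standard one, `‖u‖₁² = ‖u‖₀² + ‖∇u‖₀²`. -/
def H1 (Ω : Set Plane) : Submodule ℝ (WithLp 2 (L2 Ω × PiLp 2 (fun _ : Fin 2 => L2 Ω))) where
  carrier := {p | ∀ i, IsWeakPartial Ω i p.fst (p.snd i)}
  zero_mem' := by
    intro i φ _
    have key : ∀ χ : Plane → ℝ, ∫ x in Ω, (0 : L2 Ω) x * χ x = 0 := by
      intro χ
      refine integral_eq_zero_of_ae ?_
      filter_upwards [Lp.coeFn_zero ℝ 2 (volume.restrict Ω)] with x hx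
      rw [hx]
      simp
    change ∫ x in Ω, (0 : L2 Ω) x * pderiv i φ x = - ∫ x in Ω, (0 : L2 Ω) x * φ x
    rw [key, key, neg_zero]
  add_mem' := by
    intro a b ha hb i φ hφ
    have key : ∀ (u w : L2 Ω) (χ : Plane → ℝ), MemLp χ 2 (volume.restrict Ω) →
        ∫ x in Ω, (u + w) x * χ x = (∫ x in Ω, u x * χ x) + ∫ x in Ω, w x * χ x := by
      intro u w χ hχ
      refine Eq.trans (integral_congr_ae ?_)
        (integral_add ((Lp.memLp u).integrable_mul hχ) ((Lp.memLp w).integrable_mul hχ))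
      filter_upwards [Lp.coeFn_add u w] with x hx
      rw [hx]
      simp only [Pi.add_apply, add_mul]
    have e1 := ha i φ hφ
    have e2 := hb i φ hφ
    have k1 := key a.fst b.fst _ (Smooth.memLp_pderiv hφ.1 Ω i)
    have k2 := key (a.snd i) (b.snd i) _ (Smooth.memLp hφ.1 Ω)
    change ∫ x in Ω, (a.fst + b.fst) x * pderiv i φ x
      = - ∫ x in Ω, (a.snd i + b.snd i) x * φ x
    rw [k1, k2, e1, e2]
    ring
  smul_mem' := by
    intro c a ha i φ hφ
    have key : ∀ (u : L2 Ω) (χ : Plane → ℝ),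
        ∫ x in Ω, (c • u) x * χ x = c * ∫ x in Ω, u x * χ x := by
      intro u χ
      rw [← integral_const_mul]
      refine integral_congr_ae ?_
      filter_upwards [Lp.coeFn_smul c u] with x hx
      rw [hx]
      simp only [Pi.smul_apply, smul_eq_mul, mul_assoc]
    have e1 := ha i φ hφ
    change ∫ x in Ω, (c • a.fst) x * pderiv i φ x = - ∫ x in Ω, (c • a.snd i) x * φ x
    rw [key, key, e1]
    ring

/-- The function underlying an element of `H¹(Ω)`. -/
def H1.fn {Ω : Set Plane} (u : H1 Ω) : L2 Ω := u.1.fst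

/-- The weak partial derivative `∂_i u` of an element of `H¹(Ω)`. -/
def H1.d {Ω : Set Plane} (u : H1 Ω) (i : Fin 2) : L2 Ω := u.1.snd i

theorem H1.d_add {Ω : Set Plane} (u w : H1 Ω) (i : Fin 2) : H1.d (u + w) i = H1.d u i + H1.d w i := rfl

theorem H1.d_smul {Ω : Set Plane} (c : ℝ) (u : H1 Ω) (i : Fin 2) : H1.d (c • u) i = c • H1.d u i := rfl

/-- An element of `H¹(Ω)` is determined by its underlying function. -/
theorem H1.ext_fn {Ω : Set Plane} (hΩ : IsOpen Ω) (u w : H1 Ω) (h : (H1.fn u) = (H1.fn w)) : u = w := by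
  have hd : ∀ i, (H1.d u i) = (H1.d w i) := by
    intro i
    have hint : LocallyIntegrableOn (fun x => (H1.d u i) x - (H1.d w i) x) Ω := by
      have h1 : LocallyIntegrable (fun x => (H1.d u i) x - (H1.d w i) x) (volume.restrict Ω) :=
        ((Lp.memLp ((H1.d u i))).sub (Lp.memLp ((H1.d w i)))).locallyIntegrable (by norm_num)
      exact locallyIntegrableOn_of_locallyIntegrable_restrict h1
    have hz := hΩ.ae_eq_zero_of_integral_contDiff_smul_eq_zero hint (by
      intro φ hφ hc hs
      have ht : IsTest Ω φ := ⟨⟨hφ, hc⟩, hs⟩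
      have e1 : ∫ x in Ω, (H1.fn u) x * pderiv i φ x = - ∫ x in Ω, (H1.d u i) x * φ x := u.2 i φ ht
      have e2 : ∫ x in Ω, (H1.fn w) x * pderiv i φ x = - ∫ x in Ω, (H1.d w i) x * φ x := w.2 i φ ht
      have hsupp : Function.support (fun x => φ x • ((H1.d u i) x - (H1.d w i) x)) ⊆ Ω := by
        intro x hx
        refine hs (subset_closure ?_)
        intro h0
        exact hx (by simp [h0])
      rw [← setIntegral_eq_integral_of_forall_compl_eq_zero
        (fun x hx => Function.notMem_support.mp (fun hh => hx (hsupp hh)))]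
      have i1 : Integrable (fun x => (H1.d u i) x * φ x) (volume.restrict Ω) :=
        (Lp.memLp ((H1.d u i))).integrable_mul (Smooth.memLp ht.1 Ω)
      have i2 : Integrable (fun x => (H1.d w i) x * φ x) (volume.restrict Ω) :=
        (Lp.memLp ((H1.d w i))).integrable_mul (Smooth.memLp ht.1 Ω)
      have e3 : ∫ x in Ω, φ x • ((H1.d u i) x - (H1.d w i) x)
          = (∫ x in Ω, (H1.d u i) x * φ x) - ∫ x in Ω, (H1.d w i) x * φ x := by
        rw [← integral_sub i1 i2]
        refine integral_congr_ae (ae_of_all _ fun x => ?_)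
        simp only [smul_eq_mul]
        ring
      rw [e3]
      rw [h] at e1
      linarith)
    refine Lp.ext ?_
    rw [Filter.EventuallyEq, ae_restrict_iff' hΩ.measurableSet]
    filter_upwards [hz] with x hx hxΩ
    exact sub_eq_zero.mp (hx hxΩ)
  refine Subtype.ext ?_
  refine WithLp.ofLp_injective 2 (Prod.ext h ?_)
  exact PiLp.ext hd

/-- `(H¹(Ω))²` with its Hilbert norm `‖ψ‖₁² = ‖ψ_1‖₁² + ‖ψ_2‖₁²`. -/
abbrev H1Vec (Ω : Set Plane) := PiLp 2 (fun _ : Fin 2 => H1 Ω)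

/-- The class in `H¹(Ω)` of (the restriction to `Ω` of) a function in `C_c^∞(ℝ²)`. -/
def smoothToH1 (Ω : Set Plane) : Smooth →ₗ[ℝ] H1 Ω where
  toFun φ := ⟨WithLp.toLp 2 ((Smooth.memLp φ.2 Ω).toLp φ.1,
      WithLp.toLp 2 fun i => (Smooth.memLp_pderiv φ.2 Ω i).toLp (pderiv i φ.1)), by
    intro i χ hχ
    change ∫ x in Ω, ((Smooth.memLp φ.2 Ω).toLp φ.1) x * pderiv i χ x
      = - ∫ x in Ω, ((Smooth.memLp_pderiv φ.2 Ω i).toLp (pderiv i φ.1)) x * χ x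
    have hχ0 : ∀ x, x ∉ Ω → χ x = 0 := fun x hx =>
      image_eq_zero_of_notMem_tsupport (fun h => hx (hχ.2 h))
    have hdχ0 : ∀ x, x ∉ Ω → pderiv i χ x = 0 := fun x hx => by
      have : fderiv ℝ χ x = 0 :=
        image_eq_zero_of_notMem_tsupport (fun h => hx (hχ.2 (tsupport_fderiv_subset ℝ h)))
      simp [pderiv, this]
    have e1 : ∫ x in Ω, ((Smooth.memLp φ.2 Ω).toLp φ.1) x * pderiv i χ x
        = ∫ x, φ.1 x * pderiv i χ x := by
      rw [← setIntegral_eq_integral_of_forall_compl_eq_zero (s := Ω) (μ := volume)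
        (f := fun x => φ.1 x * pderiv i χ x) (fun x hx => by simp [hdχ0 x hx])]
      refine integral_congr_ae ?_
      filter_upwards [(Smooth.memLp φ.2 Ω).coeFn_toLp] with x hx
      rw [hx]
    have e2 : ∫ x in Ω, ((Smooth.memLp_pderiv φ.2 Ω i).toLp (pderiv i φ.1)) x * χ x
        = ∫ x, pderiv i φ.1 x * χ x := by
      rw [← setIntegral_eq_integral_of_forall_compl_eq_zero (s := Ω) (μ := volume)
        (f := fun x => pderiv i φ.1 x * χ x) (fun x hx => by simp [hχ0 x hx])]
      refine integral_congr_ae ?_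
      filter_upwards [(Smooth.memLp_pderiv φ.2 Ω i).coeFn_toLp] with x hx
      rw [hx]
    rw [e1, e2]
    have cφ := φ.2.1.continuous
    have cχ := hχ.1.1.continuous
    have cdφ := Smooth.continuous_pderiv φ.2 i
    have cdχ := Smooth.continuous_pderiv hχ.1 i
    exact integral_mul_fderiv_eq_neg_fderiv_mul_of_integrable
      ((cdφ.mul cχ).integrable_of_hasCompactSupport (hχ.1.2.mul_left))
      ((cφ.mul cdχ).integrable_of_hasCompactSupport
        ((Smooth.hasCompactSupport_pderiv hχ.1 i).mul_left))
      ((cφ.mul cχ).integrable_of_hasCompactSupport (hχ.1.2.mul_left))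
      (fun x _ => (φ.2.1.differentiable (by simp)).differentiableAt)
      (fun x _ => (hχ.1.1.differentiable (by simp)).differentiableAt)⟩
  map_add' φ χ := by
    refine Subtype.ext (WithLp.ofLp_injective 2 (Prod.ext ?_ (PiLp.ext fun i => ?_)))
    · exact MemLp.toLp_add (Smooth.memLp φ.2 Ω) (Smooth.memLp χ.2 Ω)
    · refine Eq.trans ?_ (MemLp.toLp_add (Smooth.memLp_pderiv φ.2 Ω i)
        (Smooth.memLp_pderiv χ.2 Ω i))
      exact MemLp.toLp_congr (Smooth.memLp_pderiv (φ + χ).2 Ω i) _ (Eventually.of_forall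
        (congrFun (pderiv_add φ.2 χ.2 i)))
  map_smul' c φ := by
    refine Subtype.ext (WithLp.ofLp_injective 2 (Prod.ext ?_ (PiLp.ext fun i => ?_)))
    · exact MemLp.toLp_const_smul c (Smooth.memLp φ.2 Ω)
    · refine Eq.trans ?_ (MemLp.toLp_const_smul c (Smooth.memLp_pderiv φ.2 Ω i))
      exact MemLp.toLp_congr (Smooth.memLp_pderiv (c • φ).2 Ω i) _ (Eventually.of_forall
        (congrFun (pderiv_smul φ.2 c i)))

/-! ### Polygonal domains -/

/-- The three kinds of boundary conditions. -/
inductive BC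
  | clamped
  | simplySupported
  | free

/-- A bounded domain `Ω` whose boundary is a simple closed polygon with the vertices
`vtx i`, `i ∈ ℤ/K`, listed in counterclockwise direction, together with the type of boundary
condition on each edge. The `i`-th edge goes from `vtx i` to `vtx (i + 1)`. Adjacent edges may meet at
an angle of `π` (e.g. where the type of boundary condition changes within a side). -/
structure PlateDomain (K : ℕ) [NeZero K] where
  Ω : Set Plane
  vtx : ZMod K → Plane
  bc : ZMod K → BC
  isOpen : IsOpen Ω
  isConnected : IsConnected Ω
  isBounded : Bornology.IsBounded Ω
  three_le : 3 ≤ K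
  /-- The half-open edges are pairwise disjoint: the polygon is simple and nondegenerate. -/
  simple : Pairwise fun i j => Disjoint
    (AffineMap.lineMap (k := ℝ) (vtx i) (vtx (i + 1)) '' Ico 0 1)
    (AffineMap.lineMap (k := ℝ) (vtx j) (vtx (j + 1)) '' Ico 0 1)
  frontier_eq : frontier Ω = ⋃ i, segment ℝ (vtx i) (vtx (i + 1))
  /-- Counterclockwise orientation: rotating the direction of an edge by `-π/2` gives the outer
  normal. -/
  outward : ∀ i, ∀ x ∈ openSegment ℝ (vtx i) (vtx (i + 1)), ∀ᶠ ε : ℝ in 𝓝[>] 0,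
    x - ε • !₂[(vtx (i + 1) - vtx i) 1, -(vtx (i + 1) - vtx i) 0] ∈ Ω ∧
    x + ε • !₂[(vtx (i + 1) - vtx i) 1, -(vtx (i + 1) - vtx i) 0] ∉ Ω

namespace PlateDomain

variable {K : ℕ} [NeZero K] (P : PlateDomain K)

/-- Length of the `i`-th edge. -/
def len (i : ZMod K) : ℝ := dist (P.vtx i) (P.vtx (i + 1))

/-- Unit counterclockwise tangent vector `t` on the `i`-th edge. -/
def tangent (i : ZMod K) : Plane := (P.len i)⁻¹ • (P.vtx (i + 1) - P.vtx i)

/-- Unit outer normal vector `n` on the `i`-th edge; `t = (-n_2, n_1)`. -/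
def normal (i : ZMod K) : Plane := !₂[P.tangent i 1, -P.tangent i 0]

/-- Arc length parametrization of the `i`-th edge, `0 < s < len i`. -/
def edgePt (i : ZMod K) (s : ℝ) : Plane := P.vtx i + s • P.tangent i

/-- `L²` of the `i`-th edge, in the arc length parameter. -/
abbrev L2Edge (i : ZMod K) := Lp ℝ 2 (volume.restrict (Ioo 0 (P.len i)))

/-- `L²(Γ)`, with `Γ` the union of the edges. -/
abbrev L2Bdry := PiLp 2 (fun i : ZMod K => P.L2Edge i)

theorem memLp_edge {φ : Plane → ℝ} (h : φ ∈ Smooth) (i : ZMod K) :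
    MemLp (fun s => φ (P.edgePt i s)) 2 (volume.restrict (Ioo 0 (P.len i))) := by
  obtain ⟨C, hC⟩ := h.2.exists_bound_of_continuous h.1.continuous
  refine MemLp.of_bound ?_ C (ae_of_all _ fun s => hC _)
  refine Continuous.aestronglyMeasurable ?_
  unfold edgePt
  exact h.1.continuous.comp (by fun_prop)

/-- Restriction of smooth functions to `Γ`. -/
def smoothToBdry : Smooth →ₗ[ℝ] P.L2Bdry where
  toFun φ := WithLp.toLp 2 fun i => (P.memLp_edge φ.2 i).toLp _
  map_add' φ χ := PiLp.ext fun i =>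
    MemLp.toLp_add (P.memLp_edge φ.2 i) (P.memLp_edge χ.2 i)
  map_smul' c φ := PiLp.ext fun i => MemLp.toLp_const_smul c (P.memLp_edge φ.2 i)

/-- The trace operator `H¹(Ω) → L²(Γ)`: the continuous extension of the restriction map
`φ ↦ φ|_Γ`, which is densely defined and bounded with respect to the `H¹(Ω)`-norm. -/
def trace : H1 P.Ω →L[ℝ] P.L2Bdry := P.smoothToBdry.extendOfNorm (smoothToH1 P.Ω)

theorem trace_zero (i : ZMod K) : P.trace 0 i = 0 := by
  rw [map_zero]
  rfl

theorem trace_add (u w : H1 P.Ω) (i : ZMod K) :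
    P.trace (u + w) i = P.trace u i + P.trace w i := by
  rw [map_add]
  rfl

theorem trace_smul (c : ℝ) (u : H1 P.Ω) (i : ZMod K) :
    P.trace (c • u) i = c • P.trace u i := by
  rw [map_smul]
  rfl

/-! ### The spaces `Q` and `W` -/

/-- `Q`: the functions in `H¹(Ω)` that vanish on the clamped and the simply supported edges. -/
def Q : Submodule ℝ (H1 P.Ω) where
  carrier := {u | ∀ i, P.bc i = .clamped ∨ P.bc i = .simplySupported → P.trace u i = 0}
  zero_mem' := fun i _ => P.trace_zero i
  add_mem' := fun {a b} ha hb i hi => by rw [P.trace_add, ha i hi, hb i hi, add_zero]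
  smul_mem' := fun c a ha i hi => by rw [P.trace_smul, ha i hi, smul_zero]

/-- `G = ∇v` for `v ∈ H¹(Ω)` and `G ∈ (H¹(Ω))²`; so `v ∈ H²(Ω)` iff such a `G` exists. -/
def IsGrad (v : H1 P.Ω) (G : H1Vec P.Ω) : Prop := ∀ i, (H1.d v i) = H1.fn (G i)

/-- The normal component on the `i`-th edge of the trace of a vector field; for `G = ∇v` it is the
normal derivative of `v`. -/
def normalTrace (G : H1Vec P.Ω) (i : ZMod K) : P.L2Edge i :=
  ∑ a : Fin 2, P.normal i a • P.trace (G a) i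

/-- `v ∈ W` with `∇v = G`: `v ∈ H²(Ω)`, `v = 0` and `∂v/∂n = 0` on the clamped edges, `v = 0` on the
simply supported edges. -/
def MemW (v : H1 P.Ω) (G : H1Vec P.Ω) : Prop :=
  P.IsGrad v G ∧
  (∀ i, P.bc i = .clamped → P.trace v i = 0 ∧ P.normalTrace G i = 0) ∧
  (∀ i, P.bc i = .simplySupported → P.trace v i = 0)

/-! ### The coupling condition -/

/-- `Curl ψ`, with rows `(∂_2 ψ_a, -∂_1 ψ_a)`. -/
def Curl (ψ : H1Vec P.Ω) (a : Fin 2) : Fin 2 → L2 P.Ω := ![H1.d (ψ a) 1, -H1.d (ψ a) 0]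

/-- The pairing `⟨∂ψ/∂t, ξ⟩_Γ` of the tangential derivative `∂ψ/∂t = (Curl ψ) n ∈ (H^{-1/2}(Γ))²`
with the trace of `ξ ∈ (H¹(Ω))²`. As `Div Curl ψ = 0`, this normal trace of the field `Curl ψ` is
given by `∫_Ω Curl ψ : ∇ξ`. -/
def tangPairing (ψ ξ : H1Vec P.Ω) : ℝ :=
  ∑ a : Fin 2, ∑ i : Fin 2, inner ℝ (P.Curl ψ a i) (H1.d (ξ a) i)

/-- The coupling condition: `⟨∂ψ/∂t, ∇v⟩_Γ = -∫_Γ q ∂v/∂n ds` for all `v ∈ W`. -/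
def Coupling (q : H1 P.Ω) (ψ : H1Vec P.Ω) : Prop :=
  ∀ v G, P.MemW v G →
    P.tangPairing ψ G = - ∑ i, ∫ s in Ioo 0 (P.len i), P.trace q i s * P.normalTrace G i s

/-- `Ψ_q`. -/
def Psi (q : H1 P.Ω) : Set (H1Vec P.Ω) := {ψ | P.Coupling q ψ}

theorem tangPairing_add (ψ χ ξ : H1Vec P.Ω) :
    P.tangPairing (ψ + χ) ξ = P.tangPairing ψ ξ + P.tangPairing χ ξ := by
  simp [tangPairing, Curl, Fin.sum_univ_two, H1.d_add, inner_add_left, inner_neg_left]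
  ring

theorem tangPairing_smul (c : ℝ) (ψ ξ : H1Vec P.Ω) :
    P.tangPairing (c • ψ) ξ = c * P.tangPairing ψ ξ := by
  simp [tangPairing, Curl, Fin.sum_univ_two, H1.d_smul, inner_smul_left, inner_neg_left]
  ring

theorem integral_edge (i : ZMod K) (f h : P.L2Edge i) :
    ∫ s in Ioo 0 (P.len i), f s * h s = inner ℝ f h := by
  rw [L2.inner_def]
  refine integral_congr_ae (ae_of_all _ fun s => ?_)
  simp [mul_comm]

theorem Coupling.add {q q' : H1 P.Ω} {ψ ψ' : H1Vec P.Ω} (h : P.Coupling q ψ)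
    (h' : P.Coupling q' ψ') : P.Coupling (q + q') (ψ + ψ') := by
  intro v G hG
  have h1 := h v G hG
  have h2 := h' v G hG
  simp only [integral_edge] at h1 h2 ⊢
  simp only [tangPairing_add, h1, h2, trace_add, inner_add_left, Finset.sum_add_distrib, neg_add]

theorem Coupling.smul (c : ℝ) {q : H1 P.Ω} {ψ : H1Vec P.Ω} (h : P.Coupling q ψ) :
    P.Coupling (c • q) (c • ψ) := by
  intro v G hG
  have h1 := h v G hG
  simp only [integral_edge] at h1 ⊢
  simp only [tangPairing_smul, h1, trace_smul, real_inner_smul_left, ← Finset.mul_sum, mul_neg]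

theorem Coupling.zero : P.Coupling 0 0 := by
  intro v G _
  have h1 := P.tangPairing_smul 0 0 G
  simp only [zero_smul, zero_mul] at h1
  simp only [integral_edge, h1, trace_zero, inner_zero_left, Finset.sum_const_zero, neg_zero]

/-- The space `V` of pairs `(q, ψ) ∈ Q × (H¹(Ω))²` that satisfy the coupling condition. -/
def V : Submodule ℝ (H1 P.Ω × H1Vec P.Ω) where
  carrier := {p | p.1 ∈ P.Q ∧ p.2 ∈ P.Psi p.1}
  zero_mem' := ⟨P.Q.zero_mem, Coupling.zero P⟩
  add_mem' := fun ha hb => ⟨P.Q.add_mem ha.1 hb.1, Coupling.add P ha.2 hb.2⟩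
  smul_mem' := fun c _ ha => ⟨P.Q.smul_mem c ha.1, Coupling.smul P c ha.2⟩

/-- `V₀ = {0} × Ψ₀`. -/
def V0 : Submodule ℝ (H1 P.Ω × H1Vec P.Ω) where
  carrier := ({0} : Set (H1 P.Ω)) ×ˢ P.Psi 0
  zero_mem' := ⟨rfl, Coupling.zero P⟩
  add_mem' := fun {a b} ha hb => by
    refine ⟨?_, ?_⟩
    · have h1 : a.1 = 0 := ha.1
      have h2 : b.1 = 0 := hb.1
      simp [h1, h2]
    · have h := Coupling.add P ha.2 hb.2
      rwa [add_zero] at h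
  smul_mem' := fun c a ha => by
    refine ⟨?_, ?_⟩
    · have h1 : a.1 = 0 := ha.1
      simp [h1]
    · have h := Coupling.smul P c ha.2
      rwa [smul_zero] at h

/-! ### The boundary function `ψ_Γ[q]` and its harmonic extension `ψ[q]`

Fix an edge `e`, from `x_A = vtx e` to `x_B = vtx (e + 1)`. Starting at `x_B` and going
counterclockwise, the edges are `e + 1, e + 2, …`, and the last one is `e = e + K`. -/

/-- `∫_0^s q ds` along the `i`-th edge, starting at `vtx i`. -/
def edgeIntegral (q : H1 P.Ω) (i : ZMod K) (s : ℝ) : ℝ := ∫ r in (0 : ℝ)..s, P.trace q i r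

/-- The value of `-∫_0^σ q n ds` at the starting point of the edge `e + 1 + k`, i.e. the integral
over the complete edges `e + 1, …, e + k`. -/
def cornerValue (e : ZMod K) (q : H1 P.Ω) (k : ℕ) : Plane :=
  -∑ m ∈ Finset.range k,
    P.edgeIntegral q (e + 1 + m) (P.len (e + 1 + m)) • P.normal (e + 1 + m)

/-- The boundary function `ψ_Γ[q]` in the arc length parameter of the `i`-th edge: on
`Γ ∖ e` it is `-∫_0^σ q n ds`, where `σ` is the arc length measured from `x_B`; on `e` it is the
linear interpolation of the values at `x_A` and `x_B`. -/
def psiGamma (e : ZMod K) (q : H1 P.Ω) (i : ZMod K) (s : ℝ) : Plane :=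
  if i = e then
    (1 - s / P.len e) • P.cornerValue e q (K - 1) + (s / P.len e) • P.cornerValue e q 0
  else
    P.cornerValue e q (i - (e + 1)).val - P.edgeIntegral q i s • P.normal i

/-- `ψ` is the harmonic extension `ψ[q]`: its trace is `ψ_Γ[q]`, and both components are weakly
harmonic, i.e. `∫_Ω ∇ψ_a · ∇φ = 0` for all `φ ∈ H¹₀(Ω)`. -/
def IsExt (e : ZMod K) (q : H1 P.Ω) (ψ : H1Vec P.Ω) : Prop :=
  ∀ a : Fin 2,
    (∀ i, ∀ᵐ s ∂(volume.restrict (Ioo 0 (P.len i))),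
      P.trace (ψ a) i s = P.psiGamma e q i s a) ∧
    ∀ φ : H1 P.Ω, P.trace φ = 0 → ∑ j : Fin 2, inner ℝ (H1.d (ψ a) j) (H1.d φ j) = 0

theorem intervalIntegrable_edge (i : ZMod K) (f : P.L2Edge i) {s : ℝ} (hs : s ∈ Icc 0 (P.len i)) :
    IntervalIntegrable f volume 0 s := by
  have h : IntegrableOn f (Ioo 0 (P.len i)) := (Lp.memLp f).integrable (by norm_num)
  rw [intervalIntegrable_iff_integrableOn_Ioo_of_le hs.1]
  exact h.mono_set (Ioo_subset_Ioo_right hs.2)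

theorem trace_add_ae (u w : H1 P.Ω) (i : ZMod K) : ∀ᵐ s ∂(volume.restrict (Ioo 0 (P.len i))),
    P.trace (u + w) i s = P.trace u i s + P.trace w i s := by
  rw [P.trace_add]
  exact Lp.coeFn_add (P.trace u i) (P.trace w i)

theorem trace_smul_ae (c : ℝ) (u : H1 P.Ω) (i : ZMod K) :
    ∀ᵐ s ∂(volume.restrict (Ioo 0 (P.len i))), P.trace (c • u) i s = c * P.trace u i s := by
  rw [P.trace_smul]
  exact Lp.coeFn_smul c (P.trace u i)

theorem edgeIntegral_add (u w : H1 P.Ω) (i : ZMod K) {s : ℝ} (hs : s ∈ Icc 0 (P.len i)) :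
    P.edgeIntegral (u + w) i s = P.edgeIntegral u i s + P.edgeIntegral w i s := by
  unfold edgeIntegral
  rw [← intervalIntegral.integral_add (P.intervalIntegrable_edge i _ hs)
    (P.intervalIntegrable_edge i _ hs)]
  simp only [intervalIntegral.integral_of_le hs.1, integral_Ioc_eq_integral_Ioo]
  exact integral_congr_ae (ae_restrict_of_ae_restrict_of_subset (Ioo_subset_Ioo_right hs.2)
    (P.trace_add_ae u w i))

theorem edgeIntegral_smul (c : ℝ) (u : H1 P.Ω) (i : ZMod K) {s : ℝ} (hs : s ∈ Icc 0 (P.len i)) :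
    P.edgeIntegral (c • u) i s = c * P.edgeIntegral u i s := by
  unfold edgeIntegral
  rw [← intervalIntegral.integral_const_mul]
  simp only [intervalIntegral.integral_of_le hs.1, integral_Ioc_eq_integral_Ioo]
  exact integral_congr_ae (ae_restrict_of_ae_restrict_of_subset (Ioo_subset_Ioo_right hs.2)
    (P.trace_smul_ae c u i))

theorem len_mem (i : ZMod K) : P.len i ∈ Icc 0 (P.len i) := ⟨dist_nonneg, le_rfl⟩

theorem cornerValue_add (e : ZMod K) (q q' : H1 P.Ω) (k : ℕ) :
    P.cornerValue e (q + q') k = P.cornerValue e q k + P.cornerValue e q' k := by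
  have h : ∀ i, P.edgeIntegral (q + q') i (P.len i)
      = P.edgeIntegral q i (P.len i) + P.edgeIntegral q' i (P.len i) :=
    fun i => P.edgeIntegral_add q q' i (P.len_mem i)
  simp only [cornerValue, h, add_smul, Finset.sum_add_distrib, neg_add]

theorem cornerValue_smul (e : ZMod K) (c : ℝ) (q : H1 P.Ω) (k : ℕ) :
    P.cornerValue e (c • q) k = c • P.cornerValue e q k := by
  have h : ∀ i, P.edgeIntegral (c • q) i (P.len i) = c * P.edgeIntegral q i (P.len i) :=
    fun i => P.edgeIntegral_smul c q i (P.len_mem i)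
  simp only [cornerValue, h, mul_smul, ← Finset.smul_sum, smul_neg]

theorem psiGamma_add (e : ZMod K) (q q' : H1 P.Ω) (i : ZMod K) {s : ℝ}
    (hs : s ∈ Icc 0 (P.len i)) :
    P.psiGamma e (q + q') i s = P.psiGamma e q i s + P.psiGamma e q' i s := by
  simp only [psiGamma, P.edgeIntegral_add q q' i hs, cornerValue_add]
  split_ifs <;> module

theorem psiGamma_smul (e : ZMod K) (c : ℝ) (q : H1 P.Ω) (i : ZMod K) {s : ℝ}
    (hs : s ∈ Icc 0 (P.len i)) :
    P.psiGamma e (c • q) i s = c • P.psiGamma e q i s := by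
  simp only [psiGamma, P.edgeIntegral_smul c q i hs, cornerValue_smul]
  split_ifs <;> module

theorem IsExt.add {e : ZMod K} {q q' : H1 P.Ω} {ψ ψ' : H1Vec P.Ω} (h : P.IsExt e q ψ)
    (h' : P.IsExt e q' ψ') : P.IsExt e (q + q') (ψ + ψ') := by
  intro a
  refine ⟨fun i => ?_, fun φ hφ => ?_⟩
  · filter_upwards [P.trace_add_ae (ψ a) (ψ' a) i, (h a).1 i, (h' a).1 i,
      ae_restrict_mem measurableSet_Ioo] with s hs h1 h2 hmem
    rw [P.psiGamma_add e q q' i (Ioo_subset_Icc_self hmem)]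
    exact hs.trans (by rw [h1, h2]; rfl)
  · have h1 := (h a).2 φ hφ
    have h2 := (h' a).2 φ hφ
    have h3 : ∀ j, H1.d ((ψ + ψ') a) j = H1.d (ψ a) j + H1.d (ψ' a) j := fun j => rfl
    simp only [h3, inner_add_left, Finset.sum_add_distrib, h1, h2, add_zero]

theorem IsExt.smul {e : ZMod K} (c : ℝ) {q : H1 P.Ω} {ψ : H1Vec P.Ω} (h : P.IsExt e q ψ) :
    P.IsExt e (c • q) (c • ψ) := by
  intro a
  refine ⟨fun i => ?_, fun φ hφ => ?_⟩
  · filter_upwards [P.trace_smul_ae c (ψ a) i, (h a).1 i,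
      ae_restrict_mem measurableSet_Ioo] with s hs h1 hmem
    rw [P.psiGamma_smul e c q i (Ioo_subset_Icc_self hmem)]
    exact hs.trans (by rw [h1]; rfl)
  · have h1 := (h a).2 φ hφ
    have h3 : ∀ j, H1.d ((c • ψ) a) j = c • H1.d (ψ a) j := fun j => rfl
    simp only [h3, real_inner_smul_left, ← Finset.mul_sum, h1, mul_zero]

theorem IsExt.zero (e : ZMod K) : P.IsExt e 0 0 := by
  intro a
  refine ⟨fun i => ?_, fun φ _ => ?_⟩
  · have h0 : P.trace ((0 : H1Vec P.Ω) a) i = 0 := P.trace_zero i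
    rw [h0]
    filter_upwards [Lp.coeFn_zero ℝ 2 (volume.restrict (Ioo 0 (P.len i))),
      ae_restrict_mem measurableSet_Ioo] with s hs hmem
    have h2 := P.psiGamma_smul e 0 0 i (Ioo_subset_Icc_self hmem)
    rw [zero_smul ℝ (0 : H1 P.Ω), zero_smul] at h2
    rw [h2]
    exact hs
  · have h3 : ∀ j, H1.d ((0 : H1Vec P.Ω) a) j = 0 := fun j => rfl
    simp only [h3, inner_zero_left, Finset.sum_const_zero]

/-- `V₁ = {(q, ψ[q]) : q ∈ Q}`. -/
def V1 (e : ZMod K) : Submodule ℝ (H1 P.Ω × H1Vec P.Ω) where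
  carrier := {p | p.1 ∈ P.Q ∧ P.IsExt e p.1 p.2}
  zero_mem' := ⟨P.Q.zero_mem, IsExt.zero P e⟩
  add_mem' := fun ha hb => ⟨P.Q.add_mem ha.1 hb.1, IsExt.add P ha.2 hb.2⟩
  smul_mem' := fun c _ ha => ⟨P.Q.smul_mem c ha.1, IsExt.smul P c ha.2⟩

end PlateDomain

end Plate

end

/-! Why `ψ[q]` satisfies the coupling condition. The boundary function `ψ_Γ[q]` is a primitive along
the polygon: its tangential derivative is `-q n` off the chosen clamped edge `E` and a constant
vector on `E`. The linear interpolation on `E` closes the loop, so the primitive is single valued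
and no mean value condition on `q` is needed (`startValue_succ`). For any `H¹` function with such a
trace, the pairing of its tangential derivative with `ξ` is the `L²(Γ)` product of the slope with
the trace of `ξ` (`pairing`); harmonicity plays no role here. Put `ξ = ∇v` with `v ∈ W`. On `E` the
trace of `v` vanishes, hence so does the tangential component of `∇v`; clamping removes the normal
component. Thus `∇v = 0` on `E` and the artificial slope there is invisible (`trace_grad_eq_zero`).
On the other edges the slope `-q n` yields exactly `-∫ q ∂v/∂n` (`coupling_of_isExt`).

The splitting is then linear algebra: `ψ - ψ[q]` satisfies the homogeneous condition whenever `ψ ∈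
Ψ_q`, and `ψ[0] = 0` by uniqueness.

Existence of `ψ[q]` takes two steps. A continuous boundary function with `L²` slope lifts to `H¹(Ω)`
(`exists_lift`), by local ramps that are primitives along one edge and constant in a transversal
direction. Then the lift is made harmonic by orthogonal projection of its gradient, which the
Poincaré inequality permits (`exists_harmonic`). The norm bound comes from the closed graph theorem
(`exists_bound_isExt`).

The `H¹` theory underneath is built from the geometry. Near a boundary point `Ω` is an open sector,
because the two sectors cut out by the edges are connected, avoid the frontier, and are told apart
by the outward condition (`sector_of_rays`). In a sector the divergence theorem is Fubini in oblique
coordinates; a partition of unity globalizes it (`integral_fderiv`). Applied to `χ φ²` in a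
direction pointing into the sector it gives the trace inequality (`exists_trace_bound`). The same
directions allow mollification with an off-centre kernel that never looks across the boundary, so
smooth functions are dense (`denseRange_smoothToH1`). Hence the trace is really the restriction on
smooth functions, and Green's formulas extend to `H¹(Ω)` (`green`, `green_curl_free`). -/

noncomputable section
namespace Plate

/-! ### Cross products and plane sectors -/

/-- The cross product (signed area) of two plane vectors. -/
def cross (x y : Plane) : ℝ := x 0 * y 1 - x 1 * y 0

theorem cross_add_left (x y z : Plane) : cross (x + y) z = cross x z + cross y z := by
  simp [cross]; ring

theorem cross_add_right (x y z : Plane) : cross x (y + z) = cross x y + cross x z := by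
  simp [cross]; ring

theorem cross_smul_left (c : ℝ) (x y : Plane) : cross (c • x) y = c * cross x y := by
  simp [cross]; ring

theorem cross_smul_right (c : ℝ) (x y : Plane) : cross x (c • y) = c * cross x y := by
  simp [cross]; ring

theorem cross_neg_left (x y : Plane) : cross (-x) y = -cross x y := by
  simp [cross]; ring

theorem cross_neg_right (x y : Plane) : cross x (-y) = -cross x y := by
  simp [cross]; ring

theorem cross_self (x : Plane) : cross x x = 0 := by
  simp [cross]; ring

theorem cross_swap (x y : Plane) : cross x y = -cross y x := by
  simp [cross]; ring

/-- The Plücker relation in the plane. It transfers sign information from one bounding ray of a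
sector to the other. -/
theorem cross_mul_cross (x y z w : Plane) :
    cross x y * cross z w = cross x w * cross z y + cross z x * cross w y := by
  simp [cross]; ring

theorem continuous_cross_left (x : Plane) : Continuous (fun y => cross x y) := by
  unfold cross; fun_prop

theorem continuous_cross_right (y : Plane) : Continuous (fun x => cross x y) := by
  unfold cross; fun_prop

/-- Expansion of a vector with respect to two independent vectors. -/
theorem cross_smul_eq (x y z : Plane) : cross x y • z = cross z y • x + cross x z • y := by
  ext i
  fin_cases i <;> simp [cross] <;> ring

/-- The open sector swept counterclockwise from the ray `a` to the ray `b`, split by the inner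
direction `d`. -/
def Sector (a b d : Plane) : Set Plane :=
  {x | (0 ≤ cross x d ∧ 0 < cross a x) ∨ (0 ≤ cross d x ∧ 0 < cross x b)}

/-- `d` points into the sector from `a` to `b`. -/
def Inner (a b d : Plane) : Prop := 0 < cross a d ∧ 0 < cross d b

theorem Inner.smul {a b d : Plane} (h : Inner a b d) {c : ℝ} (hc : 0 < c) : Inner a b (c • d) := by
  refine ⟨?_, ?_⟩
  · rw [cross_smul_right]; exact mul_pos hc h.1
  · rw [cross_smul_left]; exact mul_pos hc h.2

theorem isOpen_inner (a b : Plane) : IsOpen {d | Inner a b d} :=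
  (isOpen_lt continuous_const (continuous_cross_left a)).inter
    (isOpen_lt continuous_const (continuous_cross_right b))

theorem Inner.swap {a b d : Plane} (h : Inner a b d) : Inner b a (-d) := by
  refine ⟨?_, ?_⟩
  · rw [cross_neg_right, ← cross_swap]; exact h.2
  · rw [cross_neg_left, ← cross_swap]; exact h.1

/-- The sector may be reflex, so convexity is not available. If the sum stays on the same side of
the line of `d`, the defining inequalities simply add up; if it changes sides, the inequality for
the other bounding ray follows from the Plücker relation. -/
theorem sector_add {a b d v x : Plane} (h : Inner a b d) (hv : Inner a b v)
    (hx : x ∈ Sector a b d) : x + v ∈ Sector a b d := by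
  obtain ⟨h1, h2⟩ := h
  obtain ⟨v1, v2⟩ := hv
  have sw : cross d (x + v) = -cross (x + v) d := cross_swap _ _
  rcases hx with ⟨x1, x2⟩ | ⟨x1, x2⟩
  · have hay : cross a (x + v) = cross a x + cross a v := cross_add_right _ _ _
    have hyd : cross (x + v) d = cross x d + cross v d := cross_add_left _ _ _
    rcases le_or_gt 0 (cross (x + v) d) with hy | hy
    · exact Or.inl ⟨hy, by linarith⟩
    · refine Or.inr ⟨by linarith, ?_⟩
      have e1 := cross_mul_cross (x + v) b a d
      have e2 := cross_mul_cross v b a d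
      have : 0 < cross (x + v) b * cross a d := by
        -- For an angle of at least `π` both terms of `e1` have the right sign; for a convex angle,
        -- subtracting `e2` leaves an expression in `x` alone that is positive.
        rcases le_or_gt (cross a b) 0 with hab | hab
        · nlinarith [mul_pos (show 0 < cross a (x + v) by linarith) h2,
            mul_nonneg_of_nonpos_of_nonpos hy.le hab]
        · nlinarith [mul_pos v2 h1, mul_nonneg x1 hab.le, mul_pos x2 h2]
      exact pos_of_mul_pos_left this h1.le
  · have hyb : cross (x + v) b = cross x b + cross v b := cross_add_left _ _ _
    have hdy : cross d (x + v) = cross d x + cross d v := cross_add_right _ _ _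
    rcases le_or_gt 0 (cross d (x + v)) with hy | hy
    · exact Or.inr ⟨hy, by linarith⟩
    · refine Or.inl ⟨by linarith, ?_⟩
      have e1 := cross_mul_cross a (x + v) d b
      have e2 := cross_mul_cross a v d b
      have s1 : cross b (x + v) = -cross (x + v) b := cross_swap _ _
      have s2 : cross b v = - cross v b := cross_swap _ _
      have s3 : cross d a = - cross a d := cross_swap _ _
      rw [s1, s3] at e1
      rw [s2, s3] at e2
      have : 0 < cross a (x + v) * cross d b := by
        rcases le_or_gt (cross a b) 0 with hab | hab
        · nlinarith [mul_pos (show 0 < cross (x + v) b by linarith) h1,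
            mul_nonneg_of_nonpos_of_nonpos hy.le hab]
        · nlinarith [mul_pos v1 h2, mul_nonneg x1 hab.le, mul_pos x2 h1]
      exact pos_of_mul_pos_left this h2.le

theorem convex_halfplane_inter (a d p : Plane) (r : ℝ) :
    Convex ℝ ({x | 0 ≤ cross (x - p) d ∧ 0 < cross a (x - p)} ∩ Metric.ball p r) := by
  refine Convex.inter ?_ (convex_ball p r)
  intro x hx y hy s t hs ht hst
  have e : s • x + t • y - p = s • (x - p) + t • (y - p) := by
    obtain rfl : t = 1 - s := by linarith
    module
  simp only [mem_ofPred_eq, e, cross_add_left, cross_add_right, cross_smul_left,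
    cross_smul_right] at hx hy ⊢
  refine ⟨add_nonneg (mul_nonneg hs hx.1) (mul_nonneg ht hy.1), ?_⟩
  rcases hs.eq_or_lt with rfl | hs'
  · have : t = 1 := by linarith
    simp [this, hy.2]
  · exact add_pos_of_pos_of_nonneg (mul_pos hs' hx.2) (mul_nonneg ht hy.2.le)

/-- The splitting ray `d` cuts the sector into two half-sectors, each convex even if the sector is
not, and a point of this ray lies in both. -/
theorem sector_isPreconnected {a b d : Plane} (h : Inner a b d) (p : Plane) {r : ℝ} (hr : 0 < r) :
    IsPreconnected ({x | x - p ∈ Sector a b d} ∩ Metric.ball p r) := by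
  have e : {x | x - p ∈ Sector a b d} ∩ Metric.ball p r
      = ({x | 0 ≤ cross (x - p) d ∧ 0 < cross a (x - p)} ∩ Metric.ball p r) ∪
        ({x | 0 ≤ cross (x - p) (-d) ∧ 0 < cross (-b) (x - p)} ∩ Metric.ball p r) := by
    rw [← union_inter_distrib_right]
    congr 1
    ext x
    simp only [Sector, mem_ofPred_eq, mem_union, cross_neg_left, cross_neg_right,
      ← cross_swap d, ← cross_swap _ b]
  have hd0 : d ≠ 0 := by
    rintro rfl
    have := h.1
    simp [cross] at this
  have hdn : 0 < ‖d‖ := norm_pos_iff.mpr hd0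
  -- Scaled so that the common point `p + c • d` is at distance `r / 2` from `p`.
  set c : ℝ := r / 2 / ‖d‖
  have hc : 0 < c := by positivity
  rw [e]
  refine IsPreconnected.union (p + c • d) ?_ ?_ (convex_halfplane_inter _ _ _ _).isPreconnected
    (convex_halfplane_inter _ _ _ _).isPreconnected
  · refine ⟨?_, ?_⟩
    · simp only [mem_ofPred_eq, add_sub_cancel_left, cross_smul_left, cross_smul_right, cross_self]
      exact ⟨by simp, mul_pos hc h.1⟩
    · rw [Metric.mem_ball, dist_eq_norm, add_sub_cancel_left, norm_smul, Real.norm_of_nonneg hc.le]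
      rw [div_mul_cancel₀ _ hdn.ne']
      linarith
  · refine ⟨?_, ?_⟩
    · simp only [mem_ofPred_eq, add_sub_cancel_left, cross_smul_left, cross_smul_right, cross_self,
        cross_neg_right, cross_neg_left]
      refine ⟨by simp, ?_⟩
      rw [← mul_neg, ← cross_swap]
      exact mul_pos hc h.2
    · rw [Metric.mem_ball, dist_eq_norm, add_sub_cancel_left, norm_smul, Real.norm_of_nonneg hc.le]
      rw [div_mul_cancel₀ _ hdn.ne']
      linarith

/-- The two sectors bounded by the rays `a`, `b` cover the plane up to these rays. -/
theorem sector_cover {a b d : Plane} (h : Inner a b d) (x : Plane) :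
    x ∈ Sector a b d ∨ x ∈ Sector b a (-d) ∨ ∃ s : ℝ, 0 ≤ s ∧ (x = s • a ∨ x = s • b) := by
  obtain ⟨h1, h2⟩ := h
  rcases le_total 0 (cross x d) with hx | hx
  · rcases lt_trichotomy (cross a x) 0 with ha | ha | ha
    · refine Or.inr (Or.inl (Or.inr ⟨?_, ?_⟩))
      · rw [cross_neg_left, ← cross_swap]; exact hx
      · rw [cross_swap]; linarith
    · refine Or.inr (Or.inr ⟨cross x d / cross a d, div_nonneg hx h1.le, Or.inl ?_⟩)
      have e := cross_smul_eq a d x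
      rw [ha, zero_smul, add_zero] at e
      rw [div_eq_inv_mul, mul_smul, ← e, smul_smul, inv_mul_cancel₀ h1.ne', one_smul]
    · exact Or.inl (Or.inl ⟨hx, ha⟩)
  · have hx' : 0 ≤ cross d x := by rw [cross_swap]; linarith
    rcases lt_trichotomy (cross x b) 0 with ha | ha | ha
    · refine Or.inr (Or.inl (Or.inl ⟨?_, ?_⟩))
      · rw [cross_neg_right, ← cross_swap]; exact hx'
      · rw [cross_swap]; linarith
    · refine Or.inr (Or.inr ⟨cross d x / cross d b, div_nonneg hx' h2.le, Or.inr ?_⟩)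
      have e := cross_smul_eq d b x
      rw [ha, zero_smul, zero_add] at e
      rw [div_eq_inv_mul, mul_smul, ← e, smul_smul, inv_mul_cancel₀ h2.ne', one_smul]
    · exact Or.inl (Or.inr ⟨hx', ha⟩)

/-! ### Oblique coordinates -/

/-- The parametrization of the plane by oblique coordinates. -/
def oblique (p a d : Plane) (z : ℝ × ℝ) : Plane := p + (z.1 • a + z.2 • d)

theorem continuous_oblique (p a d : Plane) : Continuous (oblique p a d) := by
  unfold oblique; fun_prop

/-- The parametrization factors as a translation after the matrix with columns `a` and `d`, whose
determinant is the cross product. -/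
theorem map_oblique {a d : Plane} (h : cross a d ≠ 0) (p : Plane) :
    Measure.map (oblique p a d) volume = ENNReal.ofReal |cross a d|⁻¹ • volume := by
  let M : Matrix (Fin 2) (Fin 2) ℝ := !![a 0, d 0; a 1, d 1]
  have hM : M.det = cross a d := by
    simp [M, Matrix.det_fin_two, cross]; ring
  have e : oblique p a d = (fun x => p + x) ∘ (WithLp.toLp 2 : (Fin 2 → ℝ) → Plane) ∘
      (Matrix.toLin' M) ∘ (MeasurableEquiv.finTwoArrow (α := ℝ)).symm := by
    funext z
    ext i
    fin_cases i <;>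
      simp [oblique, M, MeasurableEquiv.finTwoArrow, Matrix.vecHead, Matrix.vecTail]
  have m1 : Measurable (fun x : Plane => p + x) := by fun_prop
  have m2 : Measurable (WithLp.toLp 2 : (Fin 2 → ℝ) → Plane) :=
    (PiLp.volume_preserving_toLp (Fin 2)).measurable
  have m3 : Measurable (Matrix.toLin' M) :=
    (LinearMap.continuous_of_finiteDimensional (Matrix.toLin' M)).measurable
  have m4 := (MeasurableEquiv.finTwoArrow (α := ℝ)).symm.measurable
  rw [e, ← Measure.map_map m1 (m2.comp (m3.comp m4)), ← Measure.map_map m2 (m3.comp m4),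
    ← Measure.map_map m3 m4, (volume_preserving_finTwoArrow ℝ).symm.map_eq,
    Real.map_matrix_volume_pi_eq_smul_volume_pi (by rw [hM]; exact h), Measure.map_smul,
    Measure.map_smul, (PiLp.volume_preserving_toLp (Fin 2)).map_eq,
    (measurePreserving_add_left volume p).map_eq, hM, abs_inv]

theorem integral_oblique {a d : Plane} (h : cross a d ≠ 0) (p : Plane) {G : Plane → ℝ}
    (hG : AEStronglyMeasurable G volume) :
    ∫ x, G x = |cross a d| * ∫ z : ℝ × ℝ, G (oblique p a d z) := by
  have hm := map_oblique h p
  have h1 := integral_map (μ := (volume : Measure (ℝ × ℝ))) (φ := oblique p a d)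
    (continuous_oblique p a d).measurable.aemeasurable (f := G)
    (by rw [hm]; exact hG.smul_measure _)
  have h0 : 0 < |cross a d| := abs_pos.mpr h
  rw [← h1, hm, integral_smul_measure, ENNReal.toReal_ofReal (by positivity), smul_eq_mul,
    mul_inv_cancel_left₀ h0.ne']

theorem hasCompactSupport_line {F : Plane → ℝ} (hF : HasCompactSupport F) {d : Plane} (hd : d ≠ 0)
    (q : Plane) : HasCompactSupport (fun t : ℝ => F (q + t • d)) :=
  hF.comp_isClosedEmbedding
    ((Homeomorph.addLeft q).isClosedEmbedding.comp (isClosedEmbedding_smul_left hd))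

theorem contDiff_line {F : Plane → ℝ} (hF : ContDiff ℝ ∞ F) (q d : Plane) :
    ContDiff ℝ ∞ (fun t : ℝ => F (q + t • d)) := by
  fun_prop

theorem hasDerivAt_line {F : Plane → ℝ} (hF : ContDiff ℝ ∞ F) (q d : Plane) (t : ℝ) :
    HasDerivAt (fun t : ℝ => F (q + t • d)) (fderiv ℝ F (q + t • d) d) t := by
  have h1 : HasDerivAt (fun t : ℝ => q + t • d) d t := by
    simpa using ((hasDerivAt_id t).smul_const d).const_add q
  exact ((hF.differentiable (by simp)).differentiableAt.hasFDerivAt).comp_hasDerivAt t h1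

/-- Fubini in oblique coordinates: integrating the `d`-derivative along `d` leaves the value on the
ray `a`. The set `A` need only be the open quadrant up to the null line on which the first
coordinate vanishes, so a half-sector may contain its ray along `d`. -/
theorem integral_quadrant_fderiv {a d : Plane} (h : cross a d ≠ 0) (p : Plane) {A : Set Plane}
    (hA : MeasurableSet A)
    (hAz : ∀ z : ℝ × ℝ, z.1 ≠ 0 → (oblique p a d z ∈ A ↔ 0 < z.1 ∧ 0 < z.2))
    {F : Plane → ℝ} (hF : F ∈ Smooth) :
    ∫ x in A, fderiv ℝ F x d = -(|cross a d| * ∫ s in Ioi (0 : ℝ), F (p + s • a)) := by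
  have hd : d ≠ 0 := by
    rintro rfl
    simp [cross] at h
  have hc : Continuous (fun x => fderiv ℝ F x d) :=
    (hF.1.continuous_fderiv (by simp)).clm_apply continuous_const
  have hcs : HasCompactSupport (fun x => fderiv ℝ F x d) := by
    refine (hF.2.fderiv (𝕜 := ℝ)).mono' fun x hx => subset_closure fun h0 => hx ?_
    simp [h0]
  have hint : Integrable (fun z : ℝ × ℝ => fderiv ℝ F (oblique p a d z) d) volume := by
    have h1 : Integrable (fun x => fderiv ℝ F x d) (Measure.map (oblique p a d) volume) := by
      rw [map_oblique h]
      exact (hc.integrable_of_hasCompactSupport hcs).smul_measure ENNReal.ofReal_ne_top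
    exact h1.comp_measurable (continuous_oblique p a d).measurable
  have hne : ∀ᵐ z : ℝ × ℝ, z.1 ≠ 0 := by
    have : ∀ᵐ s : ℝ, s ≠ 0 := by simp [ae_iff]
    exact Measure.quasiMeasurePreserving_fst.ae this
  rw [← integral_indicator hA, integral_oblique h p
    ((hc.measurable.indicator hA).aestronglyMeasurable)]
  have e1 : ∫ z : ℝ × ℝ, A.indicator (fun x => fderiv ℝ F x d) (oblique p a d z)
      = ∫ z in (Ioi (0 : ℝ)) ×ˢ (Ioi (0 : ℝ)), fderiv ℝ F (oblique p a d z) d := by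
    rw [← integral_indicator (measurableSet_Ioi.prod measurableSet_Ioi)]
    refine integral_congr_ae ?_
    filter_upwards [hne] with z hz
    by_cases hm : 0 < z.1 ∧ 0 < z.2
    · rw [indicator_of_mem ((hAz z hz).mpr hm), indicator_of_mem (show z ∈ _ from hm)]
    · rw [indicator_of_notMem (fun hh => hm ((hAz z hz).mp hh)), indicator_of_notMem (show z ∉ _ from fun hh => hm hh)]
  rw [e1, Measure.volume_eq_prod, setIntegral_prod _ (by
    rw [← Measure.volume_eq_prod]; exact hint.integrableOn)]
  have e2 : ∀ s : ℝ, ∫ t in Ioi (0 : ℝ), fderiv ℝ F (oblique p a d (s, t)) d = -F (p + s • a) := by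
    intro s
    have := ((hasCompactSupport_line hF.2 hd (p + s • a)).integral_Ioi_deriv_eq
      ((contDiff_line hF.1 (p + s • a) d).of_le (by simp)) 0)
    rw [zero_smul, add_zero] at this
    rw [← this]
    refine integral_congr_ae (ae_of_all _ fun t => ?_)
    have e3 : oblique p a d (s, t) = p + s • a + t • d := by simp [oblique, add_assoc]
    simp only [e3]
    exact (hasDerivAt_line hF.1 (p + s • a) d t).deriv.symm
  simp only [e2, integral_neg, mul_neg]

theorem measurableSet_halfplane_inter (a d p : Plane) :
    MeasurableSet {x | 0 ≤ cross (x - p) d ∧ 0 < cross a (x - p)} := by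
  have h1 : Continuous (fun x => cross (x - p) d) :=
    (continuous_cross_right d).comp (continuous_sub_right p)
  have h2 : Continuous (fun x => cross a (x - p)) :=
    (continuous_cross_left a).comp (continuous_sub_right p)
  exact (isClosed_le continuous_const h1).measurableSet.inter
    (isOpen_lt continuous_const h2).measurableSet

/-- The divergence theorem in a sector. -/
theorem integral_sector_fderiv {a b d : Plane} (h : Inner a b d) (p : Plane)
    {F : Plane → ℝ} (hF : F ∈ Smooth) :
    ∫ x in {x | x - p ∈ Sector a b d}, fderiv ℝ F x d =
      -(cross a d * ∫ s in Ioi (0 : ℝ), F (p + s • a))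
        - cross d b * ∫ s in Ioi (0 : ℝ), F (p + s • b) := by
  obtain ⟨h1, h2⟩ := h
  -- The splitting ray is assigned to `A` alone, which turns the overlapping alternatives in
  -- `Sector` into a disjoint union.
  set A : Set Plane := {x | 0 ≤ cross (x - p) d ∧ 0 < cross a (x - p)}
  set B : Set Plane := {x | 0 < cross d (x - p) ∧ 0 < cross (x - p) b}
  have hA : MeasurableSet A := measurableSet_halfplane_inter a d p
  have c1 : Continuous (fun x => cross d (x - p)) :=
    (continuous_cross_left d).comp (continuous_sub_right p)
  have c2 : Continuous (fun x => cross (x - p) b) :=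
    (continuous_cross_right b).comp (continuous_sub_right p)
  have hB : MeasurableSet B := (isOpen_lt continuous_const c1).measurableSet.inter
    (isOpen_lt continuous_const c2).measurableSet
  have e : {x | x - p ∈ Sector a b d} = A ∪ B := by
    ext x
    simp only [Sector, A, B, mem_ofPred_eq, mem_union]
    constructor
    · rintro (hx | ⟨hx, hx'⟩)
      · exact Or.inl hx
      · rcases hx.eq_or_lt with h0 | h0
        -- On the line of `d` one term of the Plücker relation drops out, and positivity passes from
        -- the `b` side to the `a` side.
        · refine Or.inl ⟨by rw [cross_swap, ← h0]; simp, ?_⟩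
          have e1 := cross_mul_cross a (x - p) d b
          rw [← h0, mul_zero, zero_add] at e1
          have : 0 < cross a (x - p) * cross d b := by
            rw [cross_swap b, cross_swap d a] at e1
            nlinarith [mul_pos hx' h1]
          exact pos_of_mul_pos_left this h2.le
        · exact Or.inr ⟨h0, hx'⟩
    · rintro (hx | ⟨hx, hx'⟩)
      · exact Or.inl hx
      · exact Or.inr ⟨hx.le, hx'⟩
  have hdisj : Disjoint A B := by
    rw [Set.disjoint_left]
    intro x hx hx'
    have := hx.1
    have := hx'.1
    rw [cross_swap] at this
    linarith
  have hc : Continuous (fun x => fderiv ℝ F x d) :=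
    (hF.1.continuous_fderiv (by simp)).clm_apply continuous_const
  have hcs : HasCompactSupport (fun x => fderiv ℝ F x d) := by
    refine (hF.2.fderiv (𝕜 := ℝ)).mono' fun x hx => subset_closure fun h0 => hx ?_
    simp [h0]
  have hi := hc.integrable_of_hasCompactSupport hcs (μ := volume)
  rw [e, setIntegral_union hdisj hB hi.integrableOn hi.integrableOn,
    integral_quadrant_fderiv h1.ne' p hA ?_ hF,
    integral_quadrant_fderiv (a := b) (by rw [cross_swap]; exact neg_ne_zero.mpr h2.ne') p hB ?_ hF,
    abs_of_pos h1, cross_swap b, abs_neg, abs_of_pos h2]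
  · ring
  · intro z _
    simp only [B, oblique, mem_ofPred_eq, add_sub_cancel_left, cross_add_left, cross_add_right,
      cross_smul_left, cross_smul_right, cross_self, mul_zero, add_zero, zero_add,
      mul_pos_iff_of_pos_right h2]
  · intro z hz
    simp only [A, oblique, mem_ofPred_eq, add_sub_cancel_left, cross_add_left, cross_add_right,
      cross_smul_left, cross_smul_right, cross_self, mul_zero, add_zero, zero_add,
      mul_pos_iff_of_pos_right h1, mul_nonneg_iff_of_pos_right h1]
    exact and_congr_left fun _ => ⟨fun hh => lt_of_le_of_ne hh (Ne.symm hz), le_of_lt⟩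

end Plate

/-! ### Local geometry of the polygonal domain -/

/-- If `t` missed the frontier, `u` and the complement of its closure would separate `t`. -/
theorem IsPreconnected.exists_mem_frontier {X : Type*} [TopologicalSpace X] {t u : Set X}
    (ht : IsPreconnected t) (hu : IsOpen u) (h1 : (t ∩ u).Nonempty) (h2 : ∃ x ∈ t, x ∉ u) :
    ∃ z ∈ t, z ∈ frontier u := by
  by_contra! hcon
  rw [hu.frontier_eq] at hcon
  have hsub : t ⊆ u ∪ (closure u)ᶜ := fun x hx => by
    by_cases hxu : x ∈ u
    · exact Or.inl hxu
    · exact Or.inr fun hc => hcon x hx ⟨hc, hxu⟩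
  obtain ⟨x, hxt, hxu⟩ := h2
  obtain ⟨z, _, hz1, hz2⟩ := ht u (closure u)ᶜ hu isClosed_closure.isOpen_compl hsub h1
    ⟨x, hxt, (hsub hxt).resolve_left hxu⟩
  exact hz2 (subset_closure hz1)

namespace Plate

theorem sector_not_ray {a b d : Plane} (h : Inner a b d) {s : ℝ} (hs : 0 ≤ s) :
    s • a ∉ Sector a b d := by
  rintro (⟨_, h2⟩ | ⟨h1, h2⟩)
  · rw [cross_smul_right, cross_self, mul_zero] at h2
    exact lt_irrefl _ h2
  · rw [cross_smul_right, cross_swap] at h1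
    rcases hs.eq_or_lt with rfl | hs
    · simp [cross] at h2
    · nlinarith [mul_pos hs h.1]

theorem sector_not_ray' {a b d : Plane} (h : Inner a b d) {s : ℝ} (hs : 0 ≤ s) :
    s • b ∉ Sector a b d := by
  rintro (⟨h1, h2⟩ | ⟨_, h2⟩)
  · rw [cross_smul_left, cross_swap] at h1
    rcases hs.eq_or_lt with rfl | hs
    · simp [cross] at h2
    · nlinarith [mul_pos hs h.2]
  · rw [cross_smul_left, cross_self, mul_zero] at h2
    exact lt_irrefl _ h2

theorem norm_sq_plane (x : Plane) : ‖x‖ ^ 2 = x 0 ^ 2 + x 1 ^ 2 := by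
  rw [EuclideanSpace.norm_sq_eq]
  simp [Fin.sum_univ_two]

/-- Any two rays that do not coincide have an inner direction between them. -/
theorem exists_inner {a b : Plane} (ha : ‖a‖ = 1) (hb : ‖b‖ = 1) (hab : a ≠ b) :
    ∃ d, Inner a b d := by
  have ha2 := norm_sq_plane a
  have hb2 := norm_sq_plane b
  rw [ha] at ha2
  rw [hb] at hb2
  -- The bisector `a + b` works for a convex angle and its negative for a reflex one. In the
  -- degenerate case `b = -a`, since equality is excluded, and a quarter turn of `a` serves.
  rcases lt_trichotomy (cross a b) 0 with h | h | h
  · refine ⟨-(a + b), ?_, ?_⟩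
    · rw [cross_neg_right, cross_add_right, cross_self]; linarith
    · rw [cross_neg_left, cross_add_left, cross_self]; linarith
  · refine ⟨!₂[-a 1, a 0], ?_, ?_⟩
    · simp [cross]; nlinarith
    · have hc : a 0 * b 1 = a 1 * b 0 := by simp only [cross] at h; linarith
      have e0 : b 0 = (a 0 * b 0 + a 1 * b 1) * a 0 := by linear_combination b 0 * ha2 - a 1 * hc
      have e1 : b 1 = (a 0 * b 0 + a 1 * b 1) * a 1 := by linear_combination b 1 * ha2 + a 0 * hc
      have hk : (a 0 * b 0 + a 1 * b 1) ^ 2 = 1 := by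
        linear_combination (-(a 0 * b 1) + a 1 * b 0) * hc - ha2 + (- (a 0)^2 - (a 1)^2) * hb2
      have hk' : (a 0 * b 0 + a 1 * b 1) ≠ 1 := by
        intro h1
        refine hab ?_
        ext i
        fin_cases i
        · simp only [Fin.zero_eta]; rw [e0, h1, one_mul]
        · simp only [Fin.mk_one]; rw [e1, h1, one_mul]
      have hk1 : a 0 * b 0 + a 1 * b 1 = -1 := (sq_eq_one_iff.mp hk).resolve_left hk'
      simp [cross]
      linarith
  · refine ⟨a + b, ?_, ?_⟩
    · rw [cross_add_right, cross_self]; linarith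
    · rw [cross_add_left, cross_self]; linarith

namespace PlateDomain
variable {K : ℕ} [NeZero K] (P : PlateDomain K)

theorem succ_ne (P : PlateDomain K) (i : ZMod K) : i + 1 ≠ i := by
  have : Fact (1 < K) := ⟨by have := P.three_le; omega⟩
  intro h
  exact one_ne_zero (add_eq_left.mp h)

theorem vtx_injective : Function.Injective P.vtx := by
  intro i j h
  by_contra hij
  refine Set.disjoint_left.mp (P.simple hij) ⟨0, by simp, AffineMap.lineMap_apply_zero _ _⟩
    ⟨0, by simp, ?_⟩
  rw [AffineMap.lineMap_apply_zero, h]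

theorem len_pos (i : ZMod K) : 0 < P.len i :=
  dist_pos.mpr fun h => P.succ_ne i (P.vtx_injective h).symm

theorem len_smul_tangent (i : ZMod K) : P.len i • P.tangent i = P.vtx (i + 1) - P.vtx i := by
  rw [tangent, smul_smul, mul_inv_cancel₀ (P.len_pos i).ne', one_smul]

theorem norm_tangent (i : ZMod K) : ‖P.tangent i‖ = 1 := by
  rw [tangent, norm_smul, norm_inv, Real.norm_of_nonneg (P.len_pos i).le, ← dist_eq_norm, dist_comm]
  exact inv_mul_cancel₀ (P.len_pos i).ne'

theorem tangent_sq (i : ZMod K) : P.tangent i 0 ^ 2 + P.tangent i 1 ^ 2 = 1 := by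
  rw [← norm_sq_plane, norm_tangent, one_pow]

theorem edgePt_zero (i : ZMod K) : P.edgePt i 0 = P.vtx i := by simp [edgePt]

theorem edgePt_len (i : ZMod K) : P.edgePt i (P.len i) = P.vtx (i + 1) := by
  rw [edgePt, len_smul_tangent]; abel

theorem edgePt_add (i : ZMod K) (s t : ℝ) : P.edgePt i (s + t) = P.edgePt i s + t • P.tangent i := by
  simp only [edgePt]; module

theorem continuous_edgePt (i : ZMod K) : Continuous (P.edgePt i) := by
  unfold edgePt; fun_prop

theorem lineMap_eq_edgePt (i : ZMod K) (c : ℝ) :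
    AffineMap.lineMap (k := ℝ) (P.vtx i) (P.vtx (i + 1)) c = P.edgePt i (c * P.len i) := by
  rw [edgePt, mul_smul, len_smul_tangent, AffineMap.lineMap_apply, vsub_eq_sub, vadd_eq_add, add_comm]

theorem edgePt_eq_lineMap (i : ZMod K) (s : ℝ) :
    P.edgePt i s = AffineMap.lineMap (k := ℝ) (P.vtx i) (P.vtx (i + 1)) (s / P.len i) := by
  rw [lineMap_eq_edgePt, div_mul_cancel₀ _ (P.len_pos i).ne']

theorem segment_eq (i : ZMod K) :
    segment ℝ (P.vtx i) (P.vtx (i + 1)) = P.edgePt i '' Icc 0 (P.len i) := by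
  have hl := P.len_pos i
  rw [segment_eq_image_lineMap]
  ext x
  constructor
  · rintro ⟨c, hc, rfl⟩
    exact ⟨c * P.len i, ⟨mul_nonneg hc.1 hl.le, by nlinarith [hc.2]⟩, (P.lineMap_eq_edgePt i c).symm⟩
  · rintro ⟨s, hs, rfl⟩
    exact ⟨s / P.len i, ⟨div_nonneg hs.1 hl.le, (div_le_one hl).mpr hs.2⟩,
      (P.edgePt_eq_lineMap i s).symm⟩

theorem edgePt_mem_openSegment (i : ZMod K) {s : ℝ} (hs : s ∈ Ioo 0 (P.len i)) :
    P.edgePt i s ∈ openSegment ℝ (P.vtx i) (P.vtx (i + 1)) := by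
  have hl := P.len_pos i
  rw [openSegment_eq_image_lineMap]
  exact ⟨s / P.len i, ⟨div_pos hs.1 hl, (div_lt_one hl).mpr hs.2⟩, (P.edgePt_eq_lineMap i s).symm⟩

theorem edgePt_index_eq {i j : ZMod K} {s t : ℝ} (hs : s ∈ Ico 0 (P.len i))
    (ht : t ∈ Ico 0 (P.len j)) (h : P.edgePt i s = P.edgePt j t) : i = j := by
  by_contra hij
  have key : ∀ (k : ZMod K) (u : ℝ), u ∈ Ico 0 (P.len k) →
      P.edgePt k u ∈ AffineMap.lineMap (k := ℝ) (P.vtx k) (P.vtx (k + 1)) '' Ico 0 1 :=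
    fun k u hu => ⟨u / P.len k, ⟨div_nonneg hu.1 (P.len_pos k).le,
      (div_lt_one (P.len_pos k)).mpr hu.2⟩, (P.edgePt_eq_lineMap k u).symm⟩
  exact Set.disjoint_left.mp (P.simple hij) (key i s hs) (h ▸ key j t ht)

theorem mem_frontier_iff (x : Plane) :
    x ∈ frontier P.Ω ↔ ∃ i, ∃ s ∈ Icc 0 (P.len i), P.edgePt i s = x := by
  rw [P.frontier_eq, mem_iUnion]
  simp only [segment_eq, mem_image]

theorem edgePt_mem_frontier (i : ZMod K) {s : ℝ} (hs : s ∈ Icc 0 (P.len i)) :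
    P.edgePt i s ∈ frontier P.Ω := (P.mem_frontier_iff _).mpr ⟨i, s, hs, rfl⟩

theorem frontier_not_mem {x : Plane} (hx : x ∈ frontier P.Ω) : x ∉ P.Ω := by
  rw [P.isOpen.frontier_eq] at hx
  exact hx.2

theorem outward_edgePt (i : ZMod K) {s : ℝ} (hs : s ∈ Ioo 0 (P.len i)) : ∀ᶠ ε : ℝ in 𝓝[>] 0,
    P.edgePt i s - ε • P.len i • P.normal i ∈ P.Ω ∧
    P.edgePt i s + ε • P.len i • P.normal i ∉ P.Ω := by
  have h := P.outward i _ (P.edgePt_mem_openSegment i hs)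
  have e : P.len i • P.normal i
      = !₂[(P.vtx (i + 1) - P.vtx i) 1, -(P.vtx (i + 1) - P.vtx i) 0] := by
    rw [← len_smul_tangent]
    ext k
    fin_cases k <;> simp [normal]
  rwa [e]

theorem cross_tangent_normal (i : ZMod K) : cross (P.tangent i) (P.normal i) = -1 := by
  have := P.tangent_sq i
  simp [cross, normal]
  linarith

/-- Near `p`, the domain is the sector between the ray along edge `i` and the ray along the
reversed edge `j`. -/
structure Chart (p : Plane) (r : ℝ) (i j : ZMod K) : Prop where
  r_pos : 0 < r
  exists_inner : ∃ d, Inner (P.tangent i) (-P.tangent j) d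
  sector : ∀ d, Inner (P.tangent i) (-P.tangent j) d → ∀ x ∈ Metric.ball p r,
    (x ∈ P.Ω ↔ x - p ∈ Sector (P.tangent i) (-P.tangent j) d)
  edges : ∀ k, ∀ s ∈ Icc 0 (P.len k), P.edgePt k s ∈ Metric.ball p r → k = i ∨ k = j
  integral : ∀ F : Plane → ℝ, Continuous F → Function.support F ⊆ Metric.ball p r →
    ∀ w : ZMod K → ℝ, ∑ k, w k * ∫ s in Ioo 0 (P.len k), F (P.edgePt k s) =
      w i * (∫ s in Ioi (0 : ℝ), F (p + s • P.tangent i)) +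
      w j * ∫ s in Ioi (0 : ℝ), F (p + s • -P.tangent j)

/-- Inside the ball the frontier lies on the two rays, and both complementary sectors are connected.
So each of them is entirely inside or entirely outside `Ω`. The outward condition at one point of
the ray along edge `i` decides which is which: the sector on the left of that ray is the inner one.
-/
theorem sector_of_rays {p : Plane} {r : ℝ} (hr : 0 < r) {i : ZMod K} {b : Plane} {σ : ℝ}
    (hp : p ∈ frontier P.Ω)
    (hi : ∀ s ∈ Ioo 0 r, σ + s ∈ Ioo 0 (P.len i) ∧ p + s • P.tangent i = P.edgePt i (σ + s))
    (hj : ∀ s ∈ Ioo 0 r, p + s • b ∈ frontier P.Ω)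
    (hball : ∀ x ∈ Metric.ball p r, x ∈ frontier P.Ω →
      ∃ s : ℝ, 0 ≤ s ∧ (x = p + s • P.tangent i ∨ x = p + s • b))
    (hb : ‖b‖ = 1) {d : Plane} (hd : Inner (P.tangent i) b d) {x : Plane}
    (hx : x ∈ Metric.ball p r) : x ∈ P.Ω ↔ x - p ∈ Sector (P.tangent i) b d := by
  set a := P.tangent i
  have hr2 : r / 2 ∈ Ioo 0 r := ⟨by linarith, by linarith⟩
  obtain ⟨hs2, he2⟩ := hi (r / 2) hr2
  set n := P.len i • P.normal i
  have hn : cross a n < 0 := by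
    simp only [n, cross_smul_right, a, cross_tangent_normal]
    linarith [P.len_pos i]
  have hout := P.outward_edgePt i hs2
  rw [← he2] at hout
  set x0 := p + (r / 2) • a
  have hx0 : x0 ∈ Metric.ball p r := by
    rw [Metric.mem_ball, dist_eq_norm]
    simp only [x0, add_sub_cancel_left, norm_smul, a, P.norm_tangent]
    rw [Real.norm_of_nonneg hr2.1.le]
    linarith [hr2.2]
  have hx0d : 0 < cross (x0 - p) d := by
    simp only [x0, add_sub_cancel_left, cross_smul_left]
    exact mul_pos hr2.1 hd.1
  have hx0a : cross a (x0 - p) = 0 := by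
    simp [x0, cross_smul_right, cross_self]
  -- Small displacements of the reference point keep it in the ball and on its side of the line of
  -- `d`, so only the sign of `cross a` remains to be read off.
  have near : ∀ v : Plane, ∀ᶠ ε : ℝ in 𝓝[>] 0,
      x0 + ε • v ∈ Metric.ball p r ∧ 0 < cross (x0 + ε • v - p) d := by
    intro v
    have hc : Continuous (fun ε : ℝ => x0 + ε • v) := by fun_prop
    have hc2 : Continuous (fun ε : ℝ => cross (x0 + ε • v - p) d) :=
      (continuous_cross_right d).comp (hc.sub continuous_const)
    refine Filter.Eventually.filter_mono nhdsWithin_le_nhds ?_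
    refine (hc.continuousAt.eventually_mem (Metric.isOpen_ball.mem_nhds (by simpa using hx0))).and
      (hc2.continuousAt.eventually_mem (isOpen_Ioi.mem_nhds (by simpa using hx0d)))
  have hS : ∃ y, y ∈ ({x | x - p ∈ Sector a b d} ∩ Metric.ball p r) ∧ y ∈ P.Ω := by
    obtain ⟨ε, ⟨h1, h2⟩, h3, h4⟩ := (hout.and ((near (-n)).and self_mem_nhdsWithin)).exists
    rw [smul_neg, ← sub_eq_add_neg] at h3
    refine ⟨_, ⟨Or.inl ⟨h3.2.le, ?_⟩, h3.1⟩, h1⟩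
    rw [show x0 - ε • n - p = (x0 - p) + (-ε) • n by module, cross_add_right, hx0a,
      cross_smul_right, zero_add]
    exact mul_pos_of_neg_of_neg (neg_neg_of_pos h4) hn
  have hS' : ∃ y, y ∈ ({x | x - p ∈ Sector b a (-d)} ∩ Metric.ball p r) ∧ y ∉ P.Ω := by
    obtain ⟨ε, ⟨h1, h2⟩, h3, h4⟩ := (hout.and ((near n).and self_mem_nhdsWithin)).exists
    refine ⟨_, ⟨Or.inr ⟨?_, ?_⟩, h3.1⟩, h2⟩
    · rw [cross_neg_left, ← cross_swap]; exact h3.2.le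
    · rw [cross_swap, show x0 + ε • n - p = (x0 - p) + ε • n by module, cross_add_right, hx0a,
        cross_smul_right, zero_add]
      exact neg_pos.mpr (mul_neg_of_pos_of_neg h4 hn)
  have offS : ∀ y ∈ {x | x - p ∈ Sector a b d} ∩ Metric.ball p r, y ∉ frontier P.Ω := by
    rintro y ⟨hy, hyb⟩ hyf
    obtain ⟨s, hs, rfl | rfl⟩ := hball y hyb hyf
    · rw [mem_ofPred_eq, add_sub_cancel_left] at hy
      exact sector_not_ray hd hs hy
    · rw [mem_ofPred_eq, add_sub_cancel_left] at hy
      exact sector_not_ray' hd hs hy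
  have offS' : ∀ y ∈ {x | x - p ∈ Sector b a (-d)} ∩ Metric.ball p r, y ∉ frontier P.Ω := by
    rintro y ⟨hy, hyb⟩ hyf
    obtain ⟨s, hs, rfl | rfl⟩ := hball y hyb hyf
    · rw [mem_ofPred_eq, add_sub_cancel_left] at hy
      exact sector_not_ray' hd.swap hs hy
    · rw [mem_ofPred_eq, add_sub_cancel_left] at hy
      exact sector_not_ray hd.swap hs hy
  constructor
  · intro hxΩ
    rcases sector_cover hd (x - p) with h | h | ⟨s, hs, h⟩
    · exact h
    · exfalso
      obtain ⟨y, hy, hyΩ⟩ := hS'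
      obtain ⟨z, hz, hzf⟩ := (sector_isPreconnected hd.swap p hr).exists_mem_frontier
        P.isOpen ⟨x, ⟨h, hx⟩, hxΩ⟩ ⟨y, hy, hyΩ⟩
      exact offS' z hz hzf
    · exfalso
      rcases hs.eq_or_lt with rfl | hs
      · have : x = p := by
          rw [zero_smul, zero_smul, or_self] at h
          exact sub_eq_zero.mp h
        exact P.frontier_not_mem hp (this ▸ hxΩ)
      · rw [Metric.mem_ball, dist_eq_norm] at hx
        rcases h with h | h
        · have hsr : s ∈ Ioo 0 r := by
            rw [h, norm_smul, P.norm_tangent, mul_one, Real.norm_of_nonneg hs.le] at hx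
            exact ⟨hs, hx⟩
          obtain ⟨h1, h2⟩ := hi s hsr
          rw [← h, add_sub_cancel] at h2
          exact P.frontier_not_mem (P.edgePt_mem_frontier i (Ioo_subset_Icc_self h1)) (h2 ▸ hxΩ)
        · have hsr : s ∈ Ioo 0 r := by
            rw [h, norm_smul, hb, mul_one, Real.norm_of_nonneg hs.le] at hx
            exact ⟨hs, hx⟩
          have := hj s hsr
          rw [← h, add_sub_cancel] at this
          exact P.frontier_not_mem this hxΩ
  · intro h
    by_contra hxΩ
    obtain ⟨y, hy, hyΩ⟩ := hS
    obtain ⟨z, hz, hzf⟩ := (sector_isPreconnected hd p hr).exists_mem_frontier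
      P.isOpen ⟨y, hy, hyΩ⟩ ⟨x, ⟨h, hx⟩, hxΩ⟩
    exact offS z hz hzf

theorem dist_edgePt (i : ZMod K) (s t : ℝ) : dist (P.edgePt i s) (P.edgePt i t) = |s - t| := by
  rw [dist_eq_norm, edgePt, edgePt, add_sub_add_left_eq_sub, ← sub_smul, norm_smul, norm_tangent,
    mul_one, Real.norm_eq_abs]

/-- `F` vanishes on the edge line at distance at least `r` from the base point, so both ray and edge
may be cut at length `r`, where they coincide. -/
theorem integral_ray_forward {F : Plane → ℝ} {i : ZMod K} {σ r : ℝ} (hr : 0 < r)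
    (hF : Function.support F ⊆ Metric.ball (P.edgePt i σ) r) (hri : r ≤ P.len i - σ) :
    ∫ s in Ioi (0 : ℝ), F (P.edgePt i σ + s • P.tangent i)
      = ∫ s in Ioo σ (P.len i), F (P.edgePt i s) := by
  have hz : ∀ s, r ≤ |s - σ| → F (P.edgePt i s) = 0 := by
    intro s hs
    by_contra h
    have := hF h
    rw [Metric.mem_ball, dist_edgePt] at this
    linarith
  simp only [← edgePt_add]
  rw [setIntegral_eq_of_subset_of_forall_sdiff_eq_zero (s := Ioc 0 r) measurableSet_Ioi
      Ioc_subset_Ioi_self, ← intervalIntegral.integral_of_le hr.le,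
    intervalIntegral.integral_comp_add_left (fun s => F (P.edgePt i s)), add_zero,
    intervalIntegral.integral_of_le (by linarith), integral_Ioc_eq_integral_Ioo]
  · refine (setIntegral_eq_of_subset_of_forall_sdiff_eq_zero measurableSet_Ioo
      (Ioo_subset_Ioo_right (by linarith)) ?_).symm
    rintro s ⟨hs, hs'⟩
    refine hz s (le_abs.mpr (Or.inl ?_))
    by_contra! h
    exact hs' ⟨hs.1, by linarith⟩
  · rintro s ⟨hs, hs'⟩
    refine hz _ (le_abs.mpr (Or.inl ?_))
    by_contra! h
    exact hs' ⟨hs, by linarith⟩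

theorem integral_ray_backward {F : Plane → ℝ} {i : ZMod K} {σ r : ℝ} (hr : 0 < r)
    (hF : Function.support F ⊆ Metric.ball (P.edgePt i σ) r) (hri : r ≤ σ) :
    ∫ s in Ioi (0 : ℝ), F (P.edgePt i σ + s • -P.tangent i)
      = ∫ s in Ioo 0 σ, F (P.edgePt i s) := by
  have hz : ∀ s, r ≤ |s - σ| → F (P.edgePt i s) = 0 := by
    intro s hs
    by_contra h
    have := hF h
    rw [Metric.mem_ball, dist_edgePt] at this
    linarith
  have e : ∀ s : ℝ, P.edgePt i σ + s • -P.tangent i = P.edgePt i (σ - s) := by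
    intro s
    rw [sub_eq_add_neg, edgePt_add]
    module
  simp only [e]
  rw [setIntegral_eq_of_subset_of_forall_sdiff_eq_zero (s := Ioc 0 r) measurableSet_Ioi
      Ioc_subset_Ioi_self, ← intervalIntegral.integral_of_le hr.le,
    intervalIntegral.integral_comp_sub_left (fun s => F (P.edgePt i s)), sub_zero,
    intervalIntegral.integral_of_le (by linarith), integral_Ioc_eq_integral_Ioo]
  · refine (setIntegral_eq_of_subset_of_forall_sdiff_eq_zero measurableSet_Ioo
      (Ioo_subset_Ioo_left (by linarith)) ?_).symm
    rintro s ⟨hs, hs'⟩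
    refine hz s (le_abs.mpr (Or.inr ?_))
    by_contra! h
    exact hs' ⟨by linarith, hs.2⟩
  · rintro s ⟨hs, hs'⟩
    refine hz _ (le_abs.mpr (Or.inr ?_))
    by_contra! h
    exact hs' ⟨hs, by linarith⟩

theorem exists_ball_avoiding (p : Plane) (S : Set (ZMod K))
    (h : ∀ k ∈ S, ∀ s ∈ Icc 0 (P.len k), P.edgePt k s ≠ p) :
    ∃ r > 0, ∀ k ∈ S, ∀ s ∈ Icc 0 (P.len k), P.edgePt k s ∉ Metric.ball p r := by
  have hcl : IsClosed (⋃ k ∈ S, P.edgePt k '' Icc 0 (P.len k)) :=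
    (Set.toFinite S).isClosed_biUnion fun k _ =>
      (isCompact_Icc.image (P.continuous_edgePt k)).isClosed
  obtain ⟨r, hr, hb⟩ := Metric.isOpen_iff.mp hcl.isOpen_compl p (by
    simp only [mem_compl_iff, mem_iUnion, not_exists]
    rintro k hk ⟨s, hs, hsp⟩
    exact h k hk s hs hsp)
  refine ⟨r, hr, fun k hk s hs hmem => hb hmem ?_⟩
  simp only [mem_iUnion]
  exact ⟨k, hk, s, hs, rfl⟩

/-- Simplicity is formulated for half-open edges; the final point of edge `k` has to be read as the
initial point of edge `k + 1`. -/
theorem edgePt_index {i k : ZMod K} {σ s : ℝ} (hσ : σ ∈ Ico 0 (P.len i))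
    (hs : s ∈ Icc 0 (P.len k)) (h : P.edgePt k s = P.edgePt i σ) :
    k = i ∨ (k + 1 = i ∧ σ = 0) := by
  rcases hs.2.eq_or_lt with h1 | h1
  · right
    rw [h1, edgePt_len, ← edgePt_zero] at h
    have h2 := P.edgePt_index_eq ⟨le_rfl, P.len_pos _⟩ hσ h
    refine ⟨h2, ?_⟩
    subst h2
    have := P.dist_edgePt (k + 1) 0 σ
    rw [h, dist_self] at this
    have := abs_eq_zero.mp this.symm
    linarith
  · exact Or.inl (P.edgePt_index_eq ⟨hs.1, h1⟩ hσ h)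

/-- An edge that folds straight back would share points near the vertex with its predecessor,
against simplicity. This excludes the zero angle, for which no inner direction exists. -/
theorem tangent_ne_neg (i : ZMod K) : P.tangent (i + 1) ≠ -P.tangent i := by
  intro h
  have l1 := P.len_pos i
  have l2 := P.len_pos (i + 1)
  set s := min (P.len i) (P.len (i + 1)) / 2
  have hs : 0 < s := half_pos (lt_min l1 l2)
  have s1 : s < P.len i := (half_lt_self (lt_min l1 l2)).trans_le (min_le_left _ _)
  have s2 : s < P.len (i + 1) := (half_lt_self (lt_min l1 l2)).trans_le (min_le_right _ _)
  refine P.succ_ne i (P.edgePt_index_eq (s := s) (t := P.len i - s) ⟨hs.le, s2⟩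
    ⟨by linarith, by linarith⟩ ?_)
  rw [sub_eq_add_neg, edgePt_add, edgePt_len, edgePt, h]
  module

theorem exists_chart_vertex (i : ZMod K) : ∃ r, P.Chart (P.vtx (i + 1)) r (i + 1) i := by
  have l1 := P.len_pos i
  have l2 := P.len_pos (i + 1)
  have hne : P.tangent (i + 1) ≠ -P.tangent i := P.tangent_ne_neg i
  have hn : ‖-P.tangent i‖ = 1 := by rw [norm_neg, norm_tangent]
  obtain ⟨r0, hr0, hav⟩ := P.exists_ball_avoiding (P.vtx (i + 1)) {k | k ≠ i + 1 ∧ k ≠ i} (by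
    rintro k ⟨hk1, hk2⟩ s hs h
    rw [← edgePt_zero] at h
    rcases P.edgePt_index ⟨le_rfl, l2⟩ hs h with h | ⟨h, _⟩
    · exact hk1 h
    · exact hk2 (add_right_cancel h))
  -- Small enough to miss all other edges and to see only the near end of each of the two adjacent
  -- ones.
  set r := min r0 (min (P.len i) (P.len (i + 1)))
  have hr : 0 < r := lt_min hr0 (lt_min l1 l2)
  have hri : r ≤ P.len i := (min_le_right _ _).trans (min_le_left _ _)
  have hri' : r ≤ P.len (i + 1) := (min_le_right _ _).trans (min_le_right _ _)
  have hedges : ∀ k, ∀ s ∈ Icc 0 (P.len k), P.edgePt k s ∈ Metric.ball (P.vtx (i + 1)) r →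
      k = i + 1 ∨ k = i := by
    intro k s hs hmem
    by_contra! hk
    exact hav k hk s hs (Metric.ball_subset_ball (min_le_left _ _) hmem)
  have eb : ∀ s : ℝ, P.vtx (i + 1) + s • -P.tangent i = P.edgePt i (P.len i - s) := by
    intro s
    rw [sub_eq_add_neg, edgePt_add, edgePt_len]
    module
  refine ⟨r, hr, exists_inner (P.norm_tangent _) hn hne, fun d hd x hx => ?_, hedges, ?_⟩
  · refine P.sector_of_rays hr (σ := 0) ?_ ?_ ?_ ?_ hn hd hx
    · rw [← edgePt_zero]
      exact P.edgePt_mem_frontier _ ⟨le_rfl, l2.le⟩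
    · intro s hs
      rw [zero_add]
      exact ⟨⟨hs.1, hs.2.trans_le hri'⟩, rfl⟩
    · intro s hs
      rw [eb]
      exact P.edgePt_mem_frontier _ ⟨by linarith [hs.2], by linarith [hs.1]⟩
    · intro x hx hxf
      obtain ⟨k, s, hs, rfl⟩ := (P.mem_frontier_iff x).mp hxf
      rcases hedges k s hs hx with rfl | rfl
      · exact ⟨s, hs.1, Or.inl rfl⟩
      · refine ⟨P.len k - s, by linarith [hs.2], Or.inr ?_⟩
        rw [eb, sub_sub_cancel]
  · intro F _ hF w
    have h1 := P.integral_ray_forward (F := F) (i := i + 1) (σ := 0) hr (by rwa [edgePt_zero])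
      (by linarith)
    have h2 := P.integral_ray_backward (F := F) (i := i) (σ := P.len i) hr (by rwa [edgePt_len]) hri
    rw [edgePt_zero] at h1
    rw [edgePt_len] at h2
    rw [h1, h2, ← Finset.sum_pair (f := fun k => w k * ∫ s in Ioo 0 (P.len k), F (P.edgePt k s))
      (P.succ_ne i)]
    refine (Finset.sum_subset (Finset.subset_univ _) fun k _ hk => ?_).symm
    simp only [Finset.mem_insert, Finset.mem_singleton] at hk
    rw [setIntegral_eq_zero_of_forall_eq_zero, mul_zero]
    intro s hs
    by_contra h
    exact hk (hedges k s (Ioo_subset_Icc_self hs) (hF h))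

/-- An interior point of an edge is treated as a vertex with a straight angle: both rays belong to
the same edge, and the two ray integrals recombine to the integral over it. -/
theorem exists_chart_edge (i : ZMod K) {σ : ℝ} (hσ : σ ∈ Ioo 0 (P.len i)) :
    ∃ r, P.Chart (P.edgePt i σ) r i i := by
  have hne : P.tangent i ≠ -P.tangent i := by
    intro h
    have h1 := P.tangent_sq i
    have h2 : ∀ k, P.tangent i k = -P.tangent i k := fun k => congrArg (fun v : Plane => v k) h
    rw [self_eq_neg.mp (h2 0), self_eq_neg.mp (h2 1)] at h1
    norm_num at h1
  have hn : ‖-P.tangent i‖ = 1 := by rw [norm_neg, norm_tangent]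
  obtain ⟨r0, hr0, hav⟩ := P.exists_ball_avoiding (P.edgePt i σ) {k | k ≠ i} (by
    rintro k hk s hs h
    rcases P.edgePt_index (Ioo_subset_Ico_self hσ) hs h with h | ⟨_, h⟩
    · exact hk h
    · exact hσ.1.ne' h)
  set r := min r0 (min σ (P.len i - σ))
  have hr : 0 < r := lt_min hr0 (lt_min hσ.1 (by linarith [hσ.2]))
  have hri : r ≤ σ := (min_le_right _ _).trans (min_le_left _ _)
  have hri' : r ≤ P.len i - σ := (min_le_right _ _).trans (min_le_right _ _)
  have hedges : ∀ k, ∀ s ∈ Icc 0 (P.len k), P.edgePt k s ∈ Metric.ball (P.edgePt i σ) r →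
      k = i := by
    intro k s hs hmem
    by_contra! hk
    exact hav k hk s hs (Metric.ball_subset_ball (min_le_left _ _) hmem)
  have eb : ∀ s : ℝ, P.edgePt i σ + s • -P.tangent i = P.edgePt i (σ - s) := by
    intro s
    rw [sub_eq_add_neg, edgePt_add]
    module
  refine ⟨r, hr, exists_inner (P.norm_tangent _) hn hne, fun d hd x hx => ?_,
    fun k s hs hk => Or.inl (hedges k s hs hk), ?_⟩
  · refine P.sector_of_rays hr (σ := σ) ?_ ?_ ?_ ?_ hn hd hx
    · exact P.edgePt_mem_frontier _ (Ioo_subset_Icc_self hσ)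
    · intro s hs
      exact ⟨⟨by linarith [hs.1, hσ.1], by linarith [hs.2]⟩, (P.edgePt_add i σ s).symm⟩
    · intro s hs
      rw [eb]
      exact P.edgePt_mem_frontier _ ⟨by linarith [hs.2], by linarith [hs.1, hσ.2]⟩
    · intro x hx hxf
      obtain ⟨k, s, hs, rfl⟩ := (P.mem_frontier_iff x).mp hxf
      obtain rfl := hedges k s hs hx
      rcases le_total σ s with h | h
      · exact ⟨s - σ, by linarith, Or.inl (by rw [← edgePt_add, add_sub_cancel])⟩
      · exact ⟨σ - s, by linarith, Or.inr (by rw [eb, sub_sub_cancel])⟩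
  · intro F hFc hF w
    rw [P.integral_ray_forward hr hF hri', P.integral_ray_backward hr hF hri, ← mul_add]
    have hc : Continuous (fun s => F (P.edgePt i s)) := hFc.comp (P.continuous_edgePt i)
    have ii : ∀ a b : ℝ, IntervalIntegrable (fun s => F (P.edgePt i s)) volume a b :=
      fun a b => hc.intervalIntegrable a b
    have e : (∫ s in Ioo σ (P.len i), F (P.edgePt i s)) + ∫ s in Ioo 0 σ, F (P.edgePt i s)
        = ∫ s in Ioo 0 (P.len i), F (P.edgePt i s) := by
      simp only [← integral_Ioc_eq_integral_Ioo]
      rw [← intervalIntegral.integral_of_le hσ.1.le, ← intervalIntegral.integral_of_le hσ.2.le,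
        ← intervalIntegral.integral_of_le (P.len_pos i).le, add_comm,
        intervalIntegral.integral_add_adjacent_intervals (ii _ _) (ii _ _)]
    rw [e]
    refine Finset.sum_eq_single_of_mem i (Finset.mem_univ i) fun k _ hk => ?_
    rw [setIntegral_eq_zero_of_forall_eq_zero, mul_zero]
    intro s hs
    by_contra h
    exact hk (hedges k s (Ioo_subset_Icc_self hs) (hF h))

theorem exists_chart {p : Plane} (hp : p ∈ frontier P.Ω) : ∃ r i j, P.Chart p r i j := by
  obtain ⟨i, s, hs, rfl⟩ := (P.mem_frontier_iff p).mp hp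
  rcases hs.1.eq_or_lt with rfl | h0
  · obtain ⟨r, hr⟩ := P.exists_chart_vertex (i - 1)
    rw [sub_add_cancel] at hr
    exact ⟨r, i, i - 1, by rwa [edgePt_zero]⟩
  · rcases hs.2.eq_or_lt with rfl | h1
    · obtain ⟨r, hr⟩ := P.exists_chart_vertex i
      exact ⟨r, i + 1, i, by rwa [edgePt_len]⟩
    · obtain ⟨r, hr⟩ := P.exists_chart_edge i ⟨h0, h1⟩
      exact ⟨r, i, i, hr⟩

end PlateDomain

/-! ### The divergence theorem on the polygon -/

theorem Smooth.mul {φ χ : Plane → ℝ} (h : φ ∈ Smooth) (h' : ContDiff ℝ ∞ χ) :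
    (fun x => χ x * φ x) ∈ Smooth :=
  ⟨h'.mul h.1, h.2.mul_left⟩

theorem Smooth.differentiableAt {φ : Plane → ℝ} (h : φ ∈ Smooth) (x : Plane) :
    DifferentiableAt ℝ φ x := (h.1.differentiable (by simp)).differentiableAt

theorem fderiv_eq_pderiv (φ : Plane → ℝ) (x v : Plane) :
    fderiv ℝ φ x v = v 0 * pderiv 0 φ x + v 1 * pderiv 1 φ x := by
  have : v = v 0 • EuclideanSpace.single (0 : Fin 2) (1 : ℝ)
      + v 1 • EuclideanSpace.single (1 : Fin 2) (1 : ℝ) := by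
    ext i
    fin_cases i <;> simp
  conv_lhs => rw [this]
  simp [pderiv]

theorem pderiv_mul {φ χ : Plane → ℝ} {x : Plane} (h : DifferentiableAt ℝ φ x)
    (h' : DifferentiableAt ℝ χ x) (i : Fin 2) :
    pderiv i (fun x => φ x * χ x) x = φ x * pderiv i χ x + pderiv i φ x * χ x := by
  have := fderiv_fun_mul h h'
  simp [pderiv, this]
  ring

theorem Smooth.continuous_fderiv_apply {φ : Plane → ℝ} (h : φ ∈ Smooth) (v : Plane) :
    Continuous (fun x => fderiv ℝ φ x v) :=
  (h.1.continuous_fderiv (by simp)).clm_apply continuous_const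

theorem Smooth.hasCompactSupport_fderiv_apply {φ : Plane → ℝ} (h : φ ∈ Smooth) (v : Plane) :
    HasCompactSupport (fun x => fderiv ℝ φ x v) := by
  refine (h.2.fderiv (𝕜 := ℝ)).mono' fun x hx => subset_closure fun h0 => hx ?_
  simp [h0]

theorem Smooth.integrable_fderiv_apply {φ : Plane → ℝ} (h : φ ∈ Smooth) (v : Plane) :
    Integrable (fun x => fderiv ℝ φ x v) :=
  (Smooth.continuous_fderiv_apply h v).integrable_of_hasCompactSupport
    (Smooth.hasCompactSupport_fderiv_apply h v)

theorem Smooth.integral_fderiv_eq_zero {φ : Plane → ℝ} (h : φ ∈ Smooth) (v : Plane) :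
    ∫ x, fderiv ℝ φ x v = 0 := by
  have := integral_mul_fderiv_eq_neg_fderiv_mul_of_integrable (μ := (volume : Measure Plane))
    (f := fun _ : Plane => (1 : ℝ)) (g := φ) (v := v) (by simp)
    (by simpa using Smooth.integrable_fderiv_apply h v)
    (by simpa using h.1.continuous.integrable_of_hasCompactSupport h.2)
    (fun x _ => differentiableAt_const _) (fun x _ => Smooth.differentiableAt h x)
  simpa using this

theorem fderiv_apply_eq_zero_of_notMem_tsupport {φ : Plane → ℝ} {x : Plane} (hx : x ∉ tsupport φ)
    (v : Plane) : fderiv ℝ φ x v = 0 := by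
  have : fderiv ℝ φ x = 0 :=
    image_eq_zero_of_notMem_tsupport fun h => hx (tsupport_fderiv_subset ℝ h)
  simp [this]

/-- A smooth partition of unity on a compact set. -/
theorem exists_smooth_partition {S : Set Plane} (hS : IsCompact S) (U : Plane → Set Plane)
    (hU : ∀ p ∈ S, IsOpen (U p) ∧ p ∈ U p ∧ Bornology.IsBounded (U p)) :
    ∃ t : Finset Plane, (∀ p ∈ t, p ∈ S) ∧ ∃ χ : Plane → Plane → ℝ,
      (∀ p ∈ t, χ p ∈ Smooth ∧ (∀ x, 0 ≤ χ p x) ∧ tsupport (χ p) ⊆ U p) ∧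
      ∀ x ∈ S, ∑ p ∈ t, χ p x = 1 := by
  obtain ⟨t, htS, ht⟩ := hS.elim_nhds_subcover U fun p hp => (hU p hp).1.mem_nhds (hU p hp).2.1
  obtain ⟨f, hf⟩ := SmoothPartitionOfUnity.exists_isSubordinate (modelWithCornersSelf ℝ Plane)
    hS.isClosed (fun p : t => U p) (fun p => (hU p (htS p p.2)).1) (by
      intro x hx
      obtain ⟨p, hp, hxp⟩ := mem_iUnion₂.mp (ht hx)
      exact mem_iUnion.mpr ⟨⟨p, hp⟩, hxp⟩)
  classical
  refine ⟨t, htS, fun p => if hp : p ∈ t then f ⟨p, hp⟩ else 0, ?_, ?_⟩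
  · intro p hp
    simp only [hp, dif_pos]
    refine ⟨⟨(f ⟨p, hp⟩).contMDiff.contDiff, ?_⟩, fun x => f.nonneg _ x, hf ⟨p, hp⟩⟩
    exact HasCompactSupport.intro' (Metric.isCompact_of_isClosed_isBounded (isClosed_tsupport _)
      ((hU p (htS p hp)).2.2.subset (hf ⟨p, hp⟩))) (isClosed_tsupport _)
      fun x hx => image_eq_zero_of_notMem_tsupport hx
  · intro x hx
    have := f.sum_eq_one hx
    rw [finsum_eq_sum_of_fintype] at this
    rw [← this, ← Finset.sum_coe_sort t]
    refine Finset.sum_congr rfl fun p _ => ?_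
    simp

theorem measurableSet_sector (a b d p : Plane) : MeasurableSet {x | x - p ∈ Sector a b d} := by
  have e : {x | x - p ∈ Sector a b d}
      = {x | 0 ≤ cross (x - p) d ∧ 0 < cross a (x - p)} ∪
        {x | 0 ≤ cross (x - p) (-d) ∧ 0 < cross (-b) (x - p)} := by
    ext x
    simp only [Sector, mem_ofPred_eq, mem_union, cross_neg_left, cross_neg_right,
      ← cross_swap d, ← cross_swap _ b]
  rw [e]
  exact (measurableSet_halfplane_inter _ _ _).union (measurableSet_halfplane_inter _ _ _)

namespace PlateDomain
variable {K : ℕ} [NeZero K] (P : PlateDomain K)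

/-- On the support of `F` the domain coincides with its sector and `Γ` with the two rays. -/
theorem Chart.integral_fderiv_inner {P : PlateDomain K} {p : Plane} {r : ℝ} {i j : ZMod K}
    (h : P.Chart p r i j) {F : Plane → ℝ} (hF : F ∈ Smooth) (hs : tsupport F ⊆ Metric.ball p r)
    {d : Plane} (hd : Inner (P.tangent i) (-P.tangent j) d) :
    ∫ x in P.Ω, fderiv ℝ F x d
      = ∑ k, cross d (P.tangent k) * ∫ s in Ioo 0 (P.len k), F (P.edgePt k s) := by
  rw [h.integral F hF.1.continuous ((subset_tsupport F).trans hs)]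
  have hz : ∀ x, x ∉ Metric.ball p r → fderiv ℝ F x d = 0 := fun x hx =>
    fderiv_apply_eq_zero_of_notMem_tsupport (fun hh => hx (hs hh)) d
  have e : ∫ x in P.Ω, fderiv ℝ F x d
      = ∫ x in {x | x - p ∈ Sector (P.tangent i) (-P.tangent j) d}, fderiv ℝ F x d := by
    rw [← integral_indicator P.isOpen.measurableSet,
      ← integral_indicator (measurableSet_sector _ _ _ _)]
    congr 1
    funext x
    by_cases hx : x ∈ Metric.ball p r
    · by_cases hxΩ : x ∈ P.Ω
      · rw [indicator_of_mem hxΩ, indicator_of_mem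
          (s := {x | x - p ∈ Sector (P.tangent i) (-P.tangent j) d}) ((h.sector d hd x hx).mp hxΩ)]
      · rw [indicator_of_notMem hxΩ, indicator_of_notMem
          (s := {x | x - p ∈ Sector (P.tangent i) (-P.tangent j) d})
          (fun hh => hxΩ ((h.sector d hd x hx).mpr hh))]
    · simp only [indicator, hz x hx, ite_self]
  rw [e, integral_sector_fderiv hd p hF, cross_swap d (P.tangent i), cross_neg_right]
  ring

/-- Both sides are linear in the direction and inner directions form an open set, so an arbitrary
`v` is a multiple of the difference of the inner directions `d + ε v` and `d`. -/
theorem Chart.integral_fderiv {P : PlateDomain K} {p : Plane} {r : ℝ} {i j : ZMod K}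
    (h : P.Chart p r i j) {F : Plane → ℝ} (hF : F ∈ Smooth) (hs : tsupport F ⊆ Metric.ball p r)
    (v : Plane) :
    ∫ x in P.Ω, fderiv ℝ F x v
      = ∑ k, cross v (P.tangent k) * ∫ s in Ioo 0 (P.len k), F (P.edgePt k s) := by
  obtain ⟨d, hd⟩ := h.exists_inner
  have hc : Continuous (fun ε : ℝ => d + ε • v) := by fun_prop
  have hev : ∀ᶠ ε : ℝ in 𝓝 0, Inner (P.tangent i) (-P.tangent j) (d + ε • v) :=
    hc.continuousAt.eventually_mem ((isOpen_inner _ _).mem_nhds (by simpa using hd))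
  obtain ⟨ε, h1, h2⟩ := ((hev.filter_mono nhdsWithin_le_nhds).and
    (self_mem_nhdsWithin (s := Ioi (0 : ℝ)))).exists
  have e1 := h.integral_fderiv_inner hF hs hd
  have e2 := h.integral_fderiv_inner hF hs h1
  simp only [map_add, map_smul, smul_eq_mul, cross_add_left, cross_smul_left, add_mul,
    Finset.sum_add_distrib] at e2
  rw [integral_add (Smooth.integrable_fderiv_apply hF d).integrableOn
    ((Smooth.integrable_fderiv_apply hF v).integrableOn.const_mul ε), integral_const_mul, e1] at e2
  have e3 := add_left_cancel e2
  simp only [mul_assoc, ← Finset.mul_sum] at e3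
  exact mul_left_cancel₀ (ne_of_gt h2) e3

theorem isCompact_closure : IsCompact (closure P.Ω) := P.isBounded.isCompact_closure

theorem edgePt_mem_closure (i : ZMod K) {s : ℝ} (hs : s ∈ Icc 0 (P.len i)) :
    P.edgePt i s ∈ closure P.Ω := frontier_subset_closure (P.edgePt_mem_frontier i hs)

/-- A radius for which the ball around `p ∈ closure Ω` lies in `Ω` or is covered by a chart. -/
def LocalRadius (p : Plane) (r : ℝ) : Prop :=
  0 < r ∧ (Metric.ball p r ⊆ P.Ω ∨ ∃ i j, P.Chart p r i j)

theorem exists_localRadius {p : Plane} (hp : p ∈ closure P.Ω) : ∃ r, P.LocalRadius p r := by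
  by_cases h : p ∈ P.Ω
  · obtain ⟨r, hr, hb⟩ := Metric.isOpen_iff.mp P.isOpen p h
    exact ⟨r, hr, Or.inl hb⟩
  · have hf : p ∈ frontier P.Ω := by rw [P.isOpen.frontier_eq]; exact ⟨hp, h⟩
    obtain ⟨r, i, j, hc⟩ := P.exists_chart hf
    exact ⟨r, hc.r_pos, Or.inr ⟨i, j, hc⟩⟩

theorem exists_local_partition : ∃ (t : Finset Plane) (r : Plane → ℝ) (χ : Plane → Plane → ℝ),
    (∀ p ∈ t, P.LocalRadius p (r p) ∧ χ p ∈ Smooth ∧ (∀ x, 0 ≤ χ p x) ∧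
      tsupport (χ p) ⊆ Metric.ball p (r p)) ∧
    ∀ x ∈ closure P.Ω, ∑ p ∈ t, χ p x = 1 := by
  have hr : ∀ p, ∃ r, p ∈ closure P.Ω → P.LocalRadius p r := fun p => by
    by_cases hp : p ∈ closure P.Ω
    · obtain ⟨r, hr⟩ := P.exists_localRadius hp
      exact ⟨r, fun _ => hr⟩
    · exact ⟨0, fun h => absurd h hp⟩
  choose r hr using hr
  obtain ⟨t, ht, χ, hχ, hsum⟩ := exists_smooth_partition P.isCompact_closure
    (fun p => Metric.ball p (r p)) (fun p hp => ⟨Metric.isOpen_ball,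
      Metric.mem_ball_self (hr p hp).1, Metric.isBounded_ball⟩)
  exact ⟨t, r, χ, fun p hp => ⟨hr p (ht p hp), hχ p hp⟩, hsum⟩

theorem integral_fderiv_of_localRadius {p : Plane} {r : ℝ} (h : P.LocalRadius p r) {F : Plane → ℝ}
    (hF : F ∈ Smooth) (hs : tsupport F ⊆ Metric.ball p r) (v : Plane) :
    ∫ x in P.Ω, fderiv ℝ F x v
      = ∑ k, cross v (P.tangent k) * ∫ s in Ioo 0 (P.len k), F (P.edgePt k s) := by
  obtain ⟨_, h | ⟨i, j, h⟩⟩ := h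
  · rw [setIntegral_eq_integral_of_forall_compl_eq_zero
      (fun x hx => fderiv_apply_eq_zero_of_notMem_tsupport (fun hh => hx (h (hs hh))) v),
      Smooth.integral_fderiv_eq_zero hF v, Finset.sum_eq_zero]
    intro k _
    rw [setIntegral_eq_zero_of_forall_eq_zero, mul_zero]
    intro s hs'
    exact image_eq_zero_of_notMem_tsupport fun hh =>
      P.frontier_not_mem (P.edgePt_mem_frontier k (Ioo_subset_Icc_self hs')) (h (hs hh))
  · exact h.integral_fderiv hF hs v

theorem integrableOn_edge {F : Plane → ℝ} (hF : Continuous F) (k : ZMod K) :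
    IntegrableOn (fun s => F (P.edgePt k s)) (Ioo 0 (P.len k)) :=
  ((hF.comp (P.continuous_edgePt k)).continuousOn.integrableOn_Icc).mono_set Ioo_subset_Icc_self

/-- The divergence theorem for smooth functions on the polygonal domain; the factor
`cross v (tangent k)` is the normal component of `v`. -/
theorem integral_fderiv {F : Plane → ℝ} (hF : F ∈ Smooth) (v : Plane) :
    ∫ x in P.Ω, fderiv ℝ F x v
      = ∑ k, cross v (P.tangent k) * ∫ s in Ioo 0 (P.len k), F (P.edgePt k s) := by
  obtain ⟨t, r, χ, hχ, hsum⟩ := P.exists_local_partition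
  have hm : ∀ p ∈ t, (fun x => χ p x * F x) ∈ Smooth := fun p hp => Smooth.mul hF (hχ p hp).2.1.1
  have hloc := Finset.sum_congr rfl fun p hp => P.integral_fderiv_of_localRadius (hχ p hp).1
    (hm p hp) ((tsupport_mul_subset_left).trans (hχ p hp).2.2.2) v
  have e1 : ∫ x in P.Ω, fderiv ℝ F x v
      = ∑ p ∈ t, ∫ x in P.Ω, fderiv ℝ (fun x => χ p x * F x) x v := by
    rw [← integral_finsetSum _ fun p hp => (Smooth.integrable_fderiv_apply (hm p hp) v).integrableOn]
    refine setIntegral_congr_fun P.isOpen.measurableSet fun x hx => ?_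
    -- The partition sums to one in a whole neighbourhood of `x` because `Ω` is open; only therefore
    -- may the identity be differentiated.
    have h1 : F =ᶠ[𝓝 x] fun y => ∑ p ∈ t, χ p y * F y := by
      filter_upwards [P.isOpen.mem_nhds hx] with y hy
      rw [← Finset.sum_mul, hsum y (subset_closure hy), one_mul]
    rw [h1.fderiv_eq, fderiv_fun_sum fun p hp => Smooth.differentiableAt (hm p hp) x]
    simp
  rw [e1, hloc, Finset.sum_comm]
  refine Finset.sum_congr rfl fun k _ => ?_
  rw [← Finset.mul_sum, ← integral_finsetSum _ fun p hp =>
    P.integrableOn_edge (hm p hp).1.continuous k]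
  congr 1
  refine setIntegral_congr_fun measurableSet_Ioo fun s hs => ?_
  rw [← Finset.sum_mul, hsum _ (P.edgePt_mem_closure k (Ioo_subset_Icc_self hs)), one_mul]

end PlateDomain

/-! ### The trace inequality -/

theorem norm_toLp_sq {α : Type*} [MeasurableSpace α] {μ : Measure α} {f : α → ℝ}
    (hf : MemLp f 2 μ) : ‖hf.toLp f‖ ^ 2 = ∫ x, f x ^ 2 ∂μ := by
  rw [← real_inner_self_eq_norm_sq, L2.inner_def]
  refine integral_congr_ae ?_
  filter_upwards [hf.coeFn_toLp] with x hx
  simp [hx, sq]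

theorem H1.norm_sq {Ω : Set Plane} (u : H1 Ω) :
    ‖u‖ ^ 2 = ‖H1.fn u‖ ^ 2 + (‖H1.d u 0‖ ^ 2 + ‖H1.d u 1‖ ^ 2) := by
  have h1 : ‖u‖ ^ 2 = ‖u.1.fst‖ ^ 2 + ‖u.1.snd‖ ^ 2 := WithLp.prod_norm_sq_eq_of_L2 u.1
  rw [h1, PiLp.norm_sq_eq_of_L2, Fin.sum_univ_two]
  rfl

theorem Smooth.integrable_sq {φ : Plane → ℝ} (h : φ ∈ Smooth) (Ω : Set Plane) :
    IntegrableOn (fun x => φ x ^ 2) Ω :=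
  (Smooth.memLp h Ω).integrable_sq

theorem Smooth.integrable_pderiv_sq {φ : Plane → ℝ} (h : φ ∈ Smooth) (Ω : Set Plane) (i : Fin 2) :
    IntegrableOn (fun x => pderiv i φ x ^ 2) Ω :=
  (Smooth.memLp_pderiv h Ω i).integrable_sq

theorem norm_fn_smoothToH1_sq (Ω : Set Plane) (φ : Smooth) :
    ‖H1.fn (smoothToH1 Ω φ)‖ ^ 2 = ∫ x in Ω, φ.1 x ^ 2 :=
  norm_toLp_sq (Smooth.memLp φ.2 Ω)

theorem norm_d_smoothToH1_sq (Ω : Set Plane) (φ : Smooth) (i : Fin 2) :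
    ‖H1.d (smoothToH1 Ω φ) i‖ ^ 2 = ∫ x in Ω, pderiv i φ.1 x ^ 2 :=
  norm_toLp_sq (Smooth.memLp_pderiv φ.2 Ω i)

theorem norm_smoothToH1_sq (Ω : Set Plane) (φ : Smooth) :
    ‖smoothToH1 Ω φ‖ ^ 2
      = ∫ x in Ω, φ.1 x ^ 2 + (pderiv 0 φ.1 x ^ 2 + pderiv 1 φ.1 x ^ 2) := by
  have i0 := Smooth.integrable_pderiv_sq φ.2 Ω 0
  have i1 := Smooth.integrable_pderiv_sq φ.2 Ω 1
  have e : ∫ x in Ω, φ.1 x ^ 2 + (pderiv 0 φ.1 x ^ 2 + pderiv 1 φ.1 x ^ 2)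
      = (∫ x in Ω, φ.1 x ^ 2) + ((∫ x in Ω, pderiv 0 φ.1 x ^ 2) + ∫ x in Ω, pderiv 1 φ.1 x ^ 2) := by
    rw [← integral_add i0 i1]
    exact integral_add (Smooth.integrable_sq φ.2 Ω) (i0.add i1)
  have h0 := norm_fn_smoothToH1_sq Ω φ
  have h1 := norm_d_smoothToH1_sq Ω φ 0
  have h2 := norm_d_smoothToH1_sq Ω φ 1
  have h3 := H1.norm_sq (smoothToH1 Ω φ)
  linarith

theorem Smooth.exists_bound {φ : Plane → ℝ} (h : φ ∈ Smooth) : ∃ M, 0 ≤ M ∧ ∀ x, |φ x| ≤ M := by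
  obtain ⟨C, hC⟩ := h.2.exists_bound_of_continuous h.1.continuous
  exact ⟨C, (norm_nonneg _).trans (hC 0), hC⟩

theorem Smooth.exists_bound_fderiv {φ : Plane → ℝ} (h : φ ∈ Smooth) (v : Plane) :
    ∃ M, 0 ≤ M ∧ ∀ x, |fderiv ℝ φ x v| ≤ M := by
  obtain ⟨C, hC⟩ := (Smooth.hasCompactSupport_fderiv_apply h v).exists_bound_of_continuous
    (Smooth.continuous_fderiv_apply h v)
  exact ⟨C, (norm_nonneg _).trans (hC 0), hC⟩

/-- Young's inequality, pointwise, for the derivative of `χ φ²` in a direction `d`: here `f`, `D0`,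
`D1` stand for `φ` and its partials, `c` and `g` for `χ` and its `d`-derivative. -/
theorem quadratic_bound {f D D0 D1 c g M1 M2 d0 d1 : ℝ} (hc : 0 ≤ c) (hM1 : c ≤ M1)
    (hM2 : |g| ≤ M2) (e : D = d0 * D0 + d1 * D1) :
    -(f ^ 2 * g + c * (2 * f * D))
      ≤ (M2 + M1 + M1 * (2 * (d0 ^ 2 + d1 ^ 2))) * (f ^ 2 + (D0 ^ 2 + D1 ^ 2)) := by
  have hM2' := (abs_nonneg g).trans hM2
  have hM1' := hc.trans hM1
  have b2 := abs_le.mp hM2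
  have hD : D ^ 2 ≤ 2 * (d0 ^ 2 + d1 ^ 2) * (D0 ^ 2 + D1 ^ 2) := by
    rw [e]
    nlinarith [sq_nonneg (d0 * D0 - d1 * D1), sq_nonneg (d0 * D1), sq_nonneg (d1 * D0)]
  have t1 : -(f ^ 2 * g) ≤ M2 * f ^ 2 := by nlinarith [sq_nonneg f]
  have t2 : -(c * (2 * f * D)) ≤ M1 * (f ^ 2 + D ^ 2) := by
    have h1 : -(2 * f * D) ≤ f ^ 2 + D ^ 2 := by nlinarith [sq_nonneg (f + D)]
    have h2 := mul_le_mul_of_nonneg_left h1 hc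
    have h3 : c * (f ^ 2 + D ^ 2) ≤ M1 * (f ^ 2 + D ^ 2) :=
      mul_le_mul_of_nonneg_right hM1 (by positivity)
    linarith
  have t3 := mul_le_mul_of_nonneg_left hD hM1'
  have t4 : 0 ≤ (M2 + M1) * (D0 ^ 2 + D1 ^ 2) := by positivity
  have t5 : 0 ≤ M1 * (2 * (d0 ^ 2 + d1 ^ 2)) * f ^ 2 := by positivity
  linarith

namespace PlateDomain
variable {K : ℕ} [NeZero K] (P : PlateDomain K)

theorem norm_smoothToBdry_sq (φ : Smooth) :
    ‖P.smoothToBdry φ‖ ^ 2 = ∑ k, ∫ s in Ioo 0 (P.len k), φ.1 (P.edgePt k s) ^ 2 := by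
  rw [PiLp.norm_sq_eq_of_L2]
  exact Finset.sum_congr rfl fun k _ => norm_toLp_sq (P.memLp_edge φ.2 k)

theorem exists_bound_integral_fderiv_mul_sq {χ : Plane → ℝ} (hχ : χ ∈ Smooth)
    (hχ0 : ∀ x, 0 ≤ χ x) (d : Plane) : ∃ C, 0 ≤ C ∧ ∀ φ : Smooth,
      -∫ x in P.Ω, fderiv ℝ (fun x => χ x * (φ.1 x * φ.1 x)) x d
        ≤ C * ‖smoothToH1 P.Ω φ‖ ^ 2 := by
  obtain ⟨M1, hM1, hb1⟩ := Smooth.exists_bound hχ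
  obtain ⟨M2, hM2, hb2⟩ := Smooth.exists_bound_fderiv hχ d
  set C1 := M2 + M1 + M1 * (2 * (d 0 ^ 2 + d 1 ^ 2))
  have hC1 : 0 ≤ C1 := by positivity
  refine ⟨C1, hC1, fun φ => ?_⟩
  have hF : (fun x => χ x * (φ.1 x * φ.1 x)) ∈ Smooth :=
    Smooth.mul (Smooth.mul φ.2 φ.2.1) hχ.1
  have hn := norm_smoothToH1_sq P.Ω φ
  rw [hn, ← integral_neg, ← integral_const_mul]
  clear hn
  have i0 := Smooth.integrable_pderiv_sq φ.2 P.Ω 0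
  have i1 := Smooth.integrable_pderiv_sq φ.2 P.Ω 1
  refine integral_mono (Smooth.integrable_fderiv_apply hF d).integrableOn.neg
    (((Smooth.integrable_sq φ.2 P.Ω).add (i0.add i1)).const_mul C1) fun x => ?_
  have dφ := Smooth.differentiableAt φ.2 x
  have e : fderiv ℝ (fun x => χ x * (φ.1 x * φ.1 x)) x d
      = φ.1 x ^ 2 * fderiv ℝ χ x d + χ x * (2 * φ.1 x * fderiv ℝ φ.1 x d) := by
    rw [fderiv_fun_mul (Smooth.differentiableAt hχ x) (dφ.fun_mul dφ), fderiv_fun_mul dφ dφ]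
    simp
    ring
  rw [e]
  exact quadratic_bound (hχ0 x) ((le_abs_self _).trans (hb1 x)) (hb2 x) (fderiv_eq_pderiv φ.1 x d)

/-- An inner direction points strictly inward across both edges at `p`. Hence the flux of `χ φ² d`
through `Γ` controls the weighted boundary integral, while the divergence theorem expresses that
flux by a volume integral bounded by the `H¹` norm. -/
theorem local_trace_bound {p : Plane} {r : ℝ} (h : P.LocalRadius p r) {χ : Plane → ℝ}
    (hχ : χ ∈ Smooth) (hχ0 : ∀ x, 0 ≤ χ x) (hs : tsupport χ ⊆ Metric.ball p r) :
    ∃ C, 0 ≤ C ∧ ∀ φ : Smooth,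
      ∑ k, ∫ s in Ioo 0 (P.len k), χ (P.edgePt k s) * φ.1 (P.edgePt k s) ^ 2
        ≤ C * ‖smoothToH1 P.Ω φ‖ ^ 2 := by
  obtain ⟨_, h | ⟨i, j, h⟩⟩ := h
  · refine ⟨0, le_rfl, fun φ => ?_⟩
    rw [zero_mul, Finset.sum_eq_zero]
    intro k _
    refine setIntegral_eq_zero_of_forall_eq_zero fun s hs' => ?_
    rw [image_eq_zero_of_notMem_tsupport (f := χ) fun hh => P.frontier_not_mem
      (P.edgePt_mem_frontier k (Ioo_subset_Icc_self hs')) (h (hs hh)), zero_mul]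
  · obtain ⟨d, hd⟩ := h.exists_inner
    -- The smaller of the two inward normal components of `d`.
    set c := min (cross (P.tangent i) d) (cross d (-P.tangent j))
    have hc : 0 < c := lt_min hd.1 hd.2
    obtain ⟨C1, hC1, hC⟩ := P.exists_bound_integral_fderiv_mul_sq hχ hχ0 d
    refine ⟨c⁻¹ * C1, by positivity, fun φ => ?_⟩
    have hF : (fun x => χ x * (φ.1 x * φ.1 x)) ∈ Smooth :=
      Smooth.mul (Smooth.mul φ.2 φ.2.1) hχ.1
    have hdiv := P.integral_fderiv hF d
    have hlow : c * ∑ k, ∫ s in Ioo 0 (P.len k), χ (P.edgePt k s) * φ.1 (P.edgePt k s) ^ 2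
        ≤ -∫ x in P.Ω, fderiv ℝ (fun x => χ x * (φ.1 x * φ.1 x)) x d := by
      rw [hdiv, ← Finset.sum_neg_distrib, Finset.mul_sum]
      refine Finset.sum_le_sum fun k _ => ?_
      have hnn : 0 ≤ ∫ s in Ioo 0 (P.len k), χ (P.edgePt k s) * φ.1 (P.edgePt k s) ^ 2 :=
        setIntegral_nonneg measurableSet_Ioo fun s _ => mul_nonneg (hχ0 _) (sq_nonneg _)
      simp only [← sq]
      by_cases hk : k = i ∨ k = j
      · rw [← neg_mul]
        refine mul_le_mul_of_nonneg_right ?_ hnn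
        rcases hk with rfl | rfl
        · rw [← cross_swap]; exact min_le_left _ _
        · rw [← cross_neg_right]; exact min_le_right _ _
      · rw [setIntegral_eq_zero_of_forall_eq_zero, mul_zero, mul_zero, neg_zero]
        intro s hs'
        rw [image_eq_zero_of_notMem_tsupport (f := χ) fun hh =>
          hk (h.edges k s (Ioo_subset_Icc_self hs') (hs hh)), zero_mul]
    have hup := hC φ
    have := hlow.trans hup
    rw [mul_assoc]
    rwa [le_inv_mul_iff₀ hc]

/-- The trace inequality for smooth functions. -/
theorem exists_trace_bound : ∃ C, ∀ φ : Smooth,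
    ‖P.smoothToBdry φ‖ ≤ C * ‖smoothToH1 P.Ω φ‖ := by
  obtain ⟨t, r, χ, hχ, hsum⟩ := P.exists_local_partition
  have hC : ∀ p, ∃ C, p ∈ t → 0 ≤ C ∧ ∀ φ : Smooth,
      ∑ k, ∫ s in Ioo 0 (P.len k), χ p (P.edgePt k s) * φ.1 (P.edgePt k s) ^ 2
        ≤ C * ‖smoothToH1 P.Ω φ‖ ^ 2 := fun p => by
    by_cases hp : p ∈ t
    · obtain ⟨C, h⟩ := P.local_trace_bound (hχ p hp).1 (hχ p hp).2.1 (hχ p hp).2.2.1 (hχ p hp).2.2.2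
      exact ⟨C, fun _ => h⟩
    · exact ⟨0, fun h => absurd h hp⟩
  choose C hC using hC
  have hS : 0 ≤ ∑ p ∈ t, C p := Finset.sum_nonneg fun p hp => (hC p hp).1
  refine ⟨Real.sqrt (∑ p ∈ t, C p), fun φ => ?_⟩
  refine le_of_sq_le_sq ?_ (by positivity)
  have h1 := P.norm_smoothToBdry_sq φ
  have h2 := fun p hp => (hC p hp).2 φ
  generalize ‖smoothToH1 P.Ω φ‖ = N at h2 ⊢
  rw [mul_pow, Real.sq_sqrt hS, h1, Finset.sum_mul]
  refine le_trans (le_of_eq ?_) (Finset.sum_le_sum h2)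
  rw [Finset.sum_comm]
  refine Finset.sum_congr rfl fun k _ => ?_
  rw [← integral_finsetSum]
  · refine setIntegral_congr_fun measurableSet_Ioo fun s hs => ?_
    rw [← Finset.sum_mul, hsum _ (P.edgePt_mem_closure k (Ioo_subset_Icc_self hs)), one_mul]
  · intro p hp
    exact P.integrableOn_edge (F := fun x => χ p x * φ.1 x ^ 2)
      ((hχ p hp).2.1.1.continuous.mul (φ.2.1.continuous.pow 2)) k

end PlateDomain

/-! ### Mollification and density of smooth functions -/

/-- Translations are continuous in `L²`. -/
theorem tendsto_eLpNorm_translate {f : Plane → ℝ} (hf : MemLp f 2 (volume : Measure Plane)) :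
    Tendsto (fun y => eLpNorm (fun x => f (x - y) - f x) 2 volume) (𝓝 0) (𝓝 0) := by
  let G : C(Plane, C(Plane, Plane)) :=
    ContinuousMap.curry ⟨fun z : Plane × Plane => z.2 - z.1, by fun_prop⟩
  have hG : ∀ y, MeasurePreserving (G y) (volume : Measure Plane) volume :=
    fun y => measurePreserving_sub_right volume y
  have h1 : Tendsto (fun y => Lp.compMeasurePreserving (G y) (hG y) (hf.toLp f)) (𝓝 0)
      (𝓝 (Lp.compMeasurePreserving (G 0) (hG 0) (hf.toLp f))) :=
    tendsto_const_nhds.compMeasurePreservingLp G.continuous.continuousAt hG (hG 0) (by simp)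
  rw [Lp.tendsto_Lp_iff_tendsto_eLpNorm'] at h1
  refine h1.congr fun y => eLpNorm_congr_ae ?_
  have h2 := Lp.coeFn_compMeasurePreserving (hf.toLp f) (hG y)
  have h3 := Lp.coeFn_compMeasurePreserving (hf.toLp f) (hG 0)
  have h4 := (hG y).quasiMeasurePreserving.ae_eq_comp hf.coeFn_toLp
  have h5 := (hG 0).quasiMeasurePreserving.ae_eq_comp hf.coeFn_toLp
  filter_upwards [h2, h3, h4, h5] with x e2 e3 e4 e5
  rw [Pi.sub_apply, e2, e3, e4, e5]
  simp [G]

/-- Mollification of `f` by the density `ρ`. -/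
def mollify (ρ f : Plane → ℝ) (x : Plane) : ℝ := ∫ y, ρ y * f (x - y)

theorem mollify_eq_convolution (ρ f : Plane → ℝ) :
    mollify ρ f = convolution ρ f (ContinuousLinearMap.mul ℝ ℝ) volume := rfl

theorem integrable_mollify {ρ f : Plane → ℝ} (hρ : ρ ∈ Smooth)
    (hf : LocallyIntegrable f (volume : Measure Plane)) (x : Plane) :
    Integrable (fun y => ρ y * f (x - y)) :=
  HasCompactSupport.convolutionExists_left (ContinuousLinearMap.mul ℝ ℝ) hρ.2 hρ.1.continuous hf x

/-- Jensen's inequality for a probability density, from Hölder applied to the factors `√ρ` and `√ρ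
g`. -/
theorem enorm_lintegral_sq_le {α : Type*} [MeasurableSpace α] {μ : Measure α} {ρ g : α → ENNReal}
    (hρ : AEMeasurable ρ μ) (hg : AEMeasurable g μ) (h1 : ∫⁻ y, ρ y ∂μ = 1) :
    (∫⁻ y, ρ y * g y ∂μ) ^ 2 ≤ ∫⁻ y, ρ y * g y ^ 2 ∂μ := by
  have h := ENNReal.lintegral_mul_le_Lp_mul_Lq μ Real.HolderConjugate.two_two
    (f := fun y => ρ y ^ (1 / 2 : ℝ)) (g := fun y => ρ y ^ (1 / 2 : ℝ) * g y)
    (hρ.pow_const _) ((hρ.pow_const _).mul hg)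
  have e1 : ∀ y, ρ y ^ (1 / 2 : ℝ) * ρ y ^ (1 / 2 : ℝ) = ρ y := fun y => by
    rw [← ENNReal.rpow_add_of_nonneg _ _ (by norm_num) (by norm_num)]; norm_num
  have e2 : ∀ y, (ρ y ^ (1 / 2 : ℝ)) ^ (2 : ℝ) = ρ y := fun y => by
    rw [← ENNReal.rpow_mul]; norm_num
  simp only [Pi.mul_apply, ← mul_assoc, e1, e2, ENNReal.mul_rpow_of_nonneg _ _ (show (0 : ℝ) ≤ 2 by norm_num), h1,
    ENNReal.one_rpow, one_mul] at h
  calc (∫⁻ y, ρ y * g y ∂μ) ^ 2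
      ≤ ((∫⁻ y, ρ y * g y ^ (2 : ℝ) ∂μ) ^ (1 / 2 : ℝ)) ^ 2 := by gcongr
    _ = ∫⁻ y, ρ y * g y ^ 2 ∂μ := by
      rw [← ENNReal.rpow_natCast, ← ENNReal.rpow_mul]
      norm_num

theorem eLpNorm_two_sq {α : Type*} [MeasurableSpace α] {μ : Measure α} (f : α → ℝ) :
    eLpNorm f 2 μ ^ 2 = ∫⁻ x, ‖f x‖ₑ ^ 2 ∂μ := by
  rw [eLpNorm_eq_lintegral_rpow_enorm_toReal (by norm_num) (by norm_num), ← ENNReal.rpow_natCast,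
    ← ENNReal.rpow_mul]
  norm_num

/-- The mollification error is an average of translation errors; Jensen and Tonelli carry their
bound over. The kernel need not be centred at the origin. -/
theorem eLpNorm_mollify_sub_le {f ρ : Plane → ℝ} (hf : MemLp f 2 (volume : Measure Plane))
    (hm : Measurable f) (hρ : ρ ∈ Smooth) (hρ0 : ∀ y, 0 ≤ ρ y) (hρ1 : ∫ y, ρ y = 1) {ε : ENNReal}
    (h : ∀ y, ρ y ≠ 0 → eLpNorm (fun x => f (x - y) - f x) 2 volume ≤ ε) :
    eLpNorm (fun x => mollify ρ f x - f x) 2 volume ≤ ε := by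
  have hloc : LocallyIntegrable f volume := hf.locallyIntegrable (by norm_num)
  have hρi : Integrable ρ volume := hρ.1.continuous.integrable_of_hasCompactSupport hρ.2
  have hρm : Measurable ρ := hρ.1.continuous.measurable
  have hρl : ∫⁻ y, ENNReal.ofReal (ρ y) = 1 := by
    rw [← ofReal_integral_eq_lintegral_ofReal hρi (ae_of_all _ hρ0), hρ1, ENNReal.ofReal_one]
  have hpt : ∀ x, ‖mollify ρ f x - f x‖ₑ ^ 2
      ≤ ∫⁻ y, ENNReal.ofReal (ρ y) * ‖f (x - y) - f x‖ₑ ^ 2 := by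
    intro x
    have e : mollify ρ f x - f x = ∫ y, ρ y * (f (x - y) - f x) := by
      have : f x = ∫ y, ρ y * f x := by rw [integral_mul_const, hρ1, one_mul]
      conv_lhs => rw [this]
      rw [mollify, ← integral_sub (integrable_mollify hρ hloc x) (hρi.mul_const _)]
      exact integral_congr_ae (ae_of_all _ fun y => (mul_sub _ _ _).symm)
    refine le_trans ?_ (enorm_lintegral_sq_le (by fun_prop) (by fun_prop) hρl)
    gcongr
    rw [e]
    refine (enorm_integral_le_lintegral_enorm _).trans (le_of_eq (lintegral_congr fun y => ?_))
    rw [enorm_mul, Real.enorm_of_nonneg (hρ0 y)]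
  refine (ENNReal.pow_le_pow_left_iff two_ne_zero).mp ?_
  rw [eLpNorm_two_sq]
  calc ∫⁻ x, ‖mollify ρ f x - f x‖ₑ ^ 2
      ≤ ∫⁻ x, ∫⁻ y, ENNReal.ofReal (ρ y) * ‖f (x - y) - f x‖ₑ ^ 2 := lintegral_mono hpt
    _ = ∫⁻ y, ∫⁻ x, ENNReal.ofReal (ρ y) * ‖f (x - y) - f x‖ₑ ^ 2 := by
      refine lintegral_lintegral_swap (Measurable.aemeasurable ?_)
      unfold Function.uncurry
      fun_prop
    _ ≤ ∫⁻ y, ENNReal.ofReal (ρ y) * ε ^ 2 := by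
      refine lintegral_mono fun y => ?_
      rw [lintegral_const_mul _ (by fun_prop)]
      by_cases hy : ρ y = 0
      · simp [hy]
      · gcongr
        rw [← eLpNorm_two_sq (fun x => f (x - y) - f x)]
        gcongr
        exact h y hy
    _ = ε ^ 2 := by
      rw [lintegral_mul_const _ (by fun_prop), hρl, one_mul]

theorem mollify_mem_smooth {ρ f : Plane → ℝ} (hρ : ρ ∈ Smooth)
    (hf : LocallyIntegrable f (volume : Measure Plane)) (hfc : HasCompactSupport f) :
    mollify ρ f ∈ Smooth := by
  rw [mollify_eq_convolution]
  exact ⟨hρ.2.contDiff_convolution_left _ hρ.1 hf, hρ.2.convolution _ hfc⟩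

theorem fderiv_mollify {ρ f : Plane → ℝ} (hρ : ρ ∈ Smooth)
    (hf : LocallyIntegrable f (volume : Measure Plane)) (x v : Plane) :
    fderiv ℝ (mollify ρ f) x v = ∫ y, fderiv ℝ ρ y v * f (x - y) := by
  have h := HasCompactSupport.hasFDerivAt_convolution_left (ContinuousLinearMap.mul ℝ ℝ) hρ.2
    (hρ.1.of_le (by simp)) hf x (μ := volume)
  rw [mollify_eq_convolution, h.fderiv, convolution, ContinuousLinearMap.integral_apply]
  · simp
  · exact HasCompactSupport.convolutionExists_left
      ((ContinuousLinearMap.mul ℝ ℝ).precompL Plane) (hρ.2.fderiv (𝕜 := ℝ))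
      (hρ.1.continuous_fderiv (by simp)) hf x

theorem Smooth.pderiv_mem {φ : Plane → ℝ} (h : φ ∈ Smooth) (i : Fin 2) : pderiv i φ ∈ Smooth :=
  ⟨(h.1.fderiv_right (m := ∞) (by simp)).clm_apply contDiff_const,
    Smooth.hasCompactSupport_pderiv h i⟩

theorem le_of_sq_eq_add {a b c : ℝ} (ha : 0 ≤ a) (hc : 0 ≤ c) (h : a ^ 2 = b ^ 2 + c) : b ≤ a :=
  le_of_sq_le_sq (by linarith) ha

theorem H1.norm_fn_le {Ω : Set Plane} (u : H1 Ω) : ‖H1.fn u‖ ≤ ‖u‖ :=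
  le_of_sq_eq_add (norm_nonneg _) (by positivity) (H1.norm_sq u)

theorem H1.norm_d_le {Ω : Set Plane} (u : H1 Ω) (i : Fin 2) : ‖H1.d u i‖ ≤ ‖u‖ := by
  have h := H1.norm_sq u
  obtain rfl | rfl : i = 0 ∨ i = 1 := by fin_cases i <;> simp
  · exact le_of_sq_eq_add (c := ‖H1.fn u‖ ^ 2 + ‖H1.d u 1‖ ^ 2) (norm_nonneg _) (by positivity)
      (h.trans (by ring))
  · exact le_of_sq_eq_add (c := ‖H1.fn u‖ ^ 2 + ‖H1.d u 0‖ ^ 2) (norm_nonneg _) (by positivity)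
      (h.trans (by ring))

/-- The underlying function as a linear map on `H¹(Ω)`. -/
def H1.fnLin (Ω : Set Plane) : H1 Ω →ₗ[ℝ] L2 Ω := ⟨⟨H1.fn, fun _ _ => rfl⟩, fun _ _ => rfl⟩

/-- The weak partial derivative as a linear map on `H¹(Ω)`. -/
def H1.dLin (Ω : Set Plane) (i : Fin 2) : H1 Ω →ₗ[ℝ] L2 Ω :=
  ⟨⟨fun u => H1.d u i, fun _ _ => rfl⟩, fun _ _ => rfl⟩

/-- The underlying function as a continuous linear map on `H¹(Ω)`. -/
def H1.fnL (Ω : Set Plane) : H1 Ω →L[ℝ] L2 Ω :=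
  (H1.fnLin Ω).mkContinuous 1 fun u => (H1.norm_fn_le u).trans_eq (one_mul _).symm

/-- The weak partial derivative as a continuous linear map on `H¹(Ω)`. -/
def H1.dL (Ω : Set Plane) (i : Fin 2) : H1 Ω →L[ℝ] L2 Ω :=
  (H1.dLin Ω i).mkContinuous 1 fun u => (H1.norm_d_le u i).trans_eq (one_mul _).symm

theorem memLp_mul {Ω : Set Plane} {χ : Plane → ℝ} (h : χ ∈ Smooth) (u : L2 Ω) :
    MemLp (fun x => χ x * u x) 2 (volume.restrict Ω) := by
  obtain ⟨M, _, hM⟩ := Smooth.exists_bound h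
  refine MemLp.of_le_mul (c := M) (Lp.memLp u)
    (h.1.continuous.aestronglyMeasurable.mul (Lp.aestronglyMeasurable u)) (ae_of_all _ fun x => ?_)
  rw [norm_mul]
  exact mul_le_mul_of_nonneg_right (hM x) (norm_nonneg _)

theorem memLp_mul_deriv {Ω : Set Plane} {χ : Plane → ℝ} (h : χ ∈ Smooth) (u : H1 Ω) (i : Fin 2) :
    MemLp (fun x => pderiv i χ x * H1.fn u x + χ x * H1.d u i x) 2 (volume.restrict Ω) :=
  (memLp_mul (Smooth.pderiv_mem h i) (H1.fn u)).add (memLp_mul h (H1.d u i))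

theorem IsTest.mul {Ω : Set Plane} {χ φ : Plane → ℝ} (hφ : IsTest Ω φ) (h : χ ∈ Smooth) :
    IsTest Ω (fun x => χ x * φ x) :=
  ⟨Smooth.mul hφ.1 h.1, tsupport_mul_subset_right.trans hφ.2⟩

/-- The Leibniz rule for weak derivatives, obtained by testing `u` with `χ φ`. -/
theorem weak_mul {Ω : Set Plane} {χ : Plane → ℝ} (h : χ ∈ Smooth) (u : H1 Ω) (i : Fin 2)
    {φ : Plane → ℝ} (hφ : IsTest Ω φ) :
    ∫ x in Ω, χ x * H1.fn u x * pderiv i φ x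
      = -∫ x in Ω, (pderiv i χ x * H1.fn u x + χ x * H1.d u i x) * φ x := by
  have hw : ∫ x in Ω, H1.fn u x * pderiv i (fun x => χ x * φ x) x
      = -∫ x in Ω, H1.d u i x * (χ x * φ x) := u.2 i _ (hφ.mul h)
  have e : ∀ x, pderiv i (fun x => χ x * φ x) x = χ x * pderiv i φ x + pderiv i χ x * φ x :=
    fun x => pderiv_mul (Smooth.differentiableAt h x) (Smooth.differentiableAt hφ.1 x) i
  have i1 : Integrable (fun x => χ x * H1.fn u x * pderiv i φ x) (volume.restrict Ω) :=
    (memLp_mul h (H1.fn u)).integrable_mul (Smooth.memLp_pderiv hφ.1 Ω i)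
  have i2 : Integrable (fun x => pderiv i χ x * H1.fn u x * φ x) (volume.restrict Ω) :=
    (memLp_mul (Smooth.pderiv_mem h i) (H1.fn u)).integrable_mul (Smooth.memLp hφ.1 Ω)
  have i3 : Integrable (fun x => χ x * H1.d u i x * φ x) (volume.restrict Ω) :=
    (memLp_mul h (H1.d u i)).integrable_mul (Smooth.memLp hφ.1 Ω)
  have e1 : ∫ x in Ω, H1.fn u x * pderiv i (fun x => χ x * φ x) x
      = (∫ x in Ω, χ x * H1.fn u x * pderiv i φ x) + ∫ x in Ω, pderiv i χ x * H1.fn u x * φ x := by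
    rw [← integral_add i1 i2]
    refine integral_congr_ae (ae_of_all _ fun x => ?_)
    simp only [e]
    ring
  have e2 : ∫ x in Ω, (pderiv i χ x * H1.fn u x + χ x * H1.d u i x) * φ x
      = (∫ x in Ω, pderiv i χ x * H1.fn u x * φ x) + ∫ x in Ω, χ x * H1.d u i x * φ x := by
    rw [← integral_add i2 i3]
    exact integral_congr_ae (ae_of_all _ fun x => add_mul _ _ _)
  have e3 : ∫ x in Ω, H1.d u i x * (χ x * φ x) = ∫ x in Ω, χ x * H1.d u i x * φ x :=
    integral_congr_ae (ae_of_all _ fun x => by simp only; ring)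
  rw [e1, e3] at hw
  rw [e2]
  linarith

/-- The product of a smooth function and an element of `H¹(Ω)`. -/
def mulH1 {Ω : Set Plane} {χ : Plane → ℝ} (h : χ ∈ Smooth) (u : H1 Ω) : H1 Ω :=
  ⟨WithLp.toLp 2 ((memLp_mul h (H1.fn u)).toLp _,
      WithLp.toLp 2 fun i => (memLp_mul_deriv h u i).toLp _), by
    intro i φ hφ
    refine Eq.trans ?_ ((weak_mul h u i hφ).trans ?_)
    · refine integral_congr_ae ?_
      filter_upwards [(memLp_mul h (H1.fn u)).coeFn_toLp] with x hx
      exact congrArg (· * pderiv i φ x) hx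
    · refine congrArg Neg.neg (integral_congr_ae ?_)
      filter_upwards [(memLp_mul_deriv h u i).coeFn_toLp] with x hx
      exact congrArg (· * φ x) hx.symm⟩

theorem fn_smoothToH1 (Ω : Set Plane) (φ : Smooth) :
    H1.fn (smoothToH1 Ω φ) = (Smooth.memLp φ.2 Ω).toLp φ.1 := rfl

theorem d_smoothToH1 (Ω : Set Plane) (φ : Smooth) (i : Fin 2) :
    H1.d (smoothToH1 Ω φ) i = (Smooth.memLp_pderiv φ.2 Ω i).toLp (pderiv i φ.1) := rfl

theorem fn_mulH1 {Ω : Set Plane} {χ : Plane → ℝ} (h : χ ∈ Smooth) (u : H1 Ω) :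
    H1.fn (mulH1 h u) = (memLp_mul h (H1.fn u)).toLp _ := rfl

theorem d_mulH1 {Ω : Set Plane} {χ : Plane → ℝ} (h : χ ∈ Smooth) (u : H1 Ω) (i : Fin 2) :
    H1.d (mulH1 h u) i = (memLp_mul_deriv h u i).toLp _ := rfl

theorem H1.fn_sub {Ω : Set Plane} (u v : H1 Ω) : H1.fn (u - v) = H1.fn u - H1.fn v := rfl

theorem H1.d_sub {Ω : Set Plane} (u v : H1 Ω) (i : Fin 2) :
    H1.d (u - v) i = H1.d u i - H1.d v i := rfl

namespace PlateDomain
variable {K : ℕ} [NeZero K] (P : PlateDomain K)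

/-- The interior cone condition: small shifts into the domain. -/
theorem exists_inner_shift {p : Plane} {r r' η : ℝ} (h : P.LocalRadius p r) (hr : r' < r)
    (hη : 0 < η) : ∃ (c : Plane) (κ : ℝ), 0 < κ ∧ Metric.closedBall c κ ⊆ Metric.ball 0 η ∧
      ∀ x ∈ P.Ω, x ∈ Metric.ball p r' → ∀ t ∈ Metric.closedBall c κ, x - t ∈ P.Ω := by
  set m := min η (r - r')
  have hm : 0 < m := lt_min hη (by linarith)
  have hmη : m ≤ η := min_le_left _ _
  have hmr : m ≤ r - r' := min_le_right _ _
  have hball : ∀ {x t : Plane}, x ∈ Metric.ball p r' → ‖t‖ < m → x - t ∈ Metric.ball p r := by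
    intro x t hx ht
    rw [Metric.mem_ball, dist_eq_norm] at hx ⊢
    calc ‖x - t - p‖ = ‖(x - p) - t‖ := by congr 1; abel
      _ ≤ ‖x - p‖ + ‖t‖ := norm_sub_le _ _
      _ < r := by linarith
  obtain ⟨_, h | ⟨i, j, h⟩⟩ := h
  · refine ⟨0, m / 2, by positivity, fun t ht => ?_, fun x _ hx t ht => h (hball hx ?_)⟩
    · rw [mem_closedBall_zero_iff] at ht
      rw [mem_ball_zero_iff]
      linarith
    · rw [mem_closedBall_zero_iff] at ht
      linarith
  · obtain ⟨d, hd⟩ := h.exists_inner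
    obtain ⟨κ, hκ, hκd⟩ := Metric.nhds_basis_closedBall.mem_iff.mp
      ((isOpen_inner (P.tangent i) (-P.tangent j)).mem_nhds hd)
    set N := ‖d‖ + κ
    have hN : 0 < N := by positivity
    -- Since an admissible `v` has norm at most `N`, the shift `ε v` has length at most `m / 2`.
    set ε := m / (2 * N)
    have hε : 0 < ε := by positivity
    have hεN : ε * N = m / 2 := by simp only [ε]; field_simp
    -- The ball of shifts is the scaled and reflected ball of inner directions around `d`;
    -- subtracting such a shift adds an inner direction, which preserves the sector.
    have key : ∀ t ∈ Metric.closedBall (-(ε • d)) (ε * κ), ∃ v, t = -(ε • v) ∧ ‖v - d‖ ≤ κ := by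
      intro t ht
      refine ⟨-(ε⁻¹ • t), ?_, ?_⟩
      · rw [smul_neg, neg_neg, smul_smul, mul_inv_cancel₀ hε.ne', one_smul]
      · rw [mem_closedBall_iff_norm, sub_neg_eq_add] at ht
        have e : -(ε⁻¹ • t) - d = -(ε⁻¹ • (t + ε • d)) := by
          rw [smul_add, smul_smul, inv_mul_cancel₀ hε.ne', one_smul]; abel
        rw [e, norm_neg, norm_smul, norm_inv, Real.norm_of_nonneg hε.le, inv_mul_le_iff₀ hε]
        exact ht
    have hsmall : ∀ t ∈ Metric.closedBall (-(ε • d)) (ε * κ), ‖t‖ < m := by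
      intro t ht
      obtain ⟨v, rfl, hv⟩ := key t ht
      have : ‖v‖ ≤ N := by
        calc ‖v‖ = ‖d + (v - d)‖ := by congr 1; abel
          _ ≤ ‖d‖ + ‖v - d‖ := norm_add_le _ _
          _ ≤ N := add_le_add le_rfl hv
      rw [norm_neg, norm_smul, Real.norm_of_nonneg hε.le]
      calc ε * ‖v‖ ≤ ε * N := by gcongr
        _ < m := by linarith
    refine ⟨-(ε • d), ε * κ, by positivity, fun t ht => ?_, fun x hxΩ hx t ht => ?_⟩
    · rw [mem_ball_zero_iff]
      exact (hsmall t ht).trans_le hmη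
    · have hb := hball hx (hsmall t ht)
      have hxr : x ∈ Metric.ball p r := Metric.ball_subset_ball hr.le hx
      obtain ⟨v, rfl, hv⟩ := key t ht
      rw [h.sector d hd _ hb]
      have hvi : Inner (P.tangent i) (-P.tangent j) v := hκd (by
        rw [mem_closedBall_iff_norm]; exact hv)
      have := sector_add hd (hvi.smul hε) ((h.sector d hd x hxr).mp hxΩ)
      rwa [show x - -(ε • v) - p = x - p + ε • v by abel]

end PlateDomain

/-- The product `χ u`, extended by zero. -/
def cutoff {Ω : Set Plane} (χ : Plane → ℝ) (u : H1 Ω) : Plane → ℝ :=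
  Ω.indicator fun x => χ x * H1.fn u x

/-- The partial derivative of the product `χ u`, extended by zero. -/
def cutoffDeriv {Ω : Set Plane} (χ : Plane → ℝ) (u : H1 Ω) (i : Fin 2) : Plane → ℝ :=
  Ω.indicator fun x => pderiv i χ x * H1.fn u x + χ x * H1.d u i x

theorem norm_toLp_sub_mollify_le {Ω : Set Plane} (hΩ : MeasurableSet Ω) {ρ w a b : Plane → ℝ}
    (ha : MemLp a 2 (volume.restrict Ω)) (hb : MemLp b 2 (volume.restrict Ω))
    (haw : ∀ x ∈ Ω, a x = mollify ρ w x) (hbw : ∀ x ∈ Ω, b x = w x) {ε : ℝ} (hε : 0 ≤ ε)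
    (h : eLpNorm (fun x => mollify ρ w x - w x) 2 volume ≤ ENNReal.ofReal ε) :
    ‖ha.toLp a - hb.toLp b‖ ≤ ε := by
  rw [← MemLp.toLp_sub, Lp.norm_toLp]
  refine ENNReal.toReal_le_of_le_ofReal hε (le_trans (le_of_eq (eLpNorm_congr_ae ?_))
    ((eLpNorm_mono_measure _ (Measure.restrict_le_self (s := Ω))).trans h))
  filter_upwards [ae_restrict_mem hΩ] with x hx
  rw [Pi.sub_apply, haw x hx, hbw x hx]

/-- In the first case the reflected and translated kernel is itself a test function on `Ω`, so the
weak derivative may be moved onto `w`; in the second both sides are zero. -/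
theorem mollify_pderiv {Ω : Set Plane} {ρ w g : Plane → ℝ} (hρ : ρ ∈ Smooth)
    (hw : LocallyIntegrable w (volume : Measure Plane)) {i : Fin 2}
    (hweak : ∀ θ, IsTest Ω θ → ∫ y, w y * pderiv i θ y = -∫ y, g y * θ y) {x : Plane}
    (hx : (∀ t ∈ tsupport ρ, x - t ∈ Ω) ∨ ∀ t ∈ tsupport ρ, w (x - t) = 0 ∧ g (x - t) = 0) :
    pderiv i (mollify ρ w) x = mollify ρ g x := by
  rw [pderiv, fderiv_mollify hρ hw]
  rcases hx with hx | hx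
  · set θ : Plane → ℝ := fun y => ρ (x - y)
    have hcl : IsClosed {y | x - y ∈ tsupport ρ} :=
      (isClosed_tsupport ρ).preimage (continuous_const.sub continuous_id)
    have hts : tsupport θ ⊆ {y | x - y ∈ tsupport ρ} :=
      closure_minimal (fun y hy => subset_tsupport ρ hy) hcl
    have hθ : IsTest Ω θ := by
      refine ⟨⟨hρ.1.comp (contDiff_const.sub contDiff_id), ?_⟩, fun y hy => ?_⟩
      · exact hρ.2.comp_homeomorph (Homeomorph.subLeft x)
      · have := hx _ (hts hy)
        rwa [sub_sub_cancel] at this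
    have hd : ∀ y, pderiv i θ y = -fderiv ℝ ρ (x - y) (EuclideanSpace.single i 1) := by
      intro y
      have h1 : HasFDerivAt (fun y => x - y) (-ContinuousLinearMap.id ℝ Plane) y :=
        (hasFDerivAt_id y).const_sub x
      have h2 := (Smooth.differentiableAt hρ (x - y)).hasFDerivAt.comp y h1
      have h3 : fderiv ℝ θ y = _ := h2.fderiv
      rw [pderiv, h3]
      simp
    have h := hweak θ hθ
    simp only [hd, mul_neg, integral_neg, neg_inj] at h
    rw [mollify, ← integral_sub_left_eq_self _ volume x,
      ← integral_sub_left_eq_self (fun y => ρ y * g (x - y)) volume x]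
    simp only [sub_sub_cancel]
    simpa only [mul_comm, θ] using h
  · refine integral_congr_ae (ae_of_all _ fun t => ?_)
    by_cases ht : t ∈ tsupport ρ
    · simp [hx t ht]
    · simp [fderiv_apply_eq_zero_of_notMem_tsupport ht, image_eq_zero_of_notMem_tsupport ht]

namespace PlateDomain
variable {K : ℕ} [NeZero K] (P : PlateDomain K)

/-- Extending `χ u` by zero creates a jump across `Γ`, which a centred kernel would see. The kernel
is therefore supported in a ball of shifts that move points of `Ω` near `p` further into `Ω`. For
points of `Ω`, derivative and mollification then commute, and continuity of translations in `L²`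
makes the errors small. -/
theorem exists_mollifier {p : Plane} {r : ℝ} (h : P.LocalRadius p r) {χ : Plane → ℝ}
    (hχ : χ ∈ Smooth) (hs : tsupport χ ⊆ Metric.ball p r) (u : H1 P.Ω) {ε : ℝ} (hε : 0 < ε) :
    ∃ ρ : Plane → ℝ, mollify ρ (cutoff χ u) ∈ Smooth ∧
      (∀ i, ∀ x ∈ P.Ω, pderiv i (mollify ρ (cutoff χ u)) x = mollify ρ (cutoffDeriv χ u i) x) ∧
      eLpNorm (fun x => mollify ρ (cutoff χ u) x - cutoff χ u x) 2 volume ≤ ENNReal.ofReal ε ∧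
      ∀ i, eLpNorm (fun x => mollify ρ (cutoffDeriv χ u i) x - cutoffDeriv χ u i x) 2 volume
        ≤ ENNReal.ofReal ε := by
  have hΩm := P.isOpen.measurableSet
  obtain ⟨r', hr', hs'⟩ := exists_lt_subset_ball (isClosed_tsupport χ) hs
  set w : Plane → ℝ := cutoff χ u
  set g : Fin 2 → Plane → ℝ := cutoffDeriv χ u
  have mχ := hχ.1.continuous.measurable
  have mu := (Lp.stronglyMeasurable (H1.fn u)).measurable
  have mw : Measurable w := (mχ.mul mu).indicator hΩm
  have mg : ∀ i, Measurable (g i) := fun i =>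
    (((Smooth.continuous_pderiv hχ i).measurable.mul mu).add
      (mχ.mul (Lp.stronglyMeasurable (H1.d u i)).measurable)).indicator hΩm
  have lw : MemLp w 2 volume := (memLp_indicator_iff_restrict hΩm).mpr (memLp_mul hχ (H1.fn u))
  have lg : ∀ i, MemLp (g i) 2 volume := fun i =>
    (memLp_indicator_iff_restrict hΩm).mpr (memLp_mul_deriv hχ u i)
  have zw : ∀ x, x ∉ tsupport χ → w x = 0 := fun x hx => by
    simp [w, cutoff, indicator, image_eq_zero_of_notMem_tsupport hx]
  have zg : ∀ i x, x ∉ tsupport χ → g i x = 0 := fun i x hx => by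
    simp [g, cutoffDeriv, indicator, image_eq_zero_of_notMem_tsupport hx, pderiv,
      fderiv_apply_eq_zero_of_notMem_tsupport hx]
  have hweak : ∀ i, ∀ θ, IsTest P.Ω θ → ∫ y, w y * pderiv i θ y = -∫ y, g i y * θ y := by
    intro i θ hθ
    have := weak_mul hχ u i hθ
    rw [← integral_indicator hΩm, ← integral_indicator hΩm] at this
    simpa only [w, g, cutoff, cutoffDeriv, indicator_mul_left] using this
  have hεe : (0 : ENNReal) < ENNReal.ofReal ε := ENNReal.ofReal_pos.mpr hε
  have hev := ((tendsto_eLpNorm_translate lw).eventually (Iic_mem_nhds hεe)).and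
    (eventually_all.mpr fun i => (tendsto_eLpNorm_translate (lg i)).eventually (Iic_mem_nhds hεe))
  obtain ⟨η, hη, hηb⟩ := Metric.eventually_nhds_iff_ball.mp hev
  -- The halfway radius separates two regimes: within it the cone condition applies, and beyond it
  -- shifts shorter than `(r - r') / 2` cannot reach the support of `χ`, which lies within radius
  -- `r'`.
  have hrr : (r' + r) / 2 < r := by linarith
  obtain ⟨c, κ, hκ, hcκ, hin⟩ := P.exists_inner_shift h hrr
    (lt_min hη (show 0 < (r - r') / 2 by linarith))
  let B : ContDiffBump c := ⟨κ / 2, κ, by positivity, by linarith⟩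
  set ρ : Plane → ℝ := B.normed volume
  have hρ : ρ ∈ Smooth := ⟨B.contDiff_normed, B.hasCompactSupport_normed⟩
  have tρ : tsupport ρ = Metric.closedBall c κ := B.tsupport_normed_eq
  have hρη : ∀ y, ρ y ≠ 0 → y ∈ Metric.ball 0 η := fun y hy =>
    Metric.ball_subset_ball (min_le_left _ _) (hcκ (tρ ▸ subset_tsupport ρ hy))
  have ew := eLpNorm_mollify_sub_le lw mw hρ (fun y => B.nonneg_normed y)
    (B.integral_normed (μ := volume)) fun y hy => (hηb y (hρη y hy)).1
  have eg := fun i => eLpNorm_mollify_sub_le (lg i) (mg i) hρ (fun y => B.nonneg_normed y)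
    (B.integral_normed (μ := volume)) fun y hy => (hηb y (hρη y hy)).2 i
  have iw : LocallyIntegrable w volume := lw.locallyIntegrable (by norm_num)
  have cw : HasCompactSupport w := HasCompactSupport.intro' hχ.2 (isClosed_tsupport χ) zw
  have hφ := mollify_mem_smooth hρ iw cw
  have hder : ∀ i, ∀ x ∈ P.Ω, pderiv i (mollify ρ w) x = mollify ρ (g i) x := by
    intro i x hx
    refine mollify_pderiv hρ iw (hweak i) ?_
    by_cases hxb : x ∈ Metric.ball p ((r' + r) / 2)
    · exact Or.inl fun t ht => hin x hx hxb t (tρ ▸ ht)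
    · refine Or.inr fun t ht => ?_
      have ht' : ‖t‖ < (r - r') / 2 := by
        have := hcκ (tρ ▸ ht)
        rw [mem_ball_zero_iff] at this
        exact this.trans_le (min_le_right _ _)
      have hout : x - t ∉ tsupport χ := by
        intro hh
        have h1 := hs' hh
        rw [Metric.mem_ball, dist_eq_norm] at h1 hxb
        refine hxb ?_
        calc ‖x - p‖ = ‖(x - t - p) + t‖ := by congr 1; abel
          _ ≤ ‖x - t - p‖ + ‖t‖ := norm_add_le _ _
          _ < (r' + r) / 2 := by linarith
      exact ⟨zw _ hout, zg i _ hout⟩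
  exact ⟨ρ, hφ, hder, ew, eg⟩

theorem exists_smooth_approx_local {p : Plane} {r : ℝ} (h : P.LocalRadius p r) {χ : Plane → ℝ}
    (hχ : χ ∈ Smooth) (hs : tsupport χ ⊆ Metric.ball p r) (u : H1 P.Ω) {ε : ℝ} (hε : 0 < ε) :
    ∃ φ : Smooth, ‖H1.fn (smoothToH1 P.Ω φ) - H1.fn (mulH1 hχ u)‖ ≤ ε ∧
      ∀ i, ‖H1.d (smoothToH1 P.Ω φ) i - H1.d (mulH1 hχ u) i‖ ≤ ε := by
  have hΩm := P.isOpen.measurableSet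
  have hex := P.exists_mollifier h hχ hs u hε
  obtain ⟨ρ, hφ, hder, ew, eg⟩ := hex
  refine ⟨⟨mollify ρ (cutoff χ u), hφ⟩, ?_, fun i => ?_⟩
  · rw [fn_smoothToH1, fn_mulH1]
    exact norm_toLp_sub_mollify_le hΩm (Smooth.memLp hφ P.Ω) (memLp_mul hχ (H1.fn u))
      (fun _ _ => rfl) (fun x hx => by simp [cutoff, hx]) hε.le ew
  · rw [d_smoothToH1, d_mulH1]
    exact norm_toLp_sub_mollify_le hΩm (Smooth.memLp_pderiv hφ P.Ω i) (memLp_mul_deriv hχ u i)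
      (hder i) (fun x hx => by simp [cutoffDeriv, hx]) hε.le (eg i)

end PlateDomain

theorem mem_closure_of_norm_sub_le {E : Type*} [SeminormedAddCommGroup E] {S : Set E} {x : E}
    (h : ∀ ε > 0, ∃ y ∈ S, ‖y - x‖ ≤ ε) : x ∈ closure S := by
  refine Metric.mem_closure_iff.mpr fun ε hε => ?_
  obtain ⟨y, hy, hyx⟩ := h (ε / 2) (half_pos hε)
  exact ⟨y, hy, by rw [dist_comm, dist_eq_norm]; linarith⟩

theorem H1.norm_le_of_le {Ω : Set Plane} (u : H1 Ω) {ε : ℝ} (hε : 0 ≤ ε) (h : ‖H1.fn u‖ ≤ ε)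
    (hd : ∀ i, ‖H1.d u i‖ ≤ ε) : ‖u‖ ≤ 2 * ε := by
  have h1 := H1.norm_sq u
  have h2 := pow_le_pow_left₀ (norm_nonneg _) h 2
  have h3 := pow_le_pow_left₀ (norm_nonneg _) (hd 0) 2
  have h4 := pow_le_pow_left₀ (norm_nonneg _) (hd 1) 2
  refine le_of_sq_le_sq ?_ (by positivity)
  refine h1.le.trans ?_
  nlinarith [sq_nonneg ε]

namespace PlateDomain
variable {K : ℕ} [NeZero K] (P : PlateDomain K)

theorem mulH1_mem_closure {p : Plane} {r : ℝ} (h : P.LocalRadius p r) {χ : Plane → ℝ}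
    (hχ : χ ∈ Smooth) (hs : tsupport χ ⊆ Metric.ball p r) (u : H1 P.Ω) :
    mulH1 hχ u ∈ (LinearMap.range (smoothToH1 P.Ω)).topologicalClosure := by
  refine mem_closure_of_norm_sub_le fun ε hε => ?_
  have hex := P.exists_smooth_approx_local h hχ hs u (half_pos hε)
  obtain ⟨φ, h1, h2⟩ := hex
  refine ⟨smoothToH1 P.Ω φ, ⟨φ, rfl⟩, ?_⟩
  have h3 := H1.norm_le_of_le (smoothToH1 P.Ω φ - mulH1 hχ u) (half_pos hε).le
    (by rw [H1.fn_sub]; exact h1) (fun i => by rw [H1.d_sub]; exact h2 i)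
  exact h3.trans_eq (by ring)

/-- Only the underlying functions have to be compared, as weak gradients are unique on an open set.
-/
theorem sum_mulH1 {t : Finset Plane} {χ : Plane → Plane → ℝ} (hχ : ∀ p : t, χ p ∈ Smooth)
    (hsum : ∀ x ∈ closure P.Ω, ∑ p ∈ t, χ p x = 1) (u : H1 P.Ω) :
    u = ∑ p : t, mulH1 (hχ p) u := by
  refine H1.ext_fn P.isOpen _ _ ?_
  have e : H1.fn (∑ p : t, mulH1 (hχ p) u) = ∑ p : t, H1.fn (mulH1 (hχ p) u) :=
    map_sum (H1.fnLin P.Ω) _ _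
  rw [e]
  refine Lp.ext ?_
  have h1 : ∀ p : t, H1.fn (mulH1 (hχ p) u) =ᵐ[volume.restrict P.Ω] fun x => χ p x * H1.fn u x :=
    fun p => (memLp_mul (hχ p) (H1.fn u)).coeFn_toLp
  filter_upwards [Lp.coeFn_finsetSum Finset.univ fun p : t => H1.fn (mulH1 (hχ p) u),
    eventually_all.mpr h1, ae_restrict_mem P.isOpen.measurableSet] with x hx hx1 hxΩ
  rw [hx, Finset.sum_apply]
  simp only [hx1]
  rw [← Finset.sum_mul, Finset.sum_coe_sort t fun p => χ p x, hsum x (subset_closure hxΩ), one_mul]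

/-- Smooth functions are dense in `H¹(Ω)`. -/
theorem denseRange_smoothToH1 : DenseRange (smoothToH1 P.Ω) := by
  intro u
  obtain ⟨t, r, χ, hχ, hsum⟩ := P.exists_local_partition
  have h : u ∈ (LinearMap.range (smoothToH1 P.Ω)).topologicalClosure := by
    rw [P.sum_mulH1 (fun p : t => (hχ p p.2).2.1) hsum u]
    exact Submodule.sum_mem _ fun p _ =>
      P.mulH1_mem_closure (hχ p p.2).1 (hχ p p.2).2.1 (hχ p p.2).2.2.2 u
  exact h

/-- Density and the trace inequality are both needed for `extendOfNorm` to be a genuine extension;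
every later statement about traces rests on this. -/
theorem trace_smoothToH1 (φ : Smooth) : P.trace (smoothToH1 P.Ω φ) = P.smoothToBdry φ :=
  LinearMap.extendOfNorm_eq P.denseRange_smoothToH1 P.exists_trace_bound φ

end PlateDomain

/-! ### Completeness of the Sobolev space and Green's formula -/

theorem integral_mul_eq_inner {α : Type*} [MeasurableSpace α] {μ : Measure α} (u : Lp ℝ 2 μ)
    {χ : α → ℝ} (hχ : MemLp χ 2 μ) : ∫ x, u x * χ x ∂μ = inner ℝ u (hχ.toLp χ) := by
  rw [L2.inner_def]
  refine integral_congr_ae ?_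
  filter_upwards [hχ.coeFn_toLp] with x hx
  simp [hx, mul_comm]

theorem inner_toLp_toLp {α : Type*} [MeasurableSpace α] {μ : Measure α}
    {f g : α → ℝ} (hf : MemLp f 2 μ) (hg : MemLp g 2 μ) :
    inner ℝ (hf.toLp f) (hg.toLp g) = ∫ x, f x * g x ∂μ := by
  rw [← integral_mul_eq_inner]
  refine integral_congr_ae ?_
  filter_upwards [hf.coeFn_toLp] with x hx
  rw [hx]

/-- Each test function imposes an equality between continuous functionals on the ambient Hilbert
sum, so the space is an intersection of closed sets. -/
theorem isClosed_H1 (Ω : Set Plane) :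
    IsClosed (H1 Ω : Set (WithLp 2 (L2 Ω × PiLp 2 (fun _ : Fin 2 => L2 Ω)))) := by
  have e : (H1 Ω : Set (WithLp 2 (L2 Ω × PiLp 2 (fun _ : Fin 2 => L2 Ω))))
      = ⋂ (i : Fin 2) (φ : Plane → ℝ) (hφ : IsTest Ω φ),
        {p | inner ℝ p.fst ((Smooth.memLp_pderiv hφ.1 Ω i).toLp (pderiv i φ))
          = -inner ℝ (p.snd i) ((Smooth.memLp hφ.1 Ω).toLp φ)} := by
    ext p
    simp only [mem_iInter, mem_ofPred_eq, ← integral_mul_eq_inner]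
    rfl
  rw [e]
  refine isClosed_iInter fun i => isClosed_iInter fun φ => isClosed_iInter fun hφ => ?_
  have c1 : Continuous fun p : WithLp 2 (L2 Ω × PiLp 2 (fun _ : Fin 2 => L2 Ω)) => p.fst := by
    fun_prop
  have c2 : Continuous fun p : WithLp 2 (L2 Ω × PiLp 2 (fun _ : Fin 2 => L2 Ω)) => p.snd i := by
    fun_prop
  exact isClosed_eq (c1.inner continuous_const) (c2.inner continuous_const).neg

instance (Ω : Set Plane) : CompleteSpace (H1 Ω) := (isClosed_H1 Ω).completeSpace_coe

theorem H1.continuous_fn (Ω : Set Plane) : Continuous fun u : H1 Ω => H1.fn u :=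
  (H1.fnL Ω).continuous

theorem H1.continuous_d (Ω : Set Plane) (i : Fin 2) : Continuous fun u : H1 Ω => H1.d u i :=
  (H1.dL Ω i).continuous

namespace PlateDomain
variable {K : ℕ} [NeZero K] (P : PlateDomain K)

theorem continuous_trace_apply (i : ZMod K) : Continuous fun u : H1 P.Ω => P.trace u i :=
  (PiLp.continuous_apply 2 _ i).comp P.trace.continuous

theorem cross_single_tangent (k : Fin 2) (i : ZMod K) :
    cross (EuclideanSpace.single k 1) (P.tangent i) = P.normal i k := by
  fin_cases k <;> simp [cross, normal]

theorem smoothToBdry_apply (φ : Smooth) (i : ZMod K) :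
    P.smoothToBdry φ i = (P.memLp_edge φ.2 i).toLp _ := rfl

theorem green_smooth (φ χ : Smooth) (k : Fin 2) :
    (∫ x in P.Ω, φ.1 x * pderiv k χ.1 x) + (∫ x in P.Ω, pderiv k φ.1 x * χ.1 x)
      = ∑ i, P.normal i k *
        ∫ s in Ioo 0 (P.len i), φ.1 (P.edgePt i s) * χ.1 (P.edgePt i s) := by
  have h := P.integral_fderiv (Smooth.mul χ.2 φ.2.1) (EuclideanSpace.single k 1)
  simp only [cross_single_tangent] at h
  rw [← h]
  refine (integral_add
    ((Smooth.memLp φ.2 P.Ω).integrable_mul (Smooth.memLp_pderiv χ.2 P.Ω k))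
    ((Smooth.memLp_pderiv φ.2 P.Ω k).integrable_mul (Smooth.memLp χ.2 P.Ω))).symm.trans ?_
  exact integral_congr_ae (ae_of_all _ fun x => (pderiv_mul (Smooth.differentiableAt φ.2 x)
    (Smooth.differentiableAt χ.2 x) k).symm)

/-- Green's formula in `H¹(Ω)`. -/
theorem green (u w : H1 P.Ω) (k : Fin 2) :
    inner ℝ (H1.fn u) (H1.d w k) + inner ℝ (H1.d u k) (H1.fn w)
      = ∑ i, P.normal i k * inner ℝ (P.trace u i) (P.trace w i) := by
  refine P.denseRange_smoothToH1.induction_on₂ (p := fun u w : H1 P.Ω =>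
    inner ℝ (H1.fn u) (H1.d w k) + inner ℝ (H1.d u k) (H1.fn w)
      = ∑ i, P.normal i k * inner ℝ (P.trace u i) (P.trace w i)) ?_ ?_ u w
  · have c1 := H1.continuous_fn P.Ω
    have c2 := H1.continuous_d P.Ω k
    refine isClosed_eq ?_ ?_
    · exact ((c1.comp continuous_fst).inner (c2.comp continuous_snd)).add
        ((c2.comp continuous_fst).inner (c1.comp continuous_snd))
    · refine continuous_finsetSum _ fun i _ => continuous_const.mul ?_
      exact ((P.continuous_trace_apply i).comp continuous_fst).inner
        ((P.continuous_trace_apply i).comp continuous_snd)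
  · intro φ χ
    simp only [trace_smoothToH1, smoothToBdry_apply, fn_smoothToH1, d_smoothToH1, inner_toLp_toLp]
    exact P.green_smooth φ χ k

end PlateDomain

/-! ### The Poincaré inequality and harmonic extension -/

theorem le_two_mul_of_sq_add {a b I J N L M : ℝ} (ha : 0 ≤ a) (hb : 0 ≤ b) (hM : 0 ≤ M)
    (h : a ^ 2 + I + J = 0) (hI : |I| ≤ a * N) (hJ : |J| ≤ b * L) (hN : N ≤ M * b)
    (hL : L ≤ M * a) : a ≤ 2 * M * b := by
  have c1 := (neg_le_abs I).trans (hI.trans (mul_le_mul_of_nonneg_left hN ha))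
  have c2 := (neg_le_abs J).trans (hJ.trans (mul_le_mul_of_nonneg_left hL hb))
  rcases ha.eq_or_lt with h0 | h0
  · rw [← h0]; positivity
  · refine le_of_mul_le_mul_left ?_ h0
    nlinarith

theorem norm_toLp_mul_le {Ω : Set Plane} {χ : Plane → ℝ} (h : χ ∈ Smooth) (u : L2 Ω) {M : ℝ}
    (hM : ∀ x, |χ x| ≤ M) : ‖(memLp_mul h u).toLp _‖ ≤ M * ‖u‖ := by
  refine Lp.norm_le_mul_norm_of_ae_le_mul ?_
  filter_upwards [(memLp_mul h u).coeFn_toLp] with x hx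
  rw [hx, norm_mul]
  exact mul_le_mul_of_nonneg_right (hM x) (norm_nonneg _)

namespace PlateDomain
variable {K : ℕ} [NeZero K] (P : PlateDomain K)

theorem exists_smooth_one : ∃ χ : Plane → ℝ, χ ∈ Smooth ∧ ∀ x ∈ closure P.Ω, χ x = 1 := by
  obtain ⟨t, r, χ, hχ, hsum⟩ := P.exists_local_partition
  refine ⟨fun x => ∑ p ∈ t, χ p x, ?_, hsum⟩
  have := Submodule.sum_mem Smooth (t := t) (f := χ) fun p hp => (hχ p hp).2.1
  convert this using 1
  ext x
  simp

theorem exists_smooth_coord : ∃ X : Plane → ℝ, X ∈ Smooth ∧ ∀ x ∈ P.Ω, pderiv 0 X x = 1 := by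
  obtain ⟨χ, hχ, h1⟩ := P.exists_smooth_one
  have hc : ContDiff ℝ ∞ fun x : Plane => x 0 := by fun_prop
  refine ⟨fun x => x 0 * χ x, Smooth.mul hχ hc, fun x hx => ?_⟩
  have he : (fun x : Plane => x 0 * χ x) =ᶠ[𝓝 x] fun x => x 0 := by
    filter_upwards [P.isOpen.mem_nhds hx] with y hy
    rw [h1 y (subset_closure hy), mul_one]
  have hd : HasFDerivAt (fun x : Plane => x 0) (EuclideanSpace.proj (𝕜 := ℝ) (0 : Fin 2)) x :=
    (EuclideanSpace.proj (𝕜 := ℝ) (0 : Fin 2) : Plane →L[ℝ] ℝ).hasFDerivAt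
  rw [pderiv, he.fderiv_eq, hd.fderiv]
  simp

/-- The Poincaré inequality for functions with zero trace. -/
theorem poincare : ∃ C, 0 ≤ C ∧ ∀ u : H1 P.Ω, P.trace u = 0 → ‖H1.fn u‖ ≤ C * ‖H1.d u 0‖ := by
  obtain ⟨X, hX, hX1⟩ := P.exists_smooth_coord
  obtain ⟨M, hM0, hM⟩ := Smooth.exists_bound hX
  refine ⟨2 * M, by positivity, fun u hu => ?_⟩
  -- As `∂_0 X = 1` on `Ω`, the product rule makes `‖u‖²` appear; the boundary sum vanishes, and the
  -- other two terms are bounded by a multiple of `‖u‖ ‖∂_0 u‖`.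
  have hg := P.green u (mulH1 hX u) 0
  have hz : ∀ i, P.trace u i = 0 := fun i => by rw [hu]; rfl
  simp only [hz, inner_zero_left, mul_zero, Finset.sum_const_zero] at hg
  have hd : H1.d (mulH1 hX u) 0 = H1.fn u + (memLp_mul hX (H1.d u 0)).toLp _ := by
    rw [d_mulH1]
    refine Lp.ext ?_
    filter_upwards [(memLp_mul_deriv hX u 0).coeFn_toLp, (memLp_mul hX (H1.d u 0)).coeFn_toLp,
      Lp.coeFn_add (H1.fn u) ((memLp_mul hX (H1.d u 0)).toLp _),
      ae_restrict_mem P.isOpen.measurableSet] with x h1 h2 h3 hx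
    rw [h1, h3, Pi.add_apply, h2, hX1 x hx, one_mul]
  rw [hd, fn_mulH1, inner_add_right, real_inner_self_eq_norm_sq] at hg
  clear hd hz
  have b1 := norm_toLp_mul_le hX (H1.d u 0) hM
  have b2 := norm_toLp_mul_le hX (H1.fn u) hM
  have a1 := abs_real_inner_le_norm (H1.fn u) ((memLp_mul hX (H1.d u 0)).toLp _)
  have a2 := abs_real_inner_le_norm (H1.d u 0) ((memLp_mul hX (H1.fn u)).toLp _)
  exact le_two_mul_of_sq_add (norm_nonneg _) (norm_nonneg _) hM0 hg a1 a2 b1 b2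

end PlateDomain

/-- The gradient on `H¹(Ω)`. -/
def H1.gradL (Ω : Set Plane) : H1 Ω →L[ℝ] PiLp 2 (fun _ : Fin 2 => L2 Ω) :=
  (PiLp.continuousLinearEquiv 2 ℝ (fun _ : Fin 2 => L2 Ω)).symm.toContinuousLinearMap.comp
    (ContinuousLinearMap.pi fun i => H1.dL Ω i)

theorem H1.inner_gradL {Ω : Set Plane} (u w : H1 Ω) :
    inner ℝ (H1.gradL Ω u) (H1.gradL Ω w) = ∑ j : Fin 2, inner ℝ (H1.d u j) (H1.d w j) := by
  rw [PiLp.inner_apply]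
  rfl

theorem H1.norm_gradL_sq {Ω : Set Plane} (u : H1 Ω) :
    ‖H1.gradL Ω u‖ ^ 2 = ‖H1.d u 0‖ ^ 2 + ‖H1.d u 1‖ ^ 2 := by
  rw [PiLp.norm_sq_eq_of_L2, Fin.sum_univ_two]
  rfl

theorem le_mul_of_sq_eq {a b c d e C : ℝ} (hb : 0 ≤ b) (he : 0 ≤ e) (hC : 0 ≤ C)
    (h1 : a ^ 2 = b ^ 2 + (c ^ 2 + d ^ 2)) (h2 : e ^ 2 = c ^ 2 + d ^ 2) (h3 : b ≤ C * c) :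
    a ≤ (C + 1) * e := by
  refine le_of_sq_le_sq ?_ (by positivity)
  have := pow_le_pow_left₀ hb h3 2
  rw [h1, ← h2]
  nlinarith [mul_nonneg (sq_nonneg C) (sq_nonneg d), mul_nonneg hC (sq_nonneg e)]

/-- A subspace on which the operator is bounded below has complete image, so that the
orthogonality relation defining a projection along it is solvable. -/
theorem exists_orthogonal_of_bounded_below {E F : Type*} [NormedAddCommGroup E] [NormedSpace ℝ E]
    [CompleteSpace E] [NormedAddCommGroup F] [InnerProductSpace ℝ F] (T : E →L[ℝ] F) {C : NNReal}
    (hT : ∀ x, ‖x‖ ≤ C * ‖T x‖) (y : F) : ∃ x, ∀ z, inner ℝ (y - T x) (T z) = 0 := by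
  have hcl : IsComplete (Set.range T) :=
    (T.antilipschitz_of_bound hT).isComplete_range T.uniformContinuous
  have : CompleteSpace (LinearMap.range (T : E →ₗ[ℝ] F)) := by
    refine IsComplete.completeSpace_coe (s := (LinearMap.range (T : E →ₗ[ℝ] F) : Set F)) ?_
    have e : (LinearMap.range (T : E →ₗ[ℝ] F) : Set F) = Set.range T := by ext; simp
    rw [e]
    exact hcl
  obtain ⟨x, hx⟩ := (LinearMap.range (T : E →ₗ[ℝ] F)).starProjection_apply_mem y
  refine ⟨x, fun z => ?_⟩
  have h := (LinearMap.range (T : E →ₗ[ℝ] F)).starProjection_inner_eq_zero y (T z) ⟨z, rfl⟩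
  rw [← hx] at h
  exact h

/-- Dirichlet's principle in abstract form, for the trace `S` and the gradient `T`: subtract from
`y` the element of the kernel of `S` whose image is the orthogonal projection of `T y`. The bound on
the kernel makes the image of the kernel complete. -/
theorem exists_orthogonal_of_isClosed {E F G : Type*} [NormedAddCommGroup E] [NormedSpace ℝ E]
    [CompleteSpace E] [NormedAddCommGroup F] [InnerProductSpace ℝ F] [NormedAddCommGroup G]
    [NormedSpace ℝ G] (S : E →L[ℝ] G) (T : E →L[ℝ] F)
    {C : NNReal} (hT : ∀ x, S x = 0 → ‖x‖ ≤ C * ‖T x‖) (y : E) :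
    ∃ x, S x = S y ∧ ∀ z, S z = 0 → inner ℝ (T x) (T z) = 0 := by
  have : CompleteSpace (LinearMap.ker (S : E →ₗ[ℝ] G)) := S.isClosed_ker.completeSpace_coe
  obtain ⟨x, hx⟩ := exists_orthogonal_of_bounded_below
    (T.comp (LinearMap.ker (S : E →ₗ[ℝ] G)).subtypeL) (C := C) (fun x => hT x.1 x.2) (T y)
  have hx0 : S x.1 = 0 := x.2
  refine ⟨y - x.1, ?_, fun z hz => ?_⟩
  · rw [map_sub, hx0, sub_zero]
  · rw [map_sub]
    exact hx ⟨z, hz⟩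

namespace PlateDomain
variable {K : ℕ} [NeZero K] (P : PlateDomain K)

theorem exists_bound_of_trace_zero : ∃ C : NNReal, ∀ u : H1 P.Ω, P.trace u = 0 →
    ‖u‖ ≤ C * ‖H1.gradL P.Ω u‖ := by
  have h := P.poincare
  obtain ⟨C, hC, hp⟩ := h
  refine ⟨⟨C + 1, by positivity⟩, fun u hu => ?_⟩
  exact le_mul_of_sq_eq (norm_nonneg _) (norm_nonneg _) hC (H1.norm_sq u) (H1.norm_gradL_sq u)
    (hp u hu)

theorem eq_zero_of_trace_zero_of_grad {u : H1 P.Ω} (hu : P.trace u = 0)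
    (h : ∑ j : Fin 2, inner ℝ (H1.d u j) (H1.d u j) = 0) : u = 0 := by
  have hC := P.exists_bound_of_trace_zero
  obtain ⟨C, hC⟩ := hC
  have h1 := hC u hu
  rw [← H1.inner_gradL, inner_self_eq_zero] at h
  rw [h, norm_zero, mul_zero] at h1
  exact norm_le_zero_iff.mp h1

/-- Weakly harmonic functions with the trace of a given function in `H¹(Ω)`. -/
theorem exists_harmonic (U : H1 P.Ω) : ∃ u : H1 P.Ω, P.trace u = P.trace U ∧
    ∀ φ : H1 P.Ω, P.trace φ = 0 → ∑ j : Fin 2, inner ℝ (H1.d u j) (H1.d φ j) = 0 := by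
  have hC := P.exists_bound_of_trace_zero
  obtain ⟨C, hC⟩ := hC
  have hex := exists_orthogonal_of_isClosed P.trace (H1.gradL P.Ω) hC U
  simpa only [H1.inner_gradL] using hex

end PlateDomain

/-! ### Lifting primitives on the boundary to the domain -/

/-- A subsequence of the `L²` convergent sequence converges almost everywhere, which identifies the
two limits. -/
theorem ae_eq_of_tendsto_Lp {α : Type*} [MeasurableSpace α] {μ : Measure α} {F : ℕ → Lp ℝ 2 μ}
    {F' : Lp ℝ 2 μ} (hF : Tendsto F atTop (𝓝 F')) {G : ℕ → α → ℝ} {G' : α → ℝ}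
    (hFG : ∀ n, F n =ᵐ[μ] G n) (hG : ∀ᵐ x ∂μ, Tendsto (fun n => G n x) atTop (𝓝 (G' x))) :
    F' =ᵐ[μ] G' := by
  obtain ⟨ns, hns, h⟩ := (tendstoInMeasure_of_tendsto_Lp hF).exists_seq_tendsto_ae
  filter_upwards [h, hG, ae_all_iff.mpr hFG] with x h1 h2 h3
  refine tendsto_nhds_unique h1 ?_
  simp only [h3]
  exact h2.comp hns.tendsto_atTop

theorem abs_setIntegral_le {α : Type*} [MeasurableSpace α] {μ : Measure α} (f : Lp ℝ 2 μ)
    {s : Set α} (hs : MeasurableSet s) (hμs : μ s ≠ ⊤) :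
    |∫ x in s, f x ∂μ| ≤ √(μ.real s) * ‖f‖ := by
  rw [← L2.inner_indicatorConstLp_one (𝕜 := ℝ) hs hμs]
  refine (abs_real_inner_le_norm _ _).trans (mul_le_mul_of_nonneg_right ?_ (norm_nonneg _))
  refine norm_indicatorConstLp_le.trans_eq ?_
  rw [norm_one, one_mul, Real.sqrt_eq_rpow]
  norm_num

theorem intervalIntegrable_Lp (f : Lp ℝ 2 (volume : Measure ℝ)) (a b : ℝ) :
    IntervalIntegrable f volume a b :=
  (((Lp.memLp f).locallyIntegrable (by norm_num)).integrableOn_isCompact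
    isCompact_uIcc).intervalIntegrable

theorem abs_intervalIntegral_le (f : Lp ℝ 2 (volume : Measure ℝ)) (t : ℝ) :
    |∫ r in (0 : ℝ)..t, f r| ≤ √|t| * ‖f‖ := by
  rw [intervalIntegral.abs_intervalIntegral_eq]
  refine (abs_setIntegral_le f measurableSet_uIoc ?_).trans_eq ?_
  · simp [uIoc]
  · simp [Measure.real, uIoc, max_sub_min_eq_abs]

theorem tendsto_intervalIntegral {F : ℕ → Lp ℝ 2 (volume : Measure ℝ)}
    {f : Lp ℝ 2 (volume : Measure ℝ)} (hF : Tendsto F atTop (𝓝 f)) (t : ℝ) :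
    Tendsto (fun n => ∫ r in (0 : ℝ)..t, F n r) atTop (𝓝 (∫ r in (0 : ℝ)..t, f r)) := by
  rw [tendsto_iff_norm_sub_tendsto_zero] at hF ⊢
  refine squeeze_zero (fun _ => norm_nonneg _) (fun n => ?_)
    (by simpa using hF.const_mul √|t|)
  rw [← intervalIntegral.integral_sub (intervalIntegrable_Lp _ _ _) (intervalIntegrable_Lp _ _ _)]
  refine le_trans (le_of_eq ?_) (abs_intervalIntegral_le (F n - f) t)
  rw [Real.norm_eq_abs]
  congr 1
  refine intervalIntegral.integral_congr_ae ?_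
  filter_upwards [Lp.coeFn_sub (F n) f] with x hx _
  rw [hx, Pi.sub_apply]

/-- The coordinate along `a` in the oblique coordinate system `p + s a + τ d`. -/
def coord (p a d x : Plane) : ℝ := cross (x - p) d / cross a d

theorem coord_oblique {a d : Plane} (h : cross a d ≠ 0) (p : Plane) (z : ℝ × ℝ) :
    coord p a d (oblique p a d z) = z.1 := by
  simp [coord, oblique, cross_add_left, cross_smul_left, cross_self, h]

theorem contDiff_coord (p a d : Plane) : ContDiff ℝ ∞ (coord p a d) := by
  unfold coord cross
  fun_prop

theorem fderiv_coord (p a d x v : Plane) : fderiv ℝ (coord p a d) x v = cross v d / cross a d := by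
  have h := hasDerivAt_line (contDiff_coord p a d) x v 0
  have e : (fun t : ℝ => coord p a d (x + t • v))
      = fun t => coord p a d x + t * (cross v d / cross a d) := by
    funext t
    simp only [coord, show x + t • v - p = (x - p) + t • v by module, cross_add_left,
      cross_smul_left]
    ring
  rw [e, zero_smul, add_zero] at h
  have h2 := ((hasDerivAt_id (0 : ℝ)).mul_const (cross v d / cross a d)).const_add (coord p a d x)
  simpa using h.unique h2

theorem exists_bound_coord {Ω : Set Plane} (hΩ : Bornology.IsBounded Ω) (p a d : Plane) :
    ∃ R, 0 ≤ R ∧ ∀ x ∈ Ω, |coord p a d x| ≤ R := by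
  obtain ⟨R, hR⟩ := hΩ.isCompact_closure.exists_bound_of_continuousOn
    (contDiff_coord p a d).continuous.continuousOn
  refine ⟨max R 0, le_max_right _ _, fun x hx => (hR x (subset_closure hx)).trans (le_max_left _ _)⟩

theorem integral_strip {g : ℝ → ℝ} {R : ℝ} (hR : 0 ≤ R) :
    ∫ z : ℝ × ℝ, g z.1 ^ 2 * (Icc (-R) R).indicator (fun _ => (1 : ℝ)) z.2
      = (2 * R) * ∫ s, g s ^ 2 := by
  have h := integral_prod_mul (μ := (volume : Measure ℝ)) (ν := (volume : Measure ℝ))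
    (fun s => g s ^ 2) (fun τ => (Icc (-R) R).indicator (fun _ => (1 : ℝ)) τ)
  refine h.trans ?_
  have e : ∫ τ : ℝ, (Icc (-R) R).indicator (fun _ => (1 : ℝ)) τ = 2 * R := by
    rw [integral_indicator measurableSet_Icc, setIntegral_const, Real.volume_real_Icc_of_le
      (by linarith), smul_eq_mul]
    ring
  rw [e, mul_comm]

theorem integrable_strip {g : ℝ → ℝ} (hg : Continuous g) (hgc : HasCompactSupport g) (R : ℝ) :
    Integrable (fun z : ℝ × ℝ => g z.1 ^ 2 * (Icc (-R) R).indicator (fun _ => (1 : ℝ)) z.2)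
      volume := by
  have hgi : Integrable (fun s => g s ^ 2) volume :=
    ((hg.mul hg).integrable_of_hasCompactSupport hgc.mul_left).congr
      (ae_of_all _ fun s => (sq (g s)).symm)
  have hi : Integrable (fun τ : ℝ => (Icc (-R) R).indicator (fun _ => (1 : ℝ)) τ) volume :=
    (integrable_indicator_iff measurableSet_Icc).mpr (by simp)
  exact hgi.mul_prod hi

/-- The integrand depends on one oblique coordinate only, and the other is bounded by some `R` on
the bounded set `Ω`; Fubini on the strip gives the factor `2 R`. -/
theorem exists_bound_integral_comp_coord {Ω : Set Plane} (hΩ : Bornology.IsBounded Ω)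
    (hm : MeasurableSet Ω) {a d : Plane} (h : cross a d ≠ 0) (p : Plane) :
    ∃ C, 0 ≤ C ∧ ∀ g : ℝ → ℝ, Continuous g → HasCompactSupport g →
      ∫ x in Ω, g (coord p a d x) ^ 2 ≤ C * ∫ s, g s ^ 2 := by
  -- With `a` and `d` interchanged this bounds the coordinate along `d`, the one to be integrated
  -- out.
  obtain ⟨R, hR, hb⟩ := exists_bound_coord hΩ p d a
  refine ⟨|cross a d| * (2 * R), by positivity, fun g hg hgc => ?_⟩
  have hmeas : AEStronglyMeasurable (Ω.indicator fun x => g (coord p a d x) ^ 2) volume :=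
    (((hg.comp (contDiff_coord p a d).continuous).pow 2).measurable.indicator hm).aestronglyMeasurable
  rw [← integral_indicator hm, integral_oblique h p hmeas, mul_assoc]
  refine mul_le_mul_of_nonneg_left ?_ (abs_nonneg _)
  refine le_trans ?_ (integral_strip hR).le
  refine integral_mono_of_nonneg (ae_of_all _ fun z => ?_) (integrable_strip hg hgc R)
    (ae_of_all _ fun z => ?_)
  · exact indicator_nonneg (f := fun x => g (coord p a d x) ^ 2) (fun x _ => sq_nonneg _) _
  · by_cases hz : oblique p a d z ∈ Ω
    · have h2 := hb _ hz
      have h' : cross d a ≠ 0 := by rw [cross_swap]; exact neg_ne_zero.mpr h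
      have e3 : oblique p a d z = oblique p d a z.swap := by
        simp [oblique, add_comm]
      rw [e3, coord_oblique h', Prod.fst_swap, abs_le] at h2
      refine le_of_eq ((indicator_of_mem hz _).trans ?_)
      rw [coord_oblique h]
      refine (mul_one _).symm.trans (congrArg _ ?_)
      exact (indicator_of_mem (show z.2 ∈ Icc (-R) R from h2) (fun _ => (1 : ℝ))).symm
    · refine (indicator_of_notMem hz (fun x => g (coord p a d x) ^ 2)).trans_le ?_
      exact mul_nonneg (sq_nonneg _) (indicator_nonneg (f := fun _ => (1 : ℝ)) (fun _ _ => zero_le_one) _)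

theorem hasDerivAt_integral_zero {g : ℝ → ℝ} (hg : Continuous g) (t : ℝ) :
    HasDerivAt (fun t => ∫ r in (0 : ℝ)..t, g r) (g t) t :=
  (hg.integral_hasStrictDerivAt 0 t).hasDerivAt

theorem contDiff_integral_zero {g : ℝ → ℝ} (hg : ContDiff ℝ ∞ g) :
    ContDiff ℝ ∞ (fun t => ∫ r in (0 : ℝ)..t, g r) := by
  rw [contDiff_infty_iff_deriv]
  refine ⟨fun t => (hasDerivAt_integral_zero hg.continuous t).differentiableAt, ?_⟩
  rwa [funext fun t => (hasDerivAt_integral_zero hg.continuous t).deriv]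

/-- The localized primitive of `g` along `a`, constant in the direction `d`. -/
def ramp (χ : Plane → ℝ) (p a d : Plane) (g : ℝ → ℝ) (x : Plane) : ℝ :=
  χ x * ∫ r in (0 : ℝ)..coord p a d x, g r

theorem contDiff_primitive_coord (p a d : Plane) {g : ℝ → ℝ} (hg : ContDiff ℝ ∞ g) :
    ContDiff ℝ ∞ fun x => ∫ r in (0 : ℝ)..coord p a d x, g r :=
  (contDiff_integral_zero hg).comp (contDiff_coord p a d)

theorem ramp_mem {χ : Plane → ℝ} (hχ : χ ∈ Smooth) (p a d : Plane) {g : ℝ → ℝ}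
    (hg : ContDiff ℝ ∞ g) : ramp χ p a d g ∈ Smooth :=
  ⟨hχ.1.mul (contDiff_primitive_coord p a d hg), hχ.2.mul_right⟩

theorem pderiv_ramp {χ : Plane → ℝ} (hχ : χ ∈ Smooth) (p a d : Plane) {g : ℝ → ℝ}
    (hg : ContDiff ℝ ∞ g) (i : Fin 2) (x : Plane) :
    pderiv i (ramp χ p a d g) x
      = χ x * (cross (EuclideanSpace.single i 1) d / cross a d) * g (coord p a d x)
        + pderiv i χ x * ∫ r in (0 : ℝ)..coord p a d x, g r := by
  have h1 := pderiv_mul (Smooth.differentiableAt hχ x)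
    (((contDiff_primitive_coord p a d hg).differentiable (by simp)).differentiableAt (x := x)) i
  refine h1.trans ?_
  congr 1
  have h2 := (hasDerivAt_integral_zero hg.continuous (coord p a d x)).comp_hasFDerivAt x
    (((contDiff_coord p a d).differentiable (by simp)).differentiableAt (x := x)).hasFDerivAt
  have h3 : pderiv i (fun x => ∫ r in (0 : ℝ)..coord p a d x, g r) x
      = g (coord p a d x) * (cross (EuclideanSpace.single i 1) d / cross a d) := by
    rw [← fderiv_coord p a d x, pderiv]
    have := h2.fderiv
    simp only [Function.comp_def] at this
    rw [this]
    simp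
  rw [h3]
  ring

theorem sq_add_le {a b A B c : ℝ} (h1 : |a| ≤ A) (h2 : |b| ≤ B) :
    (a * c + b) ^ 2 ≤ 2 * A ^ 2 * c ^ 2 + 2 * B ^ 2 := by
  have e1 : a ^ 2 ≤ A ^ 2 := sq_le_sq' (by linarith [neg_abs_le a]) ((le_abs_self a).trans h1)
  have e2 : b ^ 2 ≤ B ^ 2 := by
    have := abs_nonneg b
    exact sq_le_sq' (by linarith [neg_abs_le b]) ((le_abs_self b).trans h2)
  nlinarith [mul_le_mul_of_nonneg_right e1 (sq_nonneg c), sq_nonneg (a * c - b)]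

theorem norm_toLp_le_of_sq {α : Type*} [MeasurableSpace α] {μ : Measure α} [IsFiniteMeasure μ]
    {f g : α → ℝ} (hf : MemLp f 2 μ) (hg : Integrable (fun x => g x ^ 2) μ) {A B C N : ℝ}
    (hA : 0 ≤ A) (hB : 0 ≤ B) (hC : 0 ≤ C) (hN : 0 ≤ N)
    (h : ∀ᵐ x ∂μ, f x ^ 2 ≤ A * g x ^ 2 + B * N ^ 2) (hgN : ∫ x, g x ^ 2 ∂μ ≤ C * N ^ 2) :
    ‖hf.toLp f‖ ≤ √(A * C + B * μ.real univ) * N := by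
  refine le_of_sq_le_sq ?_ (by positivity)
  rw [norm_toLp_sq, mul_pow, Real.sq_sqrt (by positivity)]
  calc ∫ x, f x ^ 2 ∂μ ≤ ∫ x, A * g x ^ 2 + B * N ^ 2 ∂μ :=
        integral_mono_ae hf.integrable_sq ((hg.const_mul A).add (integrable_const _)) h
    _ = A * ∫ x, g x ^ 2 ∂μ + B * N ^ 2 * μ.real univ := by
        rw [integral_add (hg.const_mul A) (integrable_const _), integral_const_mul, integral_const,
          smul_eq_mul, mul_comm (μ.real univ)]
    _ ≤ (A * C + B * μ.real univ) * N ^ 2 := by nlinarith [mul_le_mul_of_nonneg_left hgN hA]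

theorem abs_integral_zero_le {g : ℝ → ℝ} (hg : MemLp g 2 (volume : Measure ℝ)) {t R : ℝ}
    (ht : |t| ≤ R) : |∫ r in (0 : ℝ)..t, g r| ≤ √R * ‖hg.toLp g‖ := by
  have e : ∫ r in (0 : ℝ)..t, g r = ∫ r in (0 : ℝ)..t, hg.toLp g r := by
    refine intervalIntegral.integral_congr_ae ?_
    filter_upwards [hg.coeFn_toLp] with x hx _
    exact hx.symm
  rw [e]
  exact (abs_intervalIntegral_le _ t).trans
    (mul_le_mul_of_nonneg_right (Real.sqrt_le_sqrt ht) (norm_nonneg _))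

/-- The ramp and its partial derivatives share the form `α g + β ∫ g` in the coordinate along `a`,
so one estimate covers them all: Fubini for the first term, Cauchy–Schwarz for the primitive. -/
theorem exists_bound_ramp_aux {Ω : Set Plane} (hΩ : Bornology.IsBounded Ω) (hm : MeasurableSet Ω)
    {a d : Plane} (h : cross a d ≠ 0) (p : Plane) {A B : ℝ} (hB : 0 ≤ B) :
    ∃ C, 0 ≤ C ∧ ∀ (g : ℝ → ℝ) (hg : ContDiff ℝ ∞ g) (hgc : HasCompactSupport g)
      (α β f : Plane → ℝ) (hf : MemLp f 2 (volume.restrict Ω)),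
      (∀ x, |α x| ≤ A) → (∀ x, |β x| ≤ B) →
      (∀ x, f x = α x * g (coord p a d x) + β x * ∫ r in (0 : ℝ)..coord p a d x, g r) →
      ‖hf.toLp f‖
        ≤ C * ‖(hg.continuous.memLp_of_hasCompactSupport hgc (p := 2) (μ := volume)).toLp g‖ := by
  obtain ⟨C, hC, hCb⟩ := exists_bound_integral_comp_coord hΩ hm h p
  obtain ⟨R, hR, hRb⟩ := exists_bound_coord hΩ p a d
  have hfin : IsFiniteMeasure (volume.restrict Ω) :=
    ⟨by rw [Measure.restrict_apply_univ]; exact hΩ.measure_lt_top⟩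
  refine ⟨√(2 * A ^ 2 * C + 2 * B ^ 2 * R * (volume.restrict Ω).real univ), Real.sqrt_nonneg _,
    fun g hg hgc α β f hf hα hβ hfe => ?_⟩
  have hgm := hg.continuous.memLp_of_hasCompactSupport hgc (p := 2) (μ := volume)
  obtain ⟨D, hD⟩ := hgc.exists_bound_of_continuous hg.continuous
  have hgl : MemLp (fun x => g (coord p a d x)) 2 (volume.restrict Ω) :=
    MemLp.of_bound (hg.continuous.comp (contDiff_coord p a d).continuous).aestronglyMeasurable D
      (ae_of_all _ fun x => hD _)
  refine norm_toLp_le_of_sq hf hgl.integrable_sq (by positivity) (by positivity) hC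
    (norm_nonneg _) ?_ ?_
  · filter_upwards [ae_restrict_mem hm] with x hx
    have h1 := abs_integral_zero_le hgm (hRb x hx)
    have h2 : |β x * ∫ r in (0 : ℝ)..coord p a d x, g r| ≤ B * (√R * ‖hgm.toLp g‖) := by
      rw [abs_mul]
      exact mul_le_mul (hβ x) h1 (abs_nonneg _) hB
    rw [hfe x]
    refine (sq_add_le (hα x) h2).trans_eq ?_
    rw [mul_pow, mul_pow, Real.sq_sqrt hR]
    ring
  · rw [norm_toLp_sq]
    exact hCb g hg.continuous hgc

theorem mul_le_mul_sum {C n : ℝ} {D : Fin 2 → ℝ} (hC : 0 ≤ C) (hD : ∀ i, 0 ≤ D i) (hn : 0 ≤ n) :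
    0 ≤ C * n + D 0 * n + D 1 * n ∧ C * n ≤ C * n + D 0 * n + D 1 * n ∧
      ∀ i, D i * n ≤ C * n + D 0 * n + D 1 * n := by
  have k0 := mul_nonneg hC hn
  have k1 := mul_nonneg (hD 0) hn
  have k2 := mul_nonneg (hD 1) hn
  refine ⟨by positivity, by linarith, ?_⟩
  rw [Fin.forall_fin_two]
  constructor <;> linarith

/-- No derivative of `g` enters the bound; this is what allows passing from smooth to square
integrable slopes. -/
theorem exists_bound_ramp {Ω : Set Plane} (hΩ : Bornology.IsBounded Ω) (hm : MeasurableSet Ω)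
    {χ : Plane → ℝ} (hχ : χ ∈ Smooth) {a d : Plane} (h : cross a d ≠ 0) (p : Plane) :
    ∃ C, 0 ≤ C ∧ ∀ (g : ℝ → ℝ) (hg : ContDiff ℝ ∞ g) (hgc : HasCompactSupport g),
      ‖smoothToH1 Ω ⟨ramp χ p a d g, ramp_mem hχ p a d hg⟩‖
        ≤ C * ‖(hg.continuous.memLp_of_hasCompactSupport hgc (p := 2) (μ := volume)).toLp g‖ := by
  obtain ⟨M, hM, hMb⟩ := Smooth.exists_bound hχ
  have hN : ∀ i : Fin 2, ∃ N, 0 ≤ N ∧ ∀ x, |pderiv i χ x| ≤ N :=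
    fun i => Smooth.exists_bound_fderiv hχ _
  choose N hN0 hNb using hN
  -- The ramp itself has no term in `g`, whence `A = 0`.
  obtain ⟨C, hC, hCb⟩ := exists_bound_ramp_aux hΩ hm h p (A := 0) hM
  have hD := fun i : Fin 2 => exists_bound_ramp_aux hΩ hm h p
    (A := M * |cross (EuclideanSpace.single i 1) d / cross a d|) (hN0 i)
  choose D hD0 hDb using hD
  refine ⟨2 * (C + D 0 + D 1), mul_nonneg zero_le_two (add_nonneg (add_nonneg hC (hD0 0)) (hD0 1)), fun g hg hgc => ?_⟩
  have hs := ramp_mem hχ p a d hg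
  have h1 := hCb g hg hgc (fun _ => 0) χ _ (Smooth.memLp hs Ω) (fun x => by simp) hMb
    (fun x => by rw [ramp, zero_mul, zero_add])
  have h2 := fun i => hDb i g hg hgc
    (fun x => χ x * (cross (EuclideanSpace.single i 1) d / cross a d)) (pderiv i χ) _
    (Smooth.memLp_pderiv hs Ω i)
    (fun x => by rw [abs_mul]; exact mul_le_mul_of_nonneg_right (hMb x) (abs_nonneg _)) (hNb i)
    (pderiv_ramp hχ p a d hg i)
  set n := ‖(hg.continuous.memLp_of_hasCompactSupport hgc (p := 2) (μ := volume)).toLp g‖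
  have k := mul_le_mul_sum hC hD0 (norm_nonneg _ : 0 ≤ n)
  have e : 2 * (C + D 0 + D 1) * n = 2 * (C * n + D 0 * n + D 1 * n) := by ring
  exact le_of_le_of_eq (H1.norm_le_of_le _ k.1 (h1.trans k.2.1) fun i => (h2 i).trans (k.2.2 i)) e.symm

theorem exists_seq_smooth_tendsto (f : Lp ℝ 2 (volume : Measure ℝ)) :
    ∃ (g : ℕ → ℝ → ℝ) (hg : ∀ n, ContDiff ℝ ∞ (g n)) (hgc : ∀ n, HasCompactSupport (g n)),
      Tendsto (fun n => ((hg n).continuous.memLp_of_hasCompactSupport (hgc n)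
        (p := 2) (μ := volume)).toLp (g n)) atTop (𝓝 f) := by
  have hd := Lp.dense_hasCompactSupport_contDiff (F := ℝ) (μ := (volume : Measure ℝ)) (p := 2)
    (by norm_num)
  obtain ⟨F, hF, hFt⟩ := mem_closure_iff_seq_limit.mp (hd f)
  choose g hgF hgc hg using hF
  refine ⟨g, hg, hgc, hFt.congr fun n => Lp.ext ?_⟩
  exact (hgF n).trans (MemLp.coeFn_toLp _).symm

theorem ramp_sub (χ : Plane → ℝ) (p a d : Plane) {g g' : ℝ → ℝ} (hg : Continuous g)
    (hg' : Continuous g') : ramp χ p a d (g - g') = ramp χ p a d g - ramp χ p a d g' := by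
  funext x
  simp only [ramp, Pi.sub_apply]
  rw [intervalIntegral.integral_sub (hg.intervalIntegrable _ _) (hg'.intervalIntegrable _ _)]
  ring

theorem smoothToH1_ramp_sub (Ω : Set Plane) {χ : Plane → ℝ} (hχ : χ ∈ Smooth) (p a d : Plane)
    {g g' : ℝ → ℝ} (hg : ContDiff ℝ ∞ g) (hg' : ContDiff ℝ ∞ g') :
    smoothToH1 Ω ⟨ramp χ p a d (g - g'), ramp_mem hχ p a d (hg.sub hg')⟩
      = smoothToH1 Ω ⟨ramp χ p a d g, ramp_mem hχ p a d hg⟩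
        - smoothToH1 Ω ⟨ramp χ p a d g', ramp_mem hχ p a d hg'⟩ := by
  refine Eq.trans (congrArg (smoothToH1 Ω) ?_) (map_sub (smoothToH1 Ω) _ _)
  exact Subtype.ext (ramp_sub χ p a d hg.continuous hg'.continuous)

theorem norm_ramp_sub_le {Ω : Set Plane} {χ : Plane → ℝ} (hχ : χ ∈ Smooth) (p a d : Plane) {C : ℝ}
    (hC : ∀ (g : ℝ → ℝ) (hg : ContDiff ℝ ∞ g) (hgc : HasCompactSupport g),
      ‖smoothToH1 Ω ⟨ramp χ p a d g, ramp_mem hχ p a d hg⟩‖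
        ≤ C * ‖(hg.continuous.memLp_of_hasCompactSupport hgc (p := 2) (μ := volume)).toLp g‖)
    {g g' : ℝ → ℝ} (hg : ContDiff ℝ ∞ g) (hgc : HasCompactSupport g) (hg' : ContDiff ℝ ∞ g')
    (hgc' : HasCompactSupport g') :
    dist (smoothToH1 Ω ⟨ramp χ p a d g, ramp_mem hχ p a d hg⟩)
      (smoothToH1 Ω ⟨ramp χ p a d g', ramp_mem hχ p a d hg'⟩)
      ≤ C * dist ((hg.continuous.memLp_of_hasCompactSupport hgc (p := 2) (μ := volume)).toLp g)
        ((hg'.continuous.memLp_of_hasCompactSupport hgc' (p := 2) (μ := volume)).toLp g') := by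
  have e := MemLp.toLp_sub (hg.continuous.memLp_of_hasCompactSupport hgc (p := 2) (μ := volume))
    (hg'.continuous.memLp_of_hasCompactSupport hgc' (p := 2) (μ := volume))
  calc _ = _ := (dist_eq_norm _ _).trans
        (congrArg norm (smoothToH1_ramp_sub Ω hχ p a d hg hg')).symm
    _ ≤ _ := hC (g - g') (hg.sub hg') (hgc.sub hgc')
    _ = _ := congrArg (C * ·) ((congrArg norm e).trans (dist_eq_norm _ _).symm)

theorem cauchySeq_of_dist_le {X Y : Type*} [PseudoMetricSpace X] [PseudoMetricSpace Y] {x : ℕ → X}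
    {y : ℕ → Y} {C : ℝ} (hC : 0 ≤ C) (h : ∀ m n, dist (x m) (x n) ≤ C * dist (y m) (y n))
    (hy : CauchySeq y) : CauchySeq x := by
  rw [Metric.cauchySeq_iff]
  intro ε hε
  obtain ⟨N, hN⟩ := Metric.cauchySeq_iff.mp hy (ε / (C + 1)) (by positivity)
  refine ⟨N, fun m hm n hn => (h m n).trans_lt ?_⟩
  have := hN m hm n hn
  rw [lt_div_iff₀ (by positivity)] at this
  refine lt_of_le_of_lt ?_ this
  rw [mul_comm]
  exact mul_le_mul_of_nonneg_left (by linarith) dist_nonneg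

namespace PlateDomain
variable {K : ℕ} [NeZero K] (P : PlateDomain K)

/-- Ramps of smooth approximations of `f` form a Cauchy sequence in `H¹(Ω)`. Their traces converge
in `L²`, and pointwise as well because primitives depend continuously on the `L²` slope. -/
theorem exists_lift_ramp {χ : Plane → ℝ} (hχ : χ ∈ Smooth) {a d : Plane} (h : cross a d ≠ 0)
    (p : Plane) (f : Lp ℝ 2 (volume : Measure ℝ)) :
    ∃ U : H1 P.Ω, ∀ i, ∀ᵐ s ∂(volume.restrict (Ioo 0 (P.len i))),
      P.trace U i s = ramp χ p a d f (P.edgePt i s) := by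
  obtain ⟨g, hg, hgc, hgt⟩ := exists_seq_smooth_tendsto f
  have hbd := exists_bound_ramp P.isBounded P.isOpen.measurableSet hχ h p
  obtain ⟨C, hC0, hC⟩ := hbd
  let φ : ℕ → Smooth := fun n => ⟨ramp χ p a d (g n), ramp_mem hχ p a d (hg n)⟩
  have hcau : CauchySeq fun n => smoothToH1 P.Ω (φ n) :=
    cauchySeq_of_dist_le hC0 (fun m n => norm_ramp_sub_le hχ p a d hC (hg m) (hgc m) (hg n) (hgc n))
      hgt.cauchySeq
  obtain ⟨U, hU⟩ := cauchySeq_tendsto_of_complete hcau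
  refine ⟨U, fun i => ?_⟩
  refine ae_eq_of_tendsto_Lp (((P.continuous_trace_apply i).tendsto U).comp hU)
    (G := fun n s => (φ n).1 (P.edgePt i s)) (fun n => ?_) (ae_of_all _ fun s => ?_)
  · rw [Function.comp_apply, P.trace_smoothToH1]
    exact (P.memLp_edge (φ n).2 i).coeFn_toLp
  · refine (tendsto_intervalIntegral hgt (coord p a d (P.edgePt i s))).const_mul _ |>.congr
      fun n => ?_
    simp only [φ, ramp]
    congr 1
    refine intervalIntegral.integral_congr_ae ?_
    filter_upwards [MemLp.coeFn_toLp ((hg n).continuous.memLp_of_hasCompactSupport (hgc n)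
        (p := 2) (μ := volume))] with x hx _
    exact hx

end PlateDomain
namespace PlateDomain
variable {K : ℕ} [NeZero K] (P : PlateDomain K)

/-- `F` is the extension by zero, so its primitive is constant beyond either end of the edge. -/
theorem exists_extension (i : ZMod K) (f : P.L2Edge i) : ∃ F : Lp ℝ 2 (volume : Measure ℝ),
    (∀ t ≤ 0, ∫ r in (0 : ℝ)..t, F r = 0) ∧ (∀ t, P.len i ≤ t → ∫ r in (P.len i)..t, F r = 0) ∧
    ∀ s ∈ Icc 0 (P.len i), ∫ r in (0 : ℝ)..s, F r = ∫ r in (0 : ℝ)..s, f r := by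
  have hm : MemLp ((Ioo 0 (P.len i)).indicator f) 2 volume :=
    (memLp_indicator_iff_restrict measurableSet_Ioo).mpr (Lp.memLp f)
  have e : ∀ a b, ∫ r in a..b, hm.toLp _ r = ∫ r in a..b, (Ioo 0 (P.len i)).indicator f r := by
    intro a b
    refine intervalIntegral.integral_congr_ae ?_
    filter_upwards [hm.coeFn_toLp] with x hx _
    exact hx
  refine ⟨hm.toLp _, fun t ht => ?_, fun t ht => ?_, fun s hs => ?_⟩
  · rw [e]
    refine (intervalIntegral.integral_congr_ae (g := fun _ => 0) (ae_of_all _ fun x hx => ?_)).trans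
      intervalIntegral.integral_zero
    rw [uIoc_of_ge ht] at hx
    exact indicator_of_notMem (fun h => hx.2.not_gt h.1) _
  · rw [e]
    refine (intervalIntegral.integral_congr_ae (g := fun _ => 0) (ae_of_all _ fun x hx => ?_)).trans
      intervalIntegral.integral_zero
    rw [uIoc_of_le ht] at hx
    exact indicator_of_notMem (fun h => hx.1.not_gt h.2) _
  · rw [e, intervalIntegral.integral_of_le hs.1, intervalIntegral.integral_of_le hs.1,
      integral_Ioc_eq_integral_Ioo, integral_Ioc_eq_integral_Ioo]
    refine setIntegral_congr_fun measurableSet_Ioo fun x hx => ?_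
    exact indicator_of_mem (show x ∈ Ioo 0 (P.len i) from ⟨hx.1, hx.2.trans_le hs.2⟩) f

/-- The slope read backwards from the end of the edge, `-f (len - r)` extended by zero; it serves
the edge that arrives at a vertex. -/
theorem exists_reflection (i : ZMod K) (f : P.L2Edge i) : ∃ F : Lp ℝ 2 (volume : Measure ℝ),
    (∀ t ≤ 0, ∫ r in (0 : ℝ)..t, F r = 0) ∧
    ∀ s ∈ Icc 0 (P.len i), ∫ r in (0 : ℝ)..(P.len i - s), F r
      = (∫ r in (0 : ℝ)..s, f r) - ∫ r in (0 : ℝ)..P.len i, f r := by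
  obtain ⟨F, -, h2, h3⟩ := P.exists_extension i f
  have hm : MemLp (fun r => -F (P.len i - r)) 2 volume :=
    ((Lp.memLp F).comp_measurePreserving (Measure.measurePreserving_sub_left volume (P.len i))).neg
  have e : ∀ t, ∫ r in (0 : ℝ)..t, hm.toLp _ r = -∫ r in (P.len i - t)..(P.len i), F r := by
    intro t
    have e1 : ∫ r in (0 : ℝ)..t, hm.toLp _ r = ∫ r in (0 : ℝ)..t, -F (P.len i - r) := by
      refine intervalIntegral.integral_congr_ae ?_
      filter_upwards [hm.coeFn_toLp] with x hx _
      exact hx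
    rw [e1, intervalIntegral.integral_neg, intervalIntegral.integral_comp_sub_left (fun r => F r),
      sub_zero]
  refine ⟨hm.toLp _, fun t ht => ?_, fun s hs => ?_⟩
  · rw [e, intervalIntegral.integral_symm, h2 _ (by linarith)]
    simp
  · rw [e, sub_sub_cancel, ← h3 s hs, ← h3 (P.len i) (P.len_mem i),
      ← intervalIntegral.integral_add_adjacent_intervals (intervalIntegrable_Lp F 0 s)
        (intervalIntegrable_Lp F s (P.len i))]
    ring

theorem coord_edgePt (i : ZMod K) {d : Plane} (h : cross (P.tangent i) d ≠ 0) (s : ℝ) :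
    coord (P.vtx i) (P.tangent i) d (P.edgePt i s) = s := by
  have := coord_oblique h (P.vtx i) (s, 0)
  simpa [oblique, edgePt] using this

theorem coord_vtx_add (p a d : Plane) (v : Plane) : coord p a d (p + v) = cross v d / cross a d := by
  rw [coord, add_sub_cancel_left]

/-- `U` has the trace `B`, in the arc length parameters of the edges. -/
def HasTrace (U : H1 P.Ω) (B : ZMod K → ℝ → ℝ) : Prop :=
  ∀ i, ∀ᵐ s ∂(volume.restrict (Ioo 0 (P.len i))), P.trace U i s = B i s

theorem HasTrace.add {U U' : H1 P.Ω} {B B' : ZMod K → ℝ → ℝ} (h : P.HasTrace U B)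
    (h' : P.HasTrace U' B') : P.HasTrace (U + U') (fun i s => B i s + B' i s) := by
  intro i
  filter_upwards [P.trace_add_ae U U' i, h i, h' i] with s h1 h2 h3
  rw [h1, h2, h3]

theorem HasTrace.smul (c : ℝ) {U : H1 P.Ω} {B : ZMod K → ℝ → ℝ} (h : P.HasTrace U B) :
    P.HasTrace (c • U) (fun i s => c * B i s) := by
  intro i
  filter_upwards [P.trace_smul_ae c U i, h i] with s h1 h2
  rw [h1, h2]

theorem HasTrace.zero : P.HasTrace 0 (fun _ _ => 0) := by
  intro i
  rw [P.trace_zero]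
  exact Lp.coeFn_zero ℝ 2 _

theorem HasTrace.sum {ι : Type*} (t : Finset ι) {U : ι → H1 P.Ω} {B : ι → ZMod K → ℝ → ℝ}
    (h : ∀ p ∈ t, P.HasTrace (U p) (B p)) :
    P.HasTrace (∑ p ∈ t, U p) (fun i s => ∑ p ∈ t, B p i s) := by
  classical
  induction t using Finset.induction_on with
  | empty => simpa using HasTrace.zero P
  | insert p t hp ih =>
    have h1 := HasTrace.add P (h p (Finset.mem_insert_self p t))
      (ih fun q hq => h q (Finset.mem_insert_of_mem hq))
    simpa only [Finset.sum_insert hp] using h1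

theorem HasTrace.congr {U : H1 P.Ω} {B B' : ZMod K → ℝ → ℝ} (h : P.HasTrace U B)
    (hB : ∀ i, ∀ s ∈ Ioo 0 (P.len i), B i s = B' i s) : P.HasTrace U B' := by
  intro i
  filter_upwards [h i, ae_restrict_mem measurableSet_Ioo] with s h1 h2
  rw [h1, hB i s h2]

theorem hasTrace_smooth (φ : Smooth) :
    P.HasTrace (smoothToH1 P.Ω φ) (fun i s => φ.1 (P.edgePt i s)) := by
  intro i
  rw [P.trace_smoothToH1]
  exact (P.memLp_edge φ.2 i).coeFn_toLp

/-- The function `c_i + ∫_0^s f_i` on the edges. -/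
def primitive (c : ZMod K → ℝ) (f : ∀ i, P.L2Edge i) (i : ZMod K) (s : ℝ) : ℝ :=
  c i + ∫ r in (0 : ℝ)..s, f i r

/-- Near `p`, the boundary function `B` lifts to the domain. -/
def LiftsNear (B : ZMod K → ℝ → ℝ) (p : Plane) (r : ℝ) : Prop :=
  ∀ χ ∈ Smooth, tsupport χ ⊆ Metric.ball p r →
    ∃ U : H1 P.Ω, P.HasTrace U fun i s => χ (P.edgePt i s) * B i s

theorem liftsNear_of_ball_subset {p : Plane} {r : ℝ} (h : Metric.ball p r ⊆ P.Ω)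
    (B : ZMod K → ℝ → ℝ) : P.LiftsNear B p r := by
  intro χ _ hs
  refine ⟨0, HasTrace.congr P (HasTrace.zero P) fun i s hi => ?_⟩
  have h0 : χ (P.edgePt i s) = 0 := image_eq_zero_of_notMem_tsupport fun hm =>
    P.frontier_not_mem (P.edgePt_mem_frontier i (Ioo_subset_Icc_self hi)) (h (hs hm))
  rw [h0, zero_mul]

/-- A single ramp along the edge, constant in the normal direction, plus the constant `c i`. -/
theorem liftsNear_edge {p : Plane} {r : ℝ} {i : ZMod K} (h : P.Chart p r i i) (c : ZMod K → ℝ)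
    (f : ∀ i, P.L2Edge i) : P.LiftsNear (P.primitive c f) p r := by
  intro χ hχ hs
  have hd : cross (P.tangent i) (P.normal i) ≠ 0 := by rw [cross_tangent_normal]; norm_num
  obtain ⟨F, -, -, hF⟩ := P.exists_extension i (f i)
  have hl := P.exists_lift_ramp hχ hd (P.vtx i) F
  obtain ⟨U, hU⟩ := hl
  refine ⟨c i • smoothToH1 P.Ω ⟨χ, hχ⟩ + U, HasTrace.congr P
    (HasTrace.add P (HasTrace.smul P (c i) (P.hasTrace_smooth ⟨χ, hχ⟩)) hU) fun k s hk => ?_⟩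
  by_cases hm : P.edgePt k s ∈ Metric.ball p r
  · obtain rfl : k = i := (or_self_iff).mp (h.edges k s (Ioo_subset_Icc_self hk) hm)
    simp only [ramp, primitive]
    rw [P.coord_edgePt k hd, hF s (Ioo_subset_Icc_self hk)]
    ring
  · have h0 : χ (P.edgePt k s) = 0 := image_eq_zero_of_notMem_tsupport fun h' => hm (hs h')
    simp only [ramp, h0]
    ring

/-- The common vertex value plus two ramps, one along the outgoing edge and one along the reversed
incoming edge, both constant in an inner direction `d`. Each edge has nonpositive coordinate for the
ramp of the other, where the slope is zero, so the ramps do not interfere. Continuity at the vertex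
enters through `hc`. -/
theorem liftsNear_vertex {r : ℝ} {i : ZMod K} (h : P.Chart (P.vtx (i + 1)) r (i + 1) i)
    {c : ZMod K → ℝ} {f : ∀ i, P.L2Edge i}
    (hc : c i + ∫ r in (0 : ℝ)..P.len i, f i r = c (i + 1)) :
    P.LiftsNear (P.primitive c f) (P.vtx (i + 1)) r := by
  intro χ hχ hs
  obtain ⟨d, hd1, hd2⟩ := h.exists_inner
  -- The two rays lie on opposite sides of the line of `d`; this sign makes the coordinates on the
  -- opposite edge negative.
  have hd2' : cross (-P.tangent i) d < 0 := by rw [cross_swap]; exact neg_neg_of_pos hd2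
  obtain ⟨F, hF0, -, hF⟩ := P.exists_extension (i + 1) (f (i + 1))
  obtain ⟨G, hG0, hG⟩ := P.exists_reflection i (f i)
  have hl := P.exists_lift_ramp hχ hd1.ne' (P.vtx (i + 1)) F
  obtain ⟨U, hU⟩ := hl
  have hl := P.exists_lift_ramp hχ hd2'.ne (P.vtx (i + 1)) G
  obtain ⟨W, hW⟩ := hl
  refine ⟨c (i + 1) • smoothToH1 P.Ω ⟨χ, hχ⟩ + (U + W), HasTrace.congr P
    (HasTrace.add P (HasTrace.smul P (c (i + 1)) (P.hasTrace_smooth ⟨χ, hχ⟩))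
      (HasTrace.add P hU hW)) fun k s hk => ?_⟩
  by_cases hm : P.edgePt k s ∈ Metric.ball (P.vtx (i + 1)) r
  · rcases h.edges k s (Ioo_subset_Icc_self hk) hm with rfl | rfl
    · simp only [ramp, primitive]
      rw [P.coord_edgePt (i + 1) hd1.ne', hF s (Ioo_subset_Icc_self hk), edgePt, coord_vtx_add,
        cross_smul_left, hG0]
      · ring
      · exact (div_neg_of_pos_of_neg (mul_pos hk.1 hd1) hd2').le
    · have e : P.edgePt k s = P.vtx (k + 1) + (P.len k - s) • -P.tangent k := by
        rw [← edgePt_len]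
        simp only [edgePt]
        module
      have hk' : 0 < P.len k - s := by linarith [hk.2]
      have e1 : coord (P.vtx (k + 1)) (-P.tangent k) d (P.edgePt k s) = P.len k - s := by
        rw [e, coord_vtx_add, cross_smul_left, mul_div_cancel_right₀ _ hd2'.ne]
      have e2 : coord (P.vtx (k + 1)) (P.tangent (k + 1)) d (P.edgePt k s) ≤ 0 := by
        rw [e, coord_vtx_add, cross_smul_left]
        exact (div_neg_of_neg_of_pos (mul_neg_of_pos_of_neg hk' hd2') hd1).le
      simp only [ramp, primitive]
      rw [e1, hF0 _ e2, hG s (Ioo_subset_Icc_self hk), ← hc]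
      ring
  · have h0 : χ (P.edgePt k s) = 0 := image_eq_zero_of_notMem_tsupport fun h' => hm (hs h')
    simp only [ramp, h0]
    ring

theorem exists_liftsNear {c : ZMod K → ℝ} {f : ∀ i, P.L2Edge i}
    (hc : ∀ i, c i + ∫ r in (0 : ℝ)..P.len i, f i r = c (i + 1)) {p : Plane}
    (hp : p ∈ closure P.Ω) : ∃ r, 0 < r ∧ P.LiftsNear (P.primitive c f) p r := by
  by_cases hpΩ : p ∈ P.Ω
  · obtain ⟨r, hr, hb⟩ := Metric.isOpen_iff.mp P.isOpen p hpΩ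
    exact ⟨r, hr, P.liftsNear_of_ball_subset hb _⟩
  · have hf : p ∈ frontier P.Ω := by
      rw [P.isOpen.frontier_eq]
      exact ⟨hp, hpΩ⟩
    have hv : ∀ i, ∃ r, 0 < r ∧ P.LiftsNear (P.primitive c f) (P.vtx (i + 1)) r := by
      intro i
      obtain ⟨r, h⟩ := P.exists_chart_vertex i
      exact ⟨r, h.r_pos, P.liftsNear_vertex h (hc i)⟩
    obtain ⟨i, s, hs, rfl⟩ := (P.mem_frontier_iff p).mp hf
    rcases hs.1.eq_or_lt with rfl | h1
    · have := hv (i - 1)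
      rwa [sub_add_cancel, ← P.edgePt_zero] at this
    rcases hs.2.eq_or_lt with rfl | h2
    · have := hv i
      rwa [← P.edgePt_len] at this
    obtain ⟨r, h⟩ := P.exists_chart_edge i ⟨h1, h2⟩
    exact ⟨r, h.r_pos, P.liftsNear_edge h c f⟩

/-- Continuous boundary functions with square integrable tangential derivative lift to `H¹(Ω)`. -/
theorem exists_lift {c : ZMod K → ℝ} {f : ∀ i, P.L2Edge i}
    (hc : ∀ i, c i + ∫ r in (0 : ℝ)..P.len i, f i r = c (i + 1)) :
    ∃ U : H1 P.Ω, P.HasTrace U (P.primitive c f) := by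
  have hr : ∀ p, ∃ r, p ∈ closure P.Ω → 0 < r ∧ P.LiftsNear (P.primitive c f) p r := by
    intro p
    by_cases hp : p ∈ closure P.Ω
    · obtain ⟨r, h⟩ := P.exists_liftsNear hc hp
      exact ⟨r, fun _ => h⟩
    · exact ⟨0, fun h => absurd h hp⟩
  choose r hr using hr
  obtain ⟨t, ht, χ, hχ, hsum⟩ := exists_smooth_partition P.isCompact_closure
    (fun p => Metric.ball p (r p)) fun p hp =>
      ⟨Metric.isOpen_ball, Metric.mem_ball_self (hr p hp).1, Metric.isBounded_ball⟩
  have hU : ∀ p, ∃ U : H1 P.Ω, p ∈ t →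
      P.HasTrace U fun i s => χ p (P.edgePt i s) * P.primitive c f i s := by
    intro p
    by_cases hp : p ∈ t
    · obtain ⟨h1, _, h3⟩ := hχ p hp
      have := (hr p (ht p hp)).2 (χ p) h1 h3
      obtain ⟨U, hU⟩ := this
      exact ⟨U, fun _ => hU⟩
    · exact ⟨0, fun h => absurd h hp⟩
  choose U hU using hU
  refine ⟨∑ p ∈ t, U p, HasTrace.congr P (HasTrace.sum P t hU) fun i s hs => ?_⟩
  rw [← Finset.sum_mul, hsum _ (P.edgePt_mem_closure i (Ioo_subset_Icc_self hs)), one_mul]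

end PlateDomain

/-! ### Tangential derivatives and their pairing with traces -/

/-- Integration by parts for the primitive of a merely integrable function, which is absolutely
continuous. -/
theorem integral_primitive_mul_deriv {f θ : ℝ → ℝ} {L : ℝ} (hf : IntervalIntegrable f volume 0 L)
    (hθ : ContDiff ℝ ∞ θ) (c : ℝ) :
    ∫ s in (0 : ℝ)..L, (c + ∫ r in (0 : ℝ)..s, f r) * deriv θ s
      = (c + ∫ r in (0 : ℝ)..L, f r) * θ L - c * θ 0 - ∫ s in (0 : ℝ)..L, f s * θ s := by
  have hI := hf.absolutelyContinuousOnInterval_intervalIntegral (c := 0) left_mem_uIcc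
  have hθ' : AbsolutelyContinuousOnInterval θ 0 L :=
    (hθ.of_le (by simp)).contDiffOn.absolutelyContinuousOnInterval
  have hc : Continuous (deriv θ) := hθ.continuous_deriv (by simp)
  have h1 := hI.integral_mul_deriv_eq_deriv_mul hθ'
  have h2 : ∫ s in (0 : ℝ)..L, deriv (fun x => ∫ r in (0 : ℝ)..x, f r) s * θ s
      = ∫ s in (0 : ℝ)..L, f s * θ s := by
    refine intervalIntegral.integral_congr_ae ?_
    filter_upwards [hf.ae_hasDerivAt_integral] with x hx hx'
    rw [(hx (uIoc_subset_uIcc hx') 0 left_mem_uIcc).deriv]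
  have h3 : ∫ s in (0 : ℝ)..L, c * deriv θ s = c * (θ L - θ 0) := by
    rw [intervalIntegral.integral_const_mul,
      intervalIntegral.integral_deriv_eq_sub (fun x _ =>
        (hθ.differentiable (by simp)).differentiableAt) (hc.intervalIntegrable _ _)]
  have h4 : ∫ s in (0 : ℝ)..L, (c + ∫ r in (0 : ℝ)..s, f r) * deriv θ s
      = (∫ s in (0 : ℝ)..L, c * deriv θ s)
        + ∫ s in (0 : ℝ)..L, (∫ r in (0 : ℝ)..s, f r) * deriv θ s := by
    rw [← intervalIntegral.integral_add ((hc.const_mul c).intervalIntegrable _ _)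
      (hc.intervalIntegrable _ _ |>.continuousOn_mul hI.continuousOn)]
    simp only [add_mul]
  rw [h4, h3, h1, h2, intervalIntegral.integral_same]
  ring

theorem pderiv_comm {φ : Plane → ℝ} (h : φ ∈ Smooth) (i j : Fin 2) :
    pderiv i (pderiv j φ) = pderiv j (pderiv i φ) := by
  funext x
  have hs : IsSymmSndFDerivAt ℝ φ x := (h.1.contDiffAt).isSymmSndFDerivAt (by
    rw [minSmoothness_of_isRCLikeNormedField]
    exact WithTop.coe_le_coe.mpr (le_top : (2 : ℕ∞) ≤ ⊤))
  have hd : DifferentiableAt ℝ (fderiv ℝ φ) x :=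
    ((h.1.fderiv_right (m := ∞) (by simp)).differentiable (by simp)).differentiableAt
  have e : ∀ i j : Fin 2, pderiv i (pderiv j φ) x
      = fderiv ℝ (fderiv ℝ φ) x (EuclideanSpace.single i 1) (EuclideanSpace.single j 1) := by
    intro i j
    unfold pderiv
    rw [fderiv_clm_apply hd (differentiableAt_const _)]
    simp
  rw [e, e]
  exact hs _ _

theorem eq_of_forall_isTest {Ω : Set Plane} (hΩ : IsOpen Ω) {u w : L2 Ω}
    (h : ∀ φ, IsTest Ω φ → ∫ x in Ω, u x * φ x = ∫ x in Ω, w x * φ x) : u = w := by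
  have hint : LocallyIntegrableOn (fun x => u x - w x) Ω :=
    locallyIntegrableOn_of_locallyIntegrable_restrict
      (((Lp.memLp u).sub (Lp.memLp w)).locallyIntegrable (by norm_num))
  have hz := hΩ.ae_eq_zero_of_integral_contDiff_smul_eq_zero hint (by
    intro φ hφ hc hs
    have ht : IsTest Ω φ := ⟨⟨hφ, hc⟩, hs⟩
    rw [← setIntegral_eq_integral_of_forall_compl_eq_zero (s := Ω) (fun x hx => by
      rw [image_eq_zero_of_notMem_tsupport (fun hh => hx (hs hh)), zero_smul])]
    have e := integral_sub ((Lp.memLp u).integrable_mul (Smooth.memLp ht.1 Ω))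
      ((Lp.memLp w).integrable_mul (Smooth.memLp ht.1 Ω))
    refine Eq.trans (integral_congr_ae (ae_of_all _ fun x => ?_))
      (e.trans (sub_eq_zero.mpr (h φ ht)))
    simp only [smul_eq_mul, Pi.mul_apply]
    ring)
  refine Lp.ext ?_
  rw [Filter.EventuallyEq, ae_restrict_iff' hΩ.measurableSet]
  filter_upwards [hz] with x hx hxΩ
  exact sub_eq_zero.mp (hx hxΩ)

theorem isTest_pderiv {Ω : Set Plane} {φ : Plane → ℝ} (h : IsTest Ω φ) (i : Fin 2) :
    IsTest Ω (pderiv i φ) := by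
  refine ⟨Smooth.pderiv_mem h.1 i, fun x hx => h.2 ?_⟩
  exact (tsupport_fderiv_apply_subset ℝ _) hx

/-- The gradient of a function in `H²(Ω)` is curl free. -/
theorem d_comm_of_grad {Ω : Set Plane} (hΩ : IsOpen Ω) {v : H1 Ω} {G : H1Vec Ω}
    (h : ∀ i, H1.d v i = H1.fn (G i)) (i j : Fin 2) : H1.d (G i) j = H1.d (G j) i := by
  refine eq_of_forall_isTest hΩ fun φ hφ => ?_
  have key : ∀ i j : Fin 2, ∫ x in Ω, H1.d (G i) j x * φ x
      = ∫ x in Ω, H1.fn v x * pderiv i (pderiv j φ) x := by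
    intro i j
    have e1 : ∫ x in Ω, H1.fn (G i) x * pderiv j φ x = - ∫ x in Ω, H1.d (G i) j x * φ x :=
      (G i).2 j φ hφ
    have e2 : ∫ x in Ω, H1.fn v x * pderiv i (pderiv j φ) x
        = - ∫ x in Ω, H1.d v i x * pderiv j φ x := v.2 i _ (isTest_pderiv hφ j)
    rw [e2, h i, e1, neg_neg]
  rw [key, key, pderiv_comm hφ.1]

namespace PlateDomain
variable {K : ℕ} [NeZero K] (P : PlateDomain K)

theorem deriv_edge {χ : Plane → ℝ} (hχ : χ ∈ Smooth) (i : ZMod K) (s : ℝ) :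
    deriv (fun s => χ (P.edgePt i s)) s
      = P.tangent i 0 * pderiv 0 χ (P.edgePt i s) + P.tangent i 1 * pderiv 1 χ (P.edgePt i s) := by
  rw [← fderiv_eq_pderiv]
  exact (hasDerivAt_line hχ.1 (P.vtx i) (P.tangent i) s).deriv

theorem memLp_deriv_edge {χ : Plane → ℝ} (hχ : χ ∈ Smooth) (i : ZMod K) :
    MemLp (deriv fun s => χ (P.edgePt i s)) 2 (volume.restrict (Ioo 0 (P.len i))) := by
  rw [funext (P.deriv_edge hχ i)]
  exact ((P.memLp_edge (Smooth.pderiv_mem hχ 0) i).const_mul _).add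
    ((P.memLp_edge (Smooth.pderiv_mem hχ 1) i).const_mul _)

theorem toLp_deriv_edge {χ : Plane → ℝ} (hχ : χ ∈ Smooth) (i : ZMod K) :
    (P.memLp_deriv_edge hχ i).toLp _
      = P.tangent i 0 • P.trace (smoothToH1 P.Ω ⟨_, Smooth.pderiv_mem hχ 0⟩) i
        + P.tangent i 1 • P.trace (smoothToH1 P.Ω ⟨_, Smooth.pderiv_mem hχ 1⟩) i := by
  rw [trace_smoothToH1, trace_smoothToH1]
  have h := ((P.memLp_edge (Smooth.pderiv_mem hχ 0) i).const_smul (P.tangent i 0)).add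
    ((P.memLp_edge (Smooth.pderiv_mem hχ 1) i).const_smul (P.tangent i 1))
  exact (MemLp.toLp_congr (P.memLp_deriv_edge hχ i) h (ae_of_all _ (P.deriv_edge hχ i))).trans rfl

theorem sub_eq_sub_of_add_eq {A A' B B' S S' : ℝ} (h : A + B = S) (h' : A' + B' = S') (hA : A = A') :
    B - B' = S - S' := by linarith

theorem sum_sub_sum_eq_neg {ι : Type*} [Fintype ι] (a b c : ι → ℝ) (h : ∀ i, a i - b i = -c i) :
    (∑ i, a i) - ∑ i, b i = -∑ i, c i := by
  rw [← Finset.sum_neg_distrib, ← Finset.sum_sub_distrib]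
  exact Finset.sum_congr rfl fun i _ => h i

theorem sum_normal_sub (i : ZMod K) (f g h : P.L2Edge i) :
    P.normal i 1 * inner ℝ f g - P.normal i 0 * inner ℝ f h
      = -inner ℝ f (P.tangent i 0 • g + P.tangent i 1 • h) := by
  rw [inner_add_right, real_inner_smul_right, real_inner_smul_right]
  simp only [normal, PiLp.toLp_apply, Matrix.cons_val_zero, Matrix.cons_val_one]
  ring

/-- Green's formula for curl free fields. -/
theorem green_curl_free (u w0 w1 : H1 P.Ω) (h : H1.d w0 1 = H1.d w1 0) :
    inner ℝ (H1.d u 1) (H1.fn w0) - inner ℝ (H1.d u 0) (H1.fn w1)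
      = -∑ i, inner ℝ (P.trace u i)
        (P.tangent i 0 • P.trace w0 i + P.tangent i 1 • P.trace w1 i) := by
  refine (sub_eq_sub_of_add_eq (P.green u w0 1) (P.green u w1 0)
    (congrArg (inner ℝ (H1.fn u)) h)).trans ?_
  exact sum_sub_sum_eq_neg _ _ _ fun i => P.sum_normal_sub i (P.trace u i) (P.trace w0 i) (P.trace w1 i)

/-- Green's formula for the tangential derivative of a smooth function. -/
theorem green_tangent (u : H1 P.Ω) {χ : Plane → ℝ} (hχ : χ ∈ Smooth) :
    inner ℝ (H1.d u 1) (H1.d (smoothToH1 P.Ω ⟨χ, hχ⟩) 0)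
        - inner ℝ (H1.d u 0) (H1.d (smoothToH1 P.Ω ⟨χ, hχ⟩) 1)
      = -∑ i, inner ℝ (P.trace u i) ((P.memLp_deriv_edge hχ i).toLp _) := by
  have e : H1.d (smoothToH1 P.Ω ⟨_, Smooth.pderiv_mem hχ 0⟩) 1
      = H1.d (smoothToH1 P.Ω ⟨_, Smooth.pderiv_mem hχ 1⟩) 0 :=
    MemLp.toLp_congr (Smooth.memLp_pderiv (Smooth.pderiv_mem hχ 0) P.Ω 1)
      (Smooth.memLp_pderiv (Smooth.pderiv_mem hχ 1) P.Ω 0)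
      (ae_of_all _ (congrFun (pderiv_comm hχ 1 0)))
  refine (P.green_curl_free u _ _ e).trans ?_
  exact congrArg Neg.neg (Finset.sum_congr rfl fun i _ =>
    congrArg (inner ℝ (P.trace u i)) (P.toLp_deriv_edge hχ i).symm)

end PlateDomain
namespace PlateDomain
variable {K : ℕ} [NeZero K] (P : PlateDomain K)

theorem inner_edge_eq (i : ZMod K) (u : P.L2Edge i) {g h : ℝ → ℝ}
    (hh : MemLp h 2 (volume.restrict (Ioo 0 (P.len i))))
    (hu : ∀ᵐ s ∂(volume.restrict (Ioo 0 (P.len i))), u s = g s) :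
    inner ℝ u (hh.toLp h) = ∫ s in (0 : ℝ)..P.len i, g s * h s := by
  rw [← integral_edge, intervalIntegral.integral_of_le (P.len_pos i).le,
    integral_Ioc_eq_integral_Ioo]
  refine integral_congr_ae ?_
  filter_upwards [hu, hh.coeFn_toLp] with s h1 h2
  rw [h1, h2]

theorem contDiff_edge {χ : Plane → ℝ} (hχ : χ ∈ Smooth) (i : ZMod K) :
    ContDiff ℝ ∞ fun s => χ (P.edgePt i s) :=
  contDiff_line hχ.1 _ _

theorem trace_smooth {χ : Plane → ℝ} (hχ : χ ∈ Smooth) (i : ZMod K) :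
    P.trace (smoothToH1 P.Ω ⟨χ, hχ⟩) i = (P.memLp_edge hχ i).toLp _ :=
  congrArg (fun x : P.L2Bdry => x i) (P.trace_smoothToH1 ⟨χ, hχ⟩)

theorem inner_primitive_deriv {c : ZMod K → ℝ} {f : ∀ i, P.L2Edge i}
    (hc : ∀ i, c i + ∫ r in (0 : ℝ)..P.len i, f i r = c (i + 1)) {U : H1 P.Ω}
    (hU : P.HasTrace U (P.primitive c f)) {χ : Plane → ℝ} (hχ : χ ∈ Smooth) (i : ZMod K) :
    inner ℝ (P.trace U i) ((P.memLp_deriv_edge hχ i).toLp _)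
      = c (i + 1) * χ (P.vtx (i + 1)) - c i * χ (P.vtx i)
        - inner ℝ (f i) (P.trace (smoothToH1 P.Ω ⟨χ, hχ⟩) i) := by
  have h1 := P.inner_edge_eq i (P.trace U i) (P.memLp_deriv_edge hχ i) (hU i)
  have h2 := P.inner_edge_eq i (f i) (P.memLp_edge hχ i) (ae_of_all _ fun s => rfl)
  have h3 := integral_primitive_mul_deriv
    (P.intervalIntegrable_edge i (f i) (P.len_mem i)) (P.contDiff_edge hχ i) (c i)
  rw [hc i, edgePt_len, edgePt_zero] at h3
  exact h1.trans (h3.trans (congrArg (c (i + 1) * χ (P.vtx (i + 1)) - c i * χ (P.vtx i) - ·)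
    (h2.symm.trans (congrArg (inner ℝ (f i)) (P.trace_smooth hχ i).symm))))

/-- The vertex terms cancel around the closed polygon, because `i ↦ i + 1` permutes `ZMod K`. -/
theorem neg_sum_eq_of_telescope {b x y : ZMod K → ℝ} (h : ∀ i, x i = b (i + 1) - b i - y i) :
    -∑ i, x i = ∑ i, y i := by
  have e : ∑ i, b (i + 1) = ∑ i, b i := Equiv.sum_comp (Equiv.addRight (1 : ZMod K)) b
  rw [Finset.sum_congr rfl fun i _ => h i, Finset.sum_sub_distrib, Finset.sum_sub_distrib, e]
  ring

theorem pairing_smooth {c : ZMod K → ℝ} {f : ∀ i, P.L2Edge i}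
    (hc : ∀ i, c i + ∫ r in (0 : ℝ)..P.len i, f i r = c (i + 1)) {U : H1 P.Ω}
    (hU : P.HasTrace U (P.primitive c f)) {χ : Plane → ℝ} (hχ : χ ∈ Smooth) :
    inner ℝ (H1.d U 1) (H1.d (smoothToH1 P.Ω ⟨χ, hχ⟩) 0)
        - inner ℝ (H1.d U 0) (H1.d (smoothToH1 P.Ω ⟨χ, hχ⟩) 1)
      = ∑ i, inner ℝ (f i) (P.trace (smoothToH1 P.Ω ⟨χ, hχ⟩) i) := by
  refine (P.green_tangent U hχ).trans ?_
  exact neg_sum_eq_of_telescope (b := fun i => c i * χ (P.vtx i)) fun i =>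
    P.inner_primitive_deriv hc hU hχ i

/-- The tangential derivative of a function with the trace `c_i + ∫_0^s f_i` is `f`. -/
theorem pairing {c : ZMod K → ℝ} {f : ∀ i, P.L2Edge i}
    (hc : ∀ i, c i + ∫ r in (0 : ℝ)..P.len i, f i r = c (i + 1)) {U : H1 P.Ω}
    (hU : P.HasTrace U (P.primitive c f)) (ξ : H1 P.Ω) :
    inner ℝ (H1.d U 1) (H1.d ξ 0) - inner ℝ (H1.d U 0) (H1.d ξ 1)
      = ∑ i, inner ℝ (f i) (P.trace ξ i) := by
  have c1 : Continuous fun ξ : H1 P.Ω => inner ℝ (H1.d U 1) (H1.d ξ 0) - inner ℝ (H1.d U 0) (H1.d ξ 1) :=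
    (continuous_const.inner (H1.continuous_d P.Ω 0)).sub
      (continuous_const.inner (H1.continuous_d P.Ω 1))
  have c2 : Continuous fun ξ : H1 P.Ω => ∑ i, inner ℝ (f i) (P.trace ξ i) :=
    continuous_finsetSum _ fun i _ => continuous_const.inner (P.continuous_trace_apply i)
  exact congrFun (P.denseRange_smoothToH1.equalizer c1 c2
    (funext fun φ => P.pairing_smooth hc hU φ.2)) ξ

theorem eq_neg_of_sub_eq_neg {A B C D S T : ℝ} (h : A - B = -S) (h' : C - D = -T) (hA : A = D)
    (hB : B = C) : S = -T := by linarith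

/-- Both boundary sums are, up to sign, the volume integral of `∇v` against the rotated gradient of
`χ`. This is the weak form of the fact that the tangential component of `∇v` is the derivative of
the trace of `v` along `Γ`. -/
theorem tangential_orthogonal {v : H1 P.Ω} {G : H1Vec P.Ω} (h : P.IsGrad v G) {χ : Plane → ℝ}
    (hχ : χ ∈ Smooth) :
    ∑ i, inner ℝ (P.trace (smoothToH1 P.Ω ⟨χ, hχ⟩) i)
        (P.tangent i 0 • P.trace (G 0) i + P.tangent i 1 • P.trace (G 1) i)
      = -∑ i, inner ℝ (P.trace v i) ((P.memLp_deriv_edge hχ i).toLp _) := by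
  have h1 := P.green_curl_free (smoothToH1 P.Ω ⟨χ, hχ⟩) (G 0) (G 1) (d_comm_of_grad P.isOpen h 0 1)
  have h2 := P.green_tangent v hχ
  exact eq_neg_of_sub_eq_neg h1 h2
    ((real_inner_comm _ _).trans (congrArg (fun g => inner ℝ g _) (h 0).symm))
    ((real_inner_comm _ _).trans (congrArg (fun g => inner ℝ g _) (h 1).symm))

end PlateDomain

/-! ### Vanishing of the gradient on clamped edges -/

theorem exists_smooth_bump (p : Plane) {r : ℝ} (hr : 0 < r) :
    ∃ η ∈ Smooth, η p ≠ 0 ∧ tsupport η ⊆ Metric.ball p r := by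
  let f : ContDiffBump p := ⟨r / 4, r / 2, by positivity, by linarith⟩
  refine ⟨f, ⟨f.contDiff, f.hasCompactSupport⟩, ?_, ?_⟩
  · rw [f.one_of_mem_closedBall (Metric.mem_closedBall_self (by positivity))]
    exact one_ne_zero
  · rw [f.tsupport_eq]
    exact Metric.closedBall_subset_ball (half_lt_self hr)

namespace PlateDomain
variable {K : ℕ} [NeZero K] (P : PlateDomain K)

theorem sum_inner_of_eq_zero {e : ZMod K} {a b : ∀ i, P.L2Edge i} (h : ∀ k, k ≠ e → a k = 0 ∨ b k = 0) :
    ∑ i, inner ℝ (a i) (b i) = inner ℝ (a e) (b e) := by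
  refine Finset.sum_eq_single e (fun k _ hk => ?_) fun hn => absurd (Finset.mem_univ e) hn
  rcases h k hk with h0 | h0
  · rw [h0, inner_zero_left]
  · rw [h0, inner_zero_right]

theorem toLp_eq_zero {i : ZMod K} {g : ℝ → ℝ} (hg : MemLp g 2 (volume.restrict (Ioo 0 (P.len i))))
    (h : ∀ s ∈ Ioo 0 (P.len i), g s = 0) : hg.toLp g = 0 := by
  refine (MemLp.toLp_congr hg MemLp.zero ?_).trans (MemLp.toLp_zero _)
  filter_upwards [ae_restrict_mem measurableSet_Ioo] with s hs
  exact h s hs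

/-- The tangential component of a vector field on the `i`-th edge. -/
def tangTrace (G : H1Vec P.Ω) (i : ZMod K) : P.L2Edge i :=
  P.tangent i 0 • P.trace (G 0) i + P.tangent i 1 • P.trace (G 1) i

/-- Since `χ` and its edge derivative vanish on the other edges, only edge `e` contributes to either
sum, and there the trace of `v` is zero. -/
theorem inner_tangTrace_eq_zero {v : H1 P.Ω} {G : H1Vec P.Ω} (h : P.IsGrad v G) {e : ZMod K}
    (hv : P.trace v e = 0) {χ : Plane → ℝ} (hχ : χ ∈ Smooth)
    (hχe : ∀ k, k ≠ e → ∀ s ∈ Ioo 0 (P.len k), χ (P.edgePt k s) = 0) :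
    inner ℝ (P.trace (smoothToH1 P.Ω ⟨χ, hχ⟩) e) (P.tangTrace G e) = 0 := by
  have h1 := P.sum_inner_of_eq_zero (e := e) (a := fun i => P.trace (smoothToH1 P.Ω ⟨χ, hχ⟩) i)
    (b := P.tangTrace G) fun k hk =>
      Or.inl ((P.trace_smooth hχ k).trans (P.toLp_eq_zero _ (hχe k hk)))
  have h2 := P.sum_inner_of_eq_zero (e := e) (a := fun i => P.trace v i)
    (b := fun i => (P.memLp_deriv_edge hχ i).toLp _) fun k hk => by
      refine Or.inr (P.toLp_eq_zero _ fun s hs => ?_)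
      have : (fun s => χ (P.edgePt k s)) =ᶠ[𝓝 s] fun _ => 0 := by
        filter_upwards [isOpen_Ioo.mem_nhds hs] with t ht using hχe k hk t ht
      rw [this.deriv_eq, deriv_const]
  have h3 : inner ℝ (P.trace v e) ((P.memLp_deriv_edge hχ e).toLp _) = 0 := by
    rw [hv, inner_zero_left]
  exact h1.symm.trans ((P.tangential_orthogonal h hχ).trans
    (neg_eq_zero.mpr (h2.trans h3)))

/-- The fundamental lemma of the calculus of variations on one edge. The bump `η` localizes to a
ball that meets no other edge, so its product with a test function of the arc length is an
admissible planar test function. -/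
theorem ae_bump_mul_eq_zero {e : ZMod K} {T : P.L2Edge e}
    (hT : ∀ χ (hχ : χ ∈ Smooth), (∀ k, k ≠ e → ∀ s ∈ Ioo 0 (P.len k), χ (P.edgePt k s) = 0) →
      inner ℝ (P.trace (smoothToH1 P.Ω ⟨χ, hχ⟩) e) T = 0) {p : Plane} {r : ℝ} (hc : P.Chart p r e e)
    {η : Plane → ℝ} (hη : η ∈ Smooth) (hs : tsupport η ⊆ Metric.ball p r) :
    ∀ᵐ s, s ∈ Ioo 0 (P.len e) → η (P.edgePt e s) * T s = 0 := by
  have hd : cross (P.tangent e) (P.normal e) ≠ 0 := by rw [cross_tangent_normal]; norm_num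
  have hm := P.memLp_edge hη e
  have hint : LocallyIntegrableOn (fun s => η (P.edgePt e s) * T s) (Ioo 0 (P.len e)) :=
    IntegrableOn.locallyIntegrableOn (hm.integrable_mul (Lp.memLp T))
  refine isOpen_Ioo.ae_eq_zero_of_integral_contDiff_smul_eq_zero hint fun g hg hgc hgs => ?_
  -- The one-variable test function is extended to the plane as a constant in the normal direction.
  have hχ := Smooth.mul hη (hg.comp (contDiff_coord (P.vtx e) (P.tangent e) (P.normal e)))
  have h0 := hT _ hχ fun k hk s hsk => by
    have : η (P.edgePt k s) = 0 := image_eq_zero_of_notMem_tsupport fun hm' =>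
      hk ((or_self_iff).mp (hc.edges k s (Ioo_subset_Icc_self hsk) (hs hm')))
    rw [this, mul_zero]
  rw [← setIntegral_eq_integral_of_forall_compl_eq_zero (s := Ioo 0 (P.len e)) (fun x hx => by
      rw [image_eq_zero_of_notMem_tsupport (fun hh => hx (hgs hh)), zero_smul])]
  rw [P.trace_smooth hχ e, ← integral_edge] at h0
  refine Eq.trans (integral_congr_ae ?_) h0
  filter_upwards [(P.memLp_edge hχ e).coeFn_toLp] with s hs'
  rw [hs']
  simp only [Function.comp, P.coord_edgePt e hd, smul_eq_mul, mul_assoc]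

/-- Every interior point of the edge has a bump that does not vanish near it, so the set where `T`
is nonzero is locally null. -/
theorem edge_eq_zero {e : ZMod K} {T : P.L2Edge e}
    (hT : ∀ χ (hχ : χ ∈ Smooth), (∀ k, k ≠ e → ∀ s ∈ Ioo 0 (P.len k), χ (P.edgePt k s) = 0) →
      inner ℝ (P.trace (smoothToH1 P.Ω ⟨χ, hχ⟩) e) T = 0) : T = 0 := by
  refine Lp.ext ?_
  have key : volume {s | s ∈ Ioo 0 (P.len e) ∧ T s ≠ 0} = 0 := by
    refine measure_null_of_locally_null _ fun σ hσ => ?_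
    obtain ⟨r, hc⟩ := P.exists_chart_edge e hσ.1
    obtain ⟨η, hη, hp, hs⟩ := exists_smooth_bump (P.edgePt e σ) hc.r_pos
    have hcont : Continuous fun s => η (P.edgePt e s) := (P.contDiff_edge hη e).continuous
    refine ⟨_, inter_mem_nhdsWithin _ ((isOpen_ne.preimage hcont).mem_nhds hp), ?_⟩
    refine measure_mono_null ?_ (ae_iff.mp (P.ae_bump_mul_eq_zero hT hc hη hs))
    rintro s ⟨⟨h1, h2⟩, h3⟩ h
    exact (mul_ne_zero h3 h2) (h h1)
  rw [Filter.EventuallyEq, ae_restrict_iff' measurableSet_Ioo]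
  have h0 := (ae_restrict_iff' measurableSet_Ioo).mp
    (Lp.coeFn_zero ℝ 2 (volume.restrict (Ioo 0 (P.len e))))
  filter_upwards [h0, compl_mem_ae_iff.mpr key] with s h1 h2 hs
  rw [h1 hs]
  by_contra h
  exact h2 ⟨hs, h⟩

/-- The tangential derivative of a function in `H²(Ω)` vanishes on the edges on which the function
does. -/
theorem tangTrace_eq_zero {v : H1 P.Ω} {G : H1Vec P.Ω} (h : P.IsGrad v G) {e : ZMod K}
    (hv : P.trace v e = 0) : P.tangTrace G e = 0 :=
  P.edge_eq_zero fun _ hχ hχe => P.inner_tangTrace_eq_zero h hv hχ hχe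

theorem eq_zero_of_components {E : Type*} [AddCommGroup E] [Module ℝ E] {t n : Fin 2 → ℝ}
    (ht : t 0 ^ 2 + t 1 ^ 2 = 1) (h0 : n 0 = t 1) (h1 : n 1 = -t 0) {g : Fin 2 → E}
    (h : t 0 • g 0 + t 1 • g 1 = 0) (h' : ∑ a, n a • g a = 0) (a : Fin 2) : g a = 0 := by
  rw [Fin.sum_univ_two, h0, h1] at h'
  have e0 : g 0 = 0 := by
    calc g 0 = (t 0 ^ 2 + t 1 ^ 2) • g 0 := by rw [ht, one_smul]
      _ = t 0 • (t 0 • g 0 + t 1 • g 1) + t 1 • (t 1 • g 0 + (-t 0) • g 1) := by module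
      _ = 0 := by rw [h, h', smul_zero, smul_zero, add_zero]
  have e1 : g 1 = 0 := by
    calc g 1 = (t 0 ^ 2 + t 1 ^ 2) • g 1 := by rw [ht, one_smul]
      _ = t 1 • (t 0 • g 0 + t 1 • g 1) - t 0 • (t 1 • g 0 + (-t 0) • g 1) := by module
      _ = 0 := by rw [h, h', smul_zero, smul_zero, sub_zero]
  fin_cases a
  · exact e0
  · exact e1

/-- Tangent and normal are orthonormal, and both components vanish. This is why the values of
`ψ_Γ[q]` on the clamped edge may be chosen freely. -/
theorem trace_grad_eq_zero {v : H1 P.Ω} {G : H1Vec P.Ω} (h : P.IsGrad v G) {e : ZMod K}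
    (hv : P.trace v e = 0) (hn : P.normalTrace G e = 0) (a : Fin 2) : P.trace (G a) e = 0 :=
  eq_zero_of_components (t := P.tangent e) (n := P.normal e) (P.tangent_sq e) rfl rfl
    (g := fun a => P.trace (G a) e) (P.tangTrace_eq_zero h hv) hn a

end PlateDomain
-- The boundary function as a primitive; existence and uniqueness of its harmonic extension
namespace PlateDomain
variable {K : ℕ} [NeZero K] (P : PlateDomain K)

/-- The value of the component `a` of `ψ_Γ[q]` at the starting point of the edge `i`. -/
def startValue (e : ZMod K) (q : H1 P.Ω) (a : Fin 2) (i : ZMod K) : ℝ :=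
  P.cornerValue e q (i - (e + 1)).val a

/-- The tangential derivative of the component `a` of `ψ_Γ[q]`. -/
def slope (e : ZMod K) (q : H1 P.Ω) (a : Fin 2) (i : ZMod K) : P.L2Edge i :=
  if i = e then
    Lp.const 2 _ ((P.cornerValue e q 0 a - P.cornerValue e q (K - 1) a) / P.len e)
  else (-P.normal i a) • P.trace q i

/-- Counted from `e + 1`, the edge `e` comes last. The exceptional case is excluded later by
`three_le`. -/
theorem val_sub_succ (e : ZMod K) : (e - (e + 1)).val = K - 1 ∨ K = 1 := by
  rcases eq_or_ne K 1 with h | h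
  · exact Or.inr h
  · have : Fact (1 < K) := ⟨by have := NeZero.ne K; omega⟩
    left
    rw [show e - (e + 1) = -1 by ring, ZMod.neg_val, if_neg one_ne_zero, ZMod.val_one]

/-- The count of edges from `e + 1` wraps around only when passing from `e` to `e + 1`. -/
theorem val_succ_sub {e i : ZMod K} (h : i ≠ e) :
    (i + 1 - (e + 1)).val = (i - (e + 1)).val + 1 := by
  have hK : (i - (e + 1)).val < K := ZMod.val_lt _
  have hne : (i - (e + 1)).val + 1 ≠ K := by
    intro hk
    have h1 : (((i - (e + 1)).val + 1 : ℕ) : ZMod K) = 0 := by rw [hk]; exact ZMod.natCast_self K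
    rw [Nat.cast_add, ZMod.natCast_zmod_val, Nat.cast_one] at h1
    exact h (by linear_combination h1)
  have : Fact (1 < K) := ⟨by omega⟩
  rw [show i + 1 - (e + 1) = (i - (e + 1)) + 1 by ring, ZMod.val_add_of_lt, ZMod.val_one]
  rw [ZMod.val_one]
  omega

theorem edge_integral_congr (i : ZMod K) {f : P.L2Edge i} {g : ℝ → ℝ}
    (h : ∀ᵐ s ∂(volume.restrict (Ioo 0 (P.len i))), f s = g s) {s : ℝ} (hs : s ∈ Icc 0 (P.len i)) :
    ∫ r in (0 : ℝ)..s, f r = ∫ r in (0 : ℝ)..s, g r := by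
  simp only [intervalIntegral.integral_of_le hs.1, integral_Ioc_eq_integral_Ioo]
  exact integral_congr_ae (ae_restrict_of_ae_restrict_of_subset (Ioo_subset_Ioo_right hs.2) h)

theorem slope_self (e : ZMod K) (q : H1 P.Ω) (a : Fin 2) : P.slope e q a e
    = Lp.const 2 _ ((P.cornerValue e q 0 a - P.cornerValue e q (K - 1) a) / P.len e) := if_pos rfl

theorem slope_of_ne {e i : ZMod K} (h : i ≠ e) (q : H1 P.Ω) (a : Fin 2) :
    P.slope e q a i = (-P.normal i a) • P.trace q i := if_neg h

theorem primitive_slope (e : ZMod K) (q : H1 P.Ω) (a : Fin 2) (i : ZMod K) {s : ℝ}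
    (hs : s ∈ Icc 0 (P.len i)) :
    P.primitive (P.startValue e q a) (P.slope e q a) i s = P.psiGamma e q i s a := by
  rw [primitive, startValue]
  rcases eq_or_ne i e with rfl | h
  · have hv := (val_sub_succ i).resolve_right (by have := P.three_le; omega)
    rw [hv, slope_self, psiGamma, if_pos rfl,
      P.edge_integral_congr i (g := fun _ => (P.cornerValue i q 0 a - P.cornerValue i q (K - 1) a)
        / P.len i) (Lp.coeFn_const _ _ _) hs]
    simp
    ring
  · rw [P.slope_of_ne h, psiGamma, if_neg h,
      P.edge_integral_congr i (f := (-P.normal i a) • P.trace q i)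
        (g := fun r => (-P.normal i a) * P.trace q i r) (Lp.coeFn_smul (-P.normal i a) _) hs, intervalIntegral.integral_const_mul]
    simp [edgeIntegral]
    ring

/-- Continuity at all vertices, including the closing one: off `e` the next corner value adds one
summand, and on `e` the interpolation leads back to the initial value. No condition on `q` is
required. -/
theorem startValue_succ (e : ZMod K) (q : H1 P.Ω) (a : Fin 2) (i : ZMod K) :
    P.startValue e q a i + ∫ r in (0 : ℝ)..P.len i, P.slope e q a i r = P.startValue e q a (i + 1) := by
  refine (P.primitive_slope e q a i (P.len_mem i)).trans ?_
  rw [psiGamma, startValue]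
  rcases eq_or_ne i e with rfl | h
  · rw [if_pos rfl, div_self (P.len_pos i).ne', sub_self, sub_self, ZMod.val_zero]
    simp
  · have hi : e + 1 + (((i - (e + 1)).val : ℕ) : ZMod K) = i := by
      rw [ZMod.natCast_zmod_val]; ring
    rw [if_neg h, val_succ_sub h, cornerValue, cornerValue, Finset.sum_range_succ, hi]
    exact congrArg (fun x : Plane => x a) (by module)

theorem hasTrace_psiGamma_iff {e : ZMod K} {q : H1 P.Ω} {a : Fin 2} {U : H1 P.Ω} :
    P.HasTrace U (fun i s => P.psiGamma e q i s a)
      ↔ P.HasTrace U (P.primitive (P.startValue e q a) (P.slope e q a)) :=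
  ⟨fun h => HasTrace.congr P h fun i _ hs =>
    (P.primitive_slope e q a i (Ioo_subset_Icc_self hs)).symm,
  fun h => HasTrace.congr P h fun i _ hs => P.primitive_slope e q a i (Ioo_subset_Icc_self hs)⟩

theorem exists_isExt (e : ZMod K) (q : H1 P.Ω) : ∃ ψ, P.IsExt e q ψ := by
  have h : ∀ a : Fin 2, ∃ u : H1 P.Ω, P.HasTrace u (fun i s => P.psiGamma e q i s a) ∧
      ∀ φ : H1 P.Ω, P.trace φ = 0 → ∑ j : Fin 2, inner ℝ (H1.d u j) (H1.d φ j) = 0 := by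
    intro a
    have h1 := P.exists_lift (P.startValue_succ e q a)
    obtain ⟨U, hU⟩ := h1
    have h2 := P.exists_harmonic U
    obtain ⟨u, hu, hu'⟩ := h2
    refine ⟨u, P.hasTrace_psiGamma_iff.mpr fun i => ?_, hu'⟩
    rw [hu]
    exact hU i
  choose u hu using h
  exact ⟨WithLp.toLp 2 u, hu⟩

theorem HasTrace.trace_eq {U W : H1 P.Ω} {B : ZMod K → ℝ → ℝ} (h : P.HasTrace U B)
    (h' : P.HasTrace W B) : P.trace U = P.trace W := by
  refine PiLp.ext fun i => Lp.ext ?_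
  filter_upwards [h i, h' i] with s h1 h2
  rw [h1, h2]

/-- The difference of two extensions has zero trace, so it may be tested with itself; its gradient
vanishes and Poincaré concludes. -/
theorem isExt_unique {e : ZMod K} {q : H1 P.Ω} {ψ χ : H1Vec P.Ω} (h : P.IsExt e q ψ)
    (h' : P.IsExt e q χ) : ψ = χ := by
  refine PiLp.ext fun a => ?_
  have ht : P.trace (ψ a - χ a) = 0 := by
    rw [map_sub, HasTrace.trace_eq P (h a).1 (h' a).1, sub_self]
  have h1 := (h a).2 _ ht
  have h2 := (h' a).2 _ ht
  refine sub_eq_zero.mp (P.eq_zero_of_trace_zero_of_grad ht ?_)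
  have h3 : ∀ j, H1.d (ψ a - χ a) j = H1.d (ψ a) j - H1.d (χ a) j := fun j => rfl
  have h4 : ∀ j, inner ℝ (H1.d (ψ a - χ a) j) (H1.d (ψ a - χ a) j)
      = inner ℝ (H1.d (ψ a) j) (H1.d (ψ a - χ a) j)
        - inner ℝ (H1.d (χ a) j) (H1.d (ψ a - χ a) j) := fun j =>
    (congrArg (fun g => inner ℝ g (H1.d (ψ a - χ a) j)) (h3 j)).trans (inner_sub_left _ _ _)
  rw [Finset.sum_congr rfl fun j _ => h4 j, Finset.sum_sub_distrib, h1, h2, sub_zero]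

end PlateDomain

/-! ### The coupling condition, the direct sum and the norm bound -/

/-- The closed graph theorem for a linear map given only as a functional relation. -/
theorem exists_bound_of_closed_graph {E F : Type*} [NormedAddCommGroup E] [NormedSpace ℝ E]
    [CompleteSpace E] [NormedAddCommGroup F] [NormedSpace ℝ F] [CompleteSpace F] {R : E → F → Prop}
    (hex : ∀ x, ∃ y, R x y) (hun : ∀ x y z, R x y → R x z → y = z)
    (hadd : ∀ x x' y y', R x y → R x' y' → R (x + x') (y + y'))
    (hsmul : ∀ (c : ℝ) x y, R x y → R (c • x) (c • y))
    (hcl : ∀ (x : ℕ → E) (y : ℕ → F) x' y', (∀ n, R (x n) (y n)) → Tendsto x atTop (𝓝 x') →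
      Tendsto y atTop (𝓝 y') → R x' y') :
    ∃ c : ℝ, 0 < c ∧ ∀ x y, R x y → ‖y‖ ≤ c * ‖x‖ := by
  choose f hf using hex
  let T : E →ₗ[ℝ] F :=
    { toFun := f
      map_add' := fun x x' => hun _ _ _ (hf _) (hadd _ _ _ _ (hf x) (hf x'))
      map_smul' := fun c x => hun _ _ _ (hf _) (hsmul c _ _ (hf x)) }
  have hT : Continuous T := T.continuous_of_seq_closed_graph fun u x y hu hy =>
    hun _ _ _ (hcl u _ x y (fun n => hf (u n)) hu hy) (hf x)
  obtain ⟨c, hc, h⟩ := (⟨T, hT⟩ : E →L[ℝ] F).bound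
  exact ⟨c, hc, fun x y hxy => hun _ _ _ (hf x) hxy ▸ h x⟩

theorem mem_sup_of_sub_mem {E F : Type*} [AddCommGroup E] [Module ℝ E] [AddCommGroup F] [Module ℝ F]
    {S T : Submodule ℝ (E × F)} {x : E} {y z : F} (h : ((0 : E), y - z) ∈ S) (h' : (x, z) ∈ T) :
    (x, y) ∈ S ⊔ T :=
  Submodule.mem_sup.mpr ⟨_, h, _, h', Prod.ext (zero_add _) (sub_add_cancel _ _)⟩

namespace PlateDomain
variable {K : ℕ} [NeZero K] (P : PlateDomain K)

theorem tangPairing_of_isExt {e : ZMod K} {q : H1 P.Ω} {ψ : H1Vec P.Ω} (h : P.IsExt e q ψ)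
    (ξ : H1Vec P.Ω) :
    P.tangPairing ψ ξ = ∑ a, ∑ i, inner ℝ (P.slope e q a i) (P.trace (ξ a) i) := by
  refine Finset.sum_congr rfl fun a _ => ?_
  rw [← P.pairing (P.startValue_succ e q a) (P.hasTrace_psiGamma_iff.mp (h a).1) (ξ a),
    Fin.sum_univ_two]
  simp only [Curl, Matrix.cons_val_zero, Matrix.cons_val_one, inner_neg_left]
  exact (sub_eq_add_neg _ _).symm

theorem sum_inner_neg_smul {E : Type*} [NormedAddCommGroup E] [InnerProductSpace ℝ E]
    (n : Fin 2 → ℝ) (q : E) (g : Fin 2 → E) :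
    ∑ a, inner ℝ ((-n a) • q) (g a) = -inner ℝ q (∑ a, n a • g a) := by
  rw [inner_sum, ← Finset.sum_neg_distrib]
  exact Finset.sum_congr rfl fun a _ => by
    rw [real_inner_smul_left, real_inner_smul_right, neg_mul]

theorem sum_inner_eq_of_eq_zero {E : Type*} [NormedAddCommGroup E] [InnerProductSpace ℝ E]
    (f g : Fin 2 → E) {q : E} (hq : q = 0) (hg : ∀ a, g a = 0) (N : E) :
    ∑ a, inner ℝ (f a) (g a) = -inner ℝ q N := by
  simp [hq, hg]

/-- Off `e` the slope is `-q n`. On `e` it is an unrelated constant, but the field vanishes there,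
and so does `q` on the right. -/
theorem sum_inner_slope {e : ZMod K} {q : H1 P.Ω} {G : H1Vec P.Ω} (hq : P.trace q e = 0)
    (hG : ∀ a, P.trace (G a) e = 0) (i : ZMod K) :
    ∑ a, inner ℝ (P.slope e q a i) (P.trace (G a) i)
      = -inner ℝ (P.trace q i) (P.normalTrace G i) := by
  rcases eq_or_ne i e with rfl | hi
  · exact sum_inner_eq_of_eq_zero (fun a => P.slope i q a i) (fun a => P.trace (G a) i) hq hG _
  · refine (Finset.sum_congr rfl fun a _ => congrArg (fun f => inner ℝ f (P.trace (G a) i))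
      (P.slope_of_ne hi q a)).trans ?_
    exact sum_inner_neg_smul (P.normal i) (P.trace q i) fun a => P.trace (G a) i

/-- The slope of `ψ_Γ[q]` represents the tangential derivative, and the pairing is compared edge by
edge. Clamping of `e` is used twice: for `q` and for `∇v`. -/
theorem coupling_of_isExt {e : ZMod K} (he : P.bc e = .clamped) {q : H1 P.Ω} (hq : q ∈ P.Q)
    {ψ : H1Vec P.Ω} (h : P.IsExt e q ψ) : P.Coupling q ψ := by
  intro v G hG
  have hv := hG.2.1 e he
  simp only [integral_edge]
  rw [P.tangPairing_of_isExt h G, Finset.sum_comm, ← Finset.sum_neg_distrib]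
  exact Finset.sum_congr rfl fun i _ =>
    P.sum_inner_slope (hq e (Or.inl he)) (P.trace_grad_eq_zero hG.1 hv.1 hv.2) i

/-- Zero is the extension that belongs to `q = 0`, and extensions are unique. -/
theorem V0_inf_V1 (e : ZMod K) : P.V0 ⊓ P.V1 e = ⊥ := by
  refine (Submodule.eq_bot_iff _).mpr fun p hp => ?_
  have h0 : p.1 = 0 := hp.1.1
  have h1 : P.IsExt e p.1 p.2 := hp.2.2
  exact Prod.ext h0 (P.isExt_unique (Eq.mp (congrArg (fun q => P.IsExt e q p.2) h0) h1)
    (IsExt.zero P e))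

theorem add_neg_one_smul {E : Type*} [AddCommGroup E] [Module ℝ E] (x y : E) :
    x + (-1 : ℝ) • y = x - y := by
  rw [neg_one_smul, sub_eq_add_neg]

theorem Coupling.sub {q : H1 P.Ω} {ψ χ : H1Vec P.Ω} (h : P.Coupling q ψ) (h' : P.Coupling q χ) :
    P.Coupling 0 (ψ - χ) :=
  Eq.mp (congrArg₂ P.Coupling ((add_neg_one_smul q q).trans (sub_self q)) (add_neg_one_smul ψ χ))
    (Coupling.add P h (Coupling.smul P (-1) h'))

theorem mem_V0 {ψ : H1Vec P.Ω} (h : P.Coupling 0 ψ) : ((0 : H1 P.Ω), ψ) ∈ P.V0 := ⟨rfl, h⟩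

theorem mem_V1 {e : ZMod K} {q : H1 P.Ω} {ψ : H1Vec P.Ω} (hq : q ∈ P.Q) (h : P.IsExt e q ψ) :
    (q, ψ) ∈ P.V1 e := ⟨hq, h⟩

/-- Subtracting `ψ[q]` from `ψ` leaves a solution of the homogeneous coupling condition. -/
theorem mem_sup_of_coupling {e : ZMod K} (he : P.bc e = .clamped) {q : H1 P.Ω} {ψ : H1Vec P.Ω}
    (hq : q ∈ P.Q) (h : P.Coupling q ψ) : (q, ψ) ∈ P.V0 ⊔ P.V1 e := by
  have hex := P.exists_isExt e q
  obtain ⟨χ, hχ⟩ := hex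
  exact mem_sup_of_sub_mem (P.mem_V0 (Coupling.sub P h (P.coupling_of_isExt he hq hχ)))
    (P.mem_V1 hq hχ)

theorem V_le {e : ZMod K} (he : P.bc e = .clamped) : P.V ≤ P.V0 ⊔ P.V1 e :=
  fun p hp => P.mem_sup_of_coupling (q := p.1) (ψ := p.2) he hp.1 hp.2

theorem V0_sup_V1 {e : ZMod K} (he : P.bc e = .clamped) : P.V0 ⊔ P.V1 e = P.V := by
  refine le_antisymm (sup_le (fun p hp => ?_) (fun p hp => ?_)) (P.V_le he)
  · have h0 : p.1 = 0 := hp.1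
    have h1 : P.Coupling 0 p.2 := hp.2
    refine ⟨?_, Eq.mpr (congrArg (fun q => P.Coupling q p.2) h0) h1⟩
    exact Eq.mpr (congrArg (fun q => q ∈ P.Q) h0) P.Q.zero_mem
  · exact ⟨hp.1, P.coupling_of_isExt he hp.1 hp.2⟩

theorem continuous_setIntegral_L2 {α : Type*} [MeasurableSpace α] {μ : Measure α} {s : Set α}
    (hs : MeasurableSet s) (hμs : μ s ≠ ⊤) :
    Continuous fun f : Lp ℝ 2 μ => ∫ x in s, f x ∂μ := by
  simp only [← L2.inner_indicatorConstLp_one (𝕜 := ℝ) hs hμs]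
  exact continuous_const.inner continuous_id

theorem intervalIntegral_eq_setIntegral (i : ZMod K) {s : ℝ} (hs : s ∈ Icc 0 (P.len i))
    (f : P.L2Edge i) :
    ∫ r in (0 : ℝ)..s, f r = ∫ r in Ioo 0 s, f r ∂(volume.restrict (Ioo 0 (P.len i))) := by
  have h : (volume.restrict (Ioo 0 (P.len i))).restrict (Ioo 0 s) = volume.restrict (Ioo 0 s) := by
    rw [Measure.restrict_restrict measurableSet_Ioo, inter_eq_left.mpr (Ioo_subset_Ioo_right hs.2)]
  rw [intervalIntegral.integral_of_le hs.1, integral_Ioc_eq_integral_Ioo]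
  exact congrArg (fun μ : Measure ℝ => ∫ r, f r ∂μ) h.symm

theorem continuous_edgeIntegral (i : ZMod K) {s : ℝ} (hs : s ∈ Icc 0 (P.len i)) :
    Continuous fun q : H1 P.Ω => P.edgeIntegral q i s :=
  ((continuous_setIntegral_L2 measurableSet_Ioo (measure_ne_top _ _)).comp
    (P.continuous_trace_apply i)).congr fun q =>
      (P.intervalIntegral_eq_setIntegral i hs (P.trace q i)).symm

theorem continuous_cornerValue (e : ZMod K) (k : ℕ) :
    Continuous fun q : H1 P.Ω => P.cornerValue e q k := by
  unfold cornerValue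
  exact (continuous_finsetSum _ fun m _ =>
    (P.continuous_edgeIntegral _ (P.len_mem _)).smul continuous_const).neg

theorem continuous_psiGamma (e i : ZMod K) {s : ℝ} (hs : s ∈ Icc 0 (P.len i)) :
    Continuous fun q : H1 P.Ω => P.psiGamma e q i s := by
  unfold psiGamma
  split_ifs
  · exact (Continuous.const_smul (P.continuous_cornerValue e _) (1 - s / P.len e)).add
      (Continuous.const_smul (P.continuous_cornerValue e _) (s / P.len e))
  · exact (P.continuous_cornerValue e _).sub
      ((P.continuous_edgeIntegral i hs).smul continuous_const)

/-- The graph is closed: at each arc length parameter `ψ_Γ[q]` depends continuously on `q`, the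
traces of `ψ` converge in `L²`, and weak harmonicity is preserved under limits. -/
theorem isExt_of_tendsto {e : ZMod K} {q : ℕ → H1 P.Ω} {ψ : ℕ → H1Vec P.Ω} {q' : H1 P.Ω}
    {ψ' : H1Vec P.Ω} (h : ∀ n, P.IsExt e (q n) (ψ n)) (hq : Tendsto q atTop (𝓝 q'))
    (hψ : Tendsto ψ atTop (𝓝 ψ')) : P.IsExt e q' ψ' := by
  intro a
  have ha : Tendsto (fun n => ψ n a) atTop (𝓝 (ψ' a)) :=
    ((PiLp.continuous_apply 2 _ a).tendsto ψ').comp hψ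
  refine ⟨fun i => ?_, fun φ hφ => ?_⟩
  · refine ae_eq_of_tendsto_Lp (((P.continuous_trace_apply i).tendsto (ψ' a)).comp ha)
      (G := fun n s => P.psiGamma e (q n) i s a) (fun n => (h n a).1 i) ?_
    filter_upwards [ae_restrict_mem measurableSet_Ioo] with s hs
    have hc : Continuous fun q : H1 P.Ω => P.psiGamma e q i s a :=
      (PiLp.continuous_apply 2 _ a).comp (P.continuous_psiGamma e i (Ioo_subset_Icc_self hs))
    exact (hc.tendsto q').comp hq
  · have hc : Continuous fun u : H1 P.Ω => ∑ j : Fin 2, inner ℝ (H1.d u j) (H1.d φ j) :=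
      continuous_finsetSum _ fun j _ => (H1.continuous_d P.Ω j).inner continuous_const
    exact tendsto_nhds_unique ((hc.tendsto (ψ' a)).comp ha)
      (tendsto_const_nhds.congr fun n => ((h n a).2 φ hφ).symm)

theorem isClosed_Q : IsClosed (P.Q : Set (H1 P.Ω)) := by
  have e : (P.Q : Set (H1 P.Ω)) = ⋂ i, ⋂ (_ : P.bc i = .clamped ∨ P.bc i = .simplySupported),
      {u | P.trace u i = 0} := by
    ext u
    simp only [mem_iInter]
    rfl
  rw [e]
  exact isClosed_iInter fun i => isClosed_iInter fun _ =>
    isClosed_singleton.preimage (P.continuous_trace_apply i)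

/-- The closed graph theorem replaces an explicit estimate; its completeness hypothesis holds
because `Q` is a closed subspace of `H¹(Ω)`. -/
theorem exists_bound_isExt (e : ZMod K) : ∃ c : ℝ, 0 < c ∧ ∀ q ∈ P.Q, ∀ ψ : H1Vec P.Ω,
    P.IsExt e q ψ → ‖ψ‖ ≤ c * ‖q‖ := by
  have hcomp : CompleteSpace P.Q := P.isClosed_Q.completeSpace_coe
  have h := exists_bound_of_closed_graph (E := P.Q) (F := H1Vec P.Ω)
    (R := fun q ψ => P.IsExt e q.1 ψ) (fun q => P.exists_isExt e q.1)
    (fun q ψ χ h h' => P.isExt_unique h h') (fun q q' ψ ψ' h h' => IsExt.add P h h')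
    (fun c q ψ h => IsExt.smul P c h) (fun q ψ q' ψ' h hq hψ =>
      P.isExt_of_tendsto h ((continuous_subtype_val.tendsto q').comp hq) hψ)
  obtain ⟨c, hc, h⟩ := h
  exact ⟨c, hc, fun q hq ψ hψ => h ⟨q, hq⟩ ψ hψ⟩

end PlateDomain
end Plate
end

theorem mainTheorem6 {K : ℕ} [NeZero K] (P : Plate.PlateDomain K) (e : ZMod K)
    (he : P.bc e = Plate.BC.clamped) :
    (∀ q ∈ P.Q, ∃! ψ : Plate.H1Vec P.Ω, P.IsExt e q ψ) ∧
    (∀ q ∈ P.Q, ∀ ψ : Plate.H1Vec P.Ω, P.IsExt e q ψ → ψ ∈ P.Psi q) ∧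
    (P.V0 ⊓ P.V1 e = ⊥ ∧ P.V0 ⊔ P.V1 e = P.V) ∧
    ∃ c : ℝ, 0 < c ∧ ∀ q ∈ P.Q, ∀ ψ : Plate.H1Vec P.Ω, P.IsExt e q ψ → ‖ψ‖ ≤ c * ‖q‖ :=
  ⟨fun q _ => by
    obtain ⟨ψ, hψ⟩ := P.exists_isExt e q
    exact ⟨ψ, hψ, fun _ h => P.isExt_unique h hψ⟩,
    fun _ hq _ h => P.coupling_of_isExt he hq h, ⟨P.V0_inf_V1 e, P.V0_sup_V1 he⟩,
    P.exists_bound_isExt e⟩
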